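/- Let $G=SO_0(4,1)$ be the identity component of the isometry group of $x_0^2+x_1^2+x_2^2+x_3^2-x_4^2$ on $\mathbb R^5$, let $G'=SO_0(3,1)\subset G$ be the stabilizer of ${}^t(0,0,0,1,0)$, and let $\mathfrak g=\mathfrak{so}(5,\mathbb C)$, $\mathfrak g'$ be the complexified Lie algebras. With the elementary matrices $E_{p,q}$ $(1\le p,q\le 5)$ put $H_0=E_{1,5}+E_{5,1}$, $C_j^{\pm}=-E_{1,j+1}+E_{j+1,1}\mp E_{5,j+1}\mp E_{j+1,5}$ $(j=1,2,3)$ and $\mathfrak n_\pm=\ker(\mathrm{ad}(H_0)\mp\mathrm{id})=\bigoplus_j\mathbb C\,C_j^\pm$, $\mathfrak l=\ker \mathrm{ad}(H_0)=\mathfrak m\oplus\mathbb C H_0$ with $\mathfrak m\simeq\mathfrak{so}(3,\mathbb C)$, $\mathfrak n_+'=\mathfrak n_+\cap\mathfrak g'$. Let $A=\exp(\mathbb R H_0)$, $M\simeq SO(3)$ (acting on the coordinates $x_1,x_2,x_3$), $L=MA$, and $L'=M'A$, where $M'\simeq SO(2)\subset SO(3)$ consists of the rotations of the coordinates $x_1,x_2$.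 Write $\mathbb N=\{0,1,2,\dots\}$, and $[x]$ for the largest integer $\le x$. Let $V^3$ be the space of homogeneous polynomials of degree $2$ in $\xi_1,\xi_2$, with basis $u_1=\xi_1^2,\ u_2=\xi_1\xi_2,\ u_3=\xi_2^2$, and let $\sigma^3$ be the representation of $SO(3)$ on $V^3$ through which the action $p\mapsto p(g^{-1}\,\cdot)$ of $SU(2)$ factors by the covering $$\varpi\begin{pmatrix}x&y\\-\overline y&\overline x\end{pmatrix}=\begin{pmatrix}\mathrm{Re}(x^2-y^2)&\mathrm{Im}(x^2+y^2)&-2\mathrm{Re}(xy)\\-\mathrm{Im}(x^2-y^2)&\mathrm{Re}(x^2+y^2)&2\mathrm{Im}(xy)\\2\mathrm{Re}(x\overline y)&2\mathrm{Im}(x\overline y)&|x|^2-|y|^2\end{pmatrix}.$$ For $\lambda,\nu\in\mathbb C$ and $m\in\mathbb Z$ let $\sigma^3_\lambda(B\exp(tH_0))=e^{\lambda t}\sigma^3(B)$ on $L$, and let $\tau_{m,\nu}$ be the character of $L'$ on $\mathbb C_{m,\nu}=\mathbb C$ that sends the product of the rotation by the angle $s$ and $\exp(tH_0)$ to $e^{ims}e^{\nu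 t}$. Let $\mu=(\sigma^3)^\vee\boxtimes\mathbb C_{3-\lambda}$, so that $d\mu(X+cH_0)=-\,{}^t d\sigma^3(X)+(3-\lambda)c$ on $(V^3)^\vee$ for $X\in\mathfrak m$, $c\in\mathbb C$. Let $G_{\mathbb C}=SO(5,\mathbb C)$ be the special orthogonal group of the quadratic form above, $L_{\mathbb C}$ the centralizer of $H_0$ in it, and write $g=\exp(p_-(g))\,p_0(g)\,\exp(p_+(g))$, with $p_\pm(g)\in\mathfrak n_\pm$ and $p_0(g)\in L_{\mathbb C}$, on the open dense set where this is possible. For $Y\in\mathfrak g$ and $Z\in\mathfrak n_-$ put $\alpha(Y,Z)=\frac{d}{dt}\big|_{t=0}p_0(e^{tY}e^Z)\in\mathfrak l$ and $\beta(Y,Z)=\frac{d}{dt}\big|_{t=0}p_-(e^{tY}e^Z)\in\mathfrak n_-$, and define $d\pi_\mu(Y)\in\mathcal D(\mathfrak n_-)\otimes\mathrm{End}((V^3)^\vee)$, where $\mathcal D$ denotes the Weyl algebra (differential operators with polynomial coefficients), by $$(d\pi_\mu(Y)F)(Z)=d\mu(\alpha(Y,Z))F(Z)-(\beta(Y,\cdot)F)(Z),$$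 $\beta(Y,\cdot)$ being regarded as a vector field on $\mathfrak n_-$. Let $z_j$ and $\zeta_j$ be the coordinates of $\mathfrak n_-$ and $\mathfrak n_+$ in the bases $C_j^-$ and $C_j^+$, and let $\widehat{d\pi_\mu}(Y)\in\mathcal D(\mathfrak n_+)\otimes\mathrm{End}((V^3)^\vee)$ be the image of $d\pi_\mu(Y)$ under the algebra isomorphism with $\frac{\partial}{\partial z_j}\mapsto-\zeta_j$, $z_j\mapsto\frac{\partial}{\partial\zeta_j}$. On $\mathrm{Pol}(\mathfrak n_+)=\mathbb C[\zeta_1,\zeta_2,\zeta_3]$ put $\mathrm{Ad}_\#(\ell)p=p(\mathrm{Ad}(\ell^{-1})\,\cdot)$. Finally let $\mathrm{Sol}(\mathfrak n_+;\sigma^3_\lambda,\tau_{m,\nu})$ be the space of all linear maps $\psi\in\mathrm{Hom}_{\mathbb C}(V^3,\mathbb C_{m,\nu}\otimes\mathrm{Pol}(\mathfrak n_+))$ such that $$\psi\circ\sigma^3_\lambda(\ell)=\tau_{m,\nu}(\ell)\,\mathrm{Ad}_\#(\ell)\,\psi\quad(\forall\,\ell\in L'),\qquad \bigl(\widehat{d\pi_\mu}(C)\otimes\mathrm{id}\bigr)\psi=0\quad(\forall\,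 C\in\mathfrak n_+').$$ For $\mu\in\mathbb C$ and $\ell\in\mathbb N$ let $$\widetilde C^\mu_\ell(z)=\frac{1}{\Gamma(\mu+[\frac{\ell+1}2])}\sum_{k=0}^{[\ell/2]}(-1)^k\frac{\Gamma(\mu+\ell-k)}{k!\,(\ell-2k)!}(2z)^{\ell-2k}$$ (the quotients of Gamma values being read as polynomials in $\mu$), $\widetilde C^\mu_\ell=0$ for $\ell<0$, and $\gamma(\mu,\ell)=1$ for $\ell$ odd, $\gamma(\mu,\ell)=\mu+\frac\ell2$ for $\ell$ even. For $g\in\mathrm{span}\{t^{b-2j}:0\le j\le[b/2]\}$ let $(T_bg)(\zeta)=(\zeta_1^2+\zeta_2^2)^{b/2}\,g\bigl(\zeta_3/\sqrt{\zeta_1^2+\zeta_2^2}\bigr)$, a polynomial, and $T_b0=0$ for $b<0$. For $m\ge1$ and $k\in\{m-1,m,m+1\}$ let $h_k^+:V^3\to\mathbb C_{m,\nu}\otimes\mathrm{Pol}(\mathfrak n_+)$ send $u_{k-m+2}$ to $(\zeta_1+i\zeta_2)^k$ and the other two basis vectors to $0$. **Theorem.** Let $\lambda,\nu\in\mathbb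 C$ and let $m\ge1$ be an integer. The following are equivalent: (i) $\mathrm{Sol}(\mathfrak n_+;\sigma^3_\lambda,\tau_{m,\nu})\ne\{0\}$; (ii) $\dim_{\mathbb C}\mathrm{Sol}(\mathfrak n_+;\sigma^3_\lambda,\tau_{m,\nu})=1$; (iii) either $m=1$ and $\nu-\lambda\in\mathbb N$, or $m>1$, $\lambda\in\mathbb Z$, $\lambda\le1-m$ and $\nu\in\{0,1,2\}$. If these conditions hold, then $a:=\nu-\lambda$ is an integer with $a\ge m-1$, and $$\mathrm{Sol}(\mathfrak n_+;\sigma^3_\lambda,\tau_{m,\nu})=\mathbb C\sum_{k=m-1}^{m+1}(T_{a-k}g_k)\,h_k^+,$$ where $(g_{m-1}(t),g_m(t),g_{m+1}(t))$ is the following triple. * If $a=m-1$: $(1,0,0)$. * If $m=1$ and $a>0$: $\Bigl(-\bigl(\lambda+[\tfrac{a-1}2]\bigr)\widetilde C^\lambda_a(it),\ -i\gamma(\lambda-1,a)\widetilde C^\lambda_{a-1}(it),\ \widetilde C^\lambda_{a-2}(it)\Bigr)$. * If $m>1$ and $a>m-1$: $\Bigl((-1)^{\nu+1}iAB\,\widetilde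 C^\lambda_{a-m+1-2\nu}(it),\ -C\,\widetilde C^{\lambda-1}_{a-m}(it)+iBt\,\widetilde C^\lambda_{a-m-1}(it),\ iB\,\widetilde C^\lambda_{a-m-1}(it)\Bigr)$, with $A=(-1)^\nu\bigl(\lambda+[\tfrac{-\lambda-m}2]\bigr)^{1-\nu}$, $B=-2\gamma(\lambda-1,a-m)$, $C=m(\nu-1)+\lambda-2$. -/

import Mathlib

open scoped TensorProduct

noncomputable section

namespace FSystem

/-! ## The Weyl algebra and the algebraic Fourier transform -/

/-- Defining relations of the Weyl algebra in `n` variables: the generator `Sum.inl j` is the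
`j`-th coordinate, the generator `Sum.inr j` is the `j`-th partial derivative. -/
inductive WeylRel (n : ℕ) :
    FreeAlgebra ℂ (Fin n ⊕ Fin n) → FreeAlgebra ℂ (Fin n ⊕ Fin n) → Prop
  | coord_comm (i j : Fin n) : WeylRel n
      (FreeAlgebra.ι ℂ (Sum.inl i) * FreeAlgebra.ι ℂ (Sum.inl j))
      (FreeAlgebra.ι ℂ (Sum.inl j) * FreeAlgebra.ι ℂ (Sum.inl i))
  | del_comm (i j : Fin n) : WeylRel n
      (FreeAlgebra.ι ℂ (Sum.inr i) * FreeAlgebra.ι ℂ (Sum.inr j))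
      (FreeAlgebra.ι ℂ (Sum.inr j) * FreeAlgebra.ι ℂ (Sum.inr i))
  | leibniz (i j : Fin n) : WeylRel n
      (FreeAlgebra.ι ℂ (Sum.inr i) * FreeAlgebra.ι ℂ (Sum.inl j))
      (FreeAlgebra.ι ℂ (Sum.inl j) * FreeAlgebra.ι ℂ (Sum.inr i) + (if i = j then 1 else 0))

/-- The Weyl algebra: differential operators with polynomial coefficients in `n` variables. -/
def Weyl (n : ℕ) : Type := RingQuot (WeylRel n)

instance (n : ℕ) : Ring (Weyl n) := inferInstanceAs (Ring (RingQuot (WeylRel n)))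

instance (n : ℕ) : Algebra ℂ (Weyl n) := inferInstanceAs (Algebra ℂ (RingQuot (WeylRel n)))

/-- The quotient map from the free algebra to the Weyl algebra. -/
def Weyl.mk (n : ℕ) : FreeAlgebra ℂ (Fin n ⊕ Fin n) →ₐ[ℂ] Weyl n :=
  RingQuot.mkAlgHom ℂ (WeylRel n)

theorem Weyl.mk_rel {n : ℕ} {x y : FreeAlgebra ℂ (Fin n ⊕ Fin n)} (h : WeylRel n x y) :
    Weyl.mk n x = Weyl.mk n y := RingQuot.mkAlgHom_rel ℂ h

/-- Multiplication by the `j`-th coordinate. -/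
def Weyl.coord {n : ℕ} (j : Fin n) : Weyl n := Weyl.mk n (FreeAlgebra.ι ℂ (Sum.inl j))

/-- The `j`-th partial derivative. -/
def Weyl.del {n : ℕ} (j : Fin n) : Weyl n := Weyl.mk n (FreeAlgebra.ι ℂ (Sum.inr j))

theorem Weyl.coord_mul_coord {n : ℕ} (i j : Fin n) :
    Weyl.coord i * Weyl.coord j = Weyl.coord j * Weyl.coord i := by
  have h := Weyl.mk_rel (WeylRel.coord_comm i j)
  rw [map_mul, map_mul] at h
  exact h

theorem Weyl.del_mul_del {n : ℕ} (i j : Fin n) :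
    Weyl.del i * Weyl.del j = Weyl.del j * Weyl.del i := by
  have h := Weyl.mk_rel (WeylRel.del_comm i j)
  rw [map_mul, map_mul] at h
  exact h

theorem Weyl.del_mul_coord {n : ℕ} (i j : Fin n) :
    Weyl.del i * Weyl.coord j
      = Weyl.coord j * Weyl.del i + (if i = j then 1 else 0) := by
  have h := Weyl.mk_rel (WeylRel.leibniz i j)
  rw [map_mul, map_add, map_mul, apply_ite (Weyl.mk n), map_one,
    map_zero] at h
  exact h

/-- The universal property of the Weyl algebra. -/
def Weyl.lift {n : ℕ} {A : Type*} [Ring A] [Algebra ℂ A] (x d : Fin n → A)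
    (hx : ∀ i j, x i * x j = x j * x i) (hd : ∀ i j, d i * d j = d j * d i)
    (hdx : ∀ i j, d i * x j = x j * d i + (if i = j then 1 else 0)) : Weyl n →ₐ[ℂ] A :=
  RingQuot.liftAlgHom ℂ ⟨FreeAlgebra.lift ℂ (Sum.elim x d), by
    intro a b h
    induction h with
    | coord_comm i j => simpa using hx i j
    | del_comm i j => simpa using hd i j
    | leibniz i j =>
      simp only [map_mul, map_add, FreeAlgebra.lift_ι_apply, Sum.elim_inl, Sum.elim_inr, hdx i j]
      split_ifs <;> simp⟩

theorem Weyl.lift_coord {n : ℕ} {A : Type*} [Ring A] [Algebra ℂ A] (x d : Fin n → A)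
    (hx : ∀ i j, x i * x j = x j * x i) (hd : ∀ i j, d i * d j = d j * d i)
    (hdx : ∀ i j, d i * x j = x j * d i + (if i = j then 1 else 0)) (j : Fin n) :
    Weyl.lift x d hx hd hdx (Weyl.coord j) = x j := by
  refine (RingQuot.liftAlgHom_mkAlgHom_apply ℂ _ _ _).trans ?_
  simp

theorem Weyl.lift_del {n : ℕ} {A : Type*} [Ring A] [Algebra ℂ A] (x d : Fin n → A)
    (hx : ∀ i j, x i * x j = x j * x i) (hd : ∀ i j, d i * d j = d j * d i)
    (hdx : ∀ i j, d i * x j = x j * d i + (if i = j then 1 else 0)) (j : Fin n) :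
    Weyl.lift x d hx hd hdx (Weyl.del j) = d j := by
  refine (RingQuot.liftAlgHom_mkAlgHom_apply ℂ _ _ _).trans ?_
  simp

/-- The algebraic Fourier transform, from the Weyl algebra on `E` to the Weyl algebra on the dual
space: the partial derivative in `z_j` goes to `-ζ_j`, and the coordinate `z_j` goes to the
partial derivative in `ζ_j`. -/
def Weyl.fourier (n : ℕ) : Weyl n →ₐ[ℂ] Weyl n :=
  Weyl.lift (fun j => Weyl.del j) (fun j => -Weyl.coord j)
    (fun i j => Weyl.del_mul_del i j)
    (fun i j => by rw [neg_mul_neg, neg_mul_neg, Weyl.coord_mul_coord i j])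
    (fun i j => by
      have h : (if j = i then 1 else 0 : Weyl n) = if i = j then 1 else 0 := by
        simp only [eq_comm]
      rw [mul_neg, Weyl.del_mul_coord j i, neg_mul, h]
      abel)

theorem pderiv_pderiv {n : ℕ} (i j : Fin n) (p : MvPolynomial (Fin n) ℂ) :
    MvPolynomial.pderiv i (MvPolynomial.pderiv j p)
      = MvPolynomial.pderiv j (MvPolynomial.pderiv i p) := by
  have h : ⁅MvPolynomial.pderiv (R := ℂ) i, MvPolynomial.pderiv (R := ℂ) j⁆ = 0 := by
    apply MvPolynomial.derivation_ext
    intro k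
    rw [Derivation.commutator_apply, MvPolynomial.pderiv_X, MvPolynomial.pderiv_X,
      Pi.single_apply, Pi.single_apply]
    split_ifs <;> simp
  have h2 : ⁅MvPolynomial.pderiv (R := ℂ) i, MvPolynomial.pderiv (R := ℂ) j⁆ p = 0 := by
    rw [h, Derivation.zero_apply]
  rw [Derivation.commutator_apply] at h2
  exact sub_eq_zero.mp h2

/-- The Weyl algebra acts on polynomials by differential operators. -/
def Weyl.act (n : ℕ) : Weyl n →ₐ[ℂ] Module.End ℂ (MvPolynomial (Fin n) ℂ) :=
  Weyl.lift (fun j => LinearMap.mulLeft ℂ (MvPolynomial.X j))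
    (fun j => (MvPolynomial.pderiv j).toLinearMap)
    (fun i j => LinearMap.ext fun p =>
      mul_left_comm (MvPolynomial.X i) (MvPolynomial.X j) p)
    (fun i j => LinearMap.ext fun p => pderiv_pderiv i j p)
    (fun i j => by
      refine LinearMap.ext fun p => ?_
      rw [Module.End.mul_apply, LinearMap.add_apply, Module.End.mul_apply,
        LinearMap.mulLeft_apply, LinearMap.mulLeft_apply]
      change MvPolynomial.pderiv i (MvPolynomial.X j * p)
        = MvPolynomial.X j * MvPolynomial.pderiv i p + _
      rw [Derivation.leibniz, MvPolynomial.pderiv_X]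
      by_cases h : i = j
      · subst h
        simp
      · simp [h])

/-- A polynomial, viewed as an element of the Weyl algebra: the monomial with exponents `s` goes to
the product of the powers `s j` of the coordinates. -/
def Weyl.ofPoly {n : ℕ} : MvPolynomial (Fin n) ℂ →ₗ[ℂ] Weyl n :=
  (MvPolynomial.basisMonomials (Fin n) ℂ).constr ℂ fun s =>
    (List.ofFn fun j => Weyl.coord j ^ s j).prod

open Classical in
/-- The polynomial that represents a polynomial function on `ℂⁿ` (it is unique). -/
def polyOf {n : ℕ} (f : (Fin n → ℂ) → ℂ) : MvPolynomial (Fin n) ℂ :=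
  if h : ∃ p : MvPolynomial (Fin n) ℂ, ∀ z, MvPolynomial.eval z p = f z then h.choose else 0

/-! ## The Lie algebra `𝔤 = 𝔰𝔬(5, ℂ)`, the complexification of `𝔰𝔬(4, 1)`

Rows and columns are numbered from `0` to `4`. -/

/-- The Gram matrix of `x₀² + x₁² + x₂² + x₃² - x₄²`. -/
def J : Matrix (Fin 5) (Fin 5) ℂ := Matrix.diagonal ![1, 1, 1, 1, -1]

/-- The generator `H₀` of `𝔞`. -/
def H0 : Matrix (Fin 5) (Fin 5) ℂ := Matrix.single 0 4 1 + Matrix.single 4 0 1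

/-- The position `1, 2, 3` in `ℂ⁵` of the indices `0, 1, 2` of `ℂ³`. -/
def mid (j : Fin 3) : Fin 5 := j.succ.castSucc

/-- The basis `C_j⁺` of `𝔫₊`. -/
def Cplus (j : Fin 3) : Matrix (Fin 5) (Fin 5) ℂ :=
  -Matrix.single 0 (mid j) 1 + Matrix.single (mid j) 0 1
    - Matrix.single 4 (mid j) 1 - Matrix.single (mid j) 4 1

/-- The basis `C_j⁻` of `𝔫₋`. -/
def Cminus (j : Fin 3) : Matrix (Fin 5) (Fin 5) ℂ :=
  -Matrix.single 0 (mid j) 1 + Matrix.single (mid j) 0 1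
    + Matrix.single 4 (mid j) 1 + Matrix.single (mid j) 4 1

/-- The elements `X_{p,q} = E_{q,p} - E_{p,q}` of `𝔰𝔬(3)`. -/
def Xso (p q : Fin 3) : Matrix (Fin 3) (Fin 3) ℝ :=
  Matrix.single q p 1 - Matrix.single p q 1

/-- The embedding of `3 × 3` matrices in the central block, with `c` in the two outer diagonal
places: `c = 1` embeds `SO(3)` as `M`, and `c = 0` embeds `𝔰𝔬(3)` as `𝔪`. -/
def embed (c : ℂ) (B : Matrix (Fin 3) (Fin 3) ℝ) : Matrix (Fin 5) (Fin 5) ℂ :=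
  !![c, 0, 0, 0, 0;
     0, B 0 0, B 0 1, B 0 2, 0;
     0, B 1 0, B 1 1, B 1 2, 0;
     0, B 2 0, B 2 1, B 2 2, 0;
     0, 0, 0, 0, c]

/-- The element of `𝔫₋` with coordinates `z` in the basis `C_j⁻`. -/
def nMinus (z : Fin 3 → ℂ) : Matrix (Fin 5) (Fin 5) ℂ := ∑ j, z j • Cminus j

/-- The element of `𝔫₊` with coordinates `w` in the basis `C_j⁺`. -/
def nPlus (w : Fin 3 → ℂ) : Matrix (Fin 5) (Fin 5) ℂ := ∑ j, w j • Cplus j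

/-- The coordinates, in the basis `C_j⁺`, of an element of `𝔫₊`. -/
def coordPlus (X : Matrix (Fin 5) (Fin 5) ℂ) : Fin 3 → ℂ := fun j => X (mid j) 0

theorem coordPlus_nPlus (w : Fin 3 → ℂ) : coordPlus (nPlus w) = w := by
  funext k
  fin_cases k <;>
    simp [coordPlus, nPlus, Cplus, mid, Fin.sum_univ_three]

/-- `𝔫₊' = 𝔫₊ ∩ 𝔤'` (complexified): the elements `X` of `𝔤` with `[H₀, X] = X` that annihilate the
vector `(0, 0, 0, 1, 0)`, whose stabilizer is `G'`. -/
def nPlusPrime : Set (Matrix (Fin 5) (Fin 5) ℂ) :=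
  {X | X.transpose * J + J * X = 0 ∧ H0 * X - X * H0 = X ∧ X.mulVec (Pi.single 3 1) = 0}

/-- The complex Levi subgroup `L_ℂ`: the centralizer of `H₀` in `G_ℂ = SO(5, ℂ)`, the special
orthogonal group of the quadratic form above. -/
def leviC : Set (Matrix (Fin 5) (Fin 5) ℂ) :=
  {l | l.transpose * J * l = J ∧ l.det = 1 ∧ l * H0 = H0 * l}

/-- The Gelfand--Naimark factorization `g = exp(p₋(g)) p₀(g) exp(p₊(g))`, with `p₋(g)` and `p₊(g)`
in coordinates. Such a factorization is unique when it exists. -/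
def IsGelfandNaimark (g : Matrix (Fin 5) (Fin 5) ℂ) (z : Fin 3 → ℂ)
    (l : Matrix (Fin 5) (Fin 5) ℂ) (w : Fin 3 → ℂ) : Prop :=
  l ∈ leviC ∧ NormedSpace.exp (nMinus z) * l * NormedSpace.exp (nPlus w) = g

open Classical in
/-- The projection `p₋`, in coordinates (with value `0` outside of the regular set). -/
def pMinus (g : Matrix (Fin 5) (Fin 5) ℂ) : Fin 3 → ℂ :=
  if h : ∃ z l w, IsGelfandNaimark g z l w then h.choose else 0

open Classical in
/-- The projection `p₀` (with value `1` outside of the regular set). -/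
def pZero (g : Matrix (Fin 5) (Fin 5) ℂ) : Matrix (Fin 5) (Fin 5) ℂ :=
  if h : ∃ l z w, IsGelfandNaimark g z l w then h.choose else 1

/-- `α(Y, Z)`, the derivative at `t = 0` of `p₀(exp(tY) exp(Z))`; here `Z` has coordinates `z`. -/
def alpha (Y : Matrix (Fin 5) (Fin 5) ℂ) (z : Fin 3 → ℂ) : Matrix (Fin 5) (Fin 5) ℂ :=
  Matrix.of fun i j => deriv (fun t : ℂ =>
    pZero (NormedSpace.exp (t • Y) * NormedSpace.exp (nMinus z)) i j) 0

/-- `β(Y, Z)`, the derivative at `t = 0` of `p₋(exp(tY) exp(Z))`, in coordinates; here `Z` has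
coordinates `z`. -/
def beta (Y : Matrix (Fin 5) (Fin 5) ℂ) (z : Fin 3 → ℂ) : Fin 3 → ℂ :=
  fun j => deriv (fun t : ℂ =>
    pMinus (NormedSpace.exp (t • Y) * NormedSpace.exp (nMinus z)) j) 0

/-! ## The three-dimensional representation of `SO(3)` -/

/-- `V³`: homogeneous polynomials of degree `2` in two variables. -/
abbrev V3 : Type := MvPolynomial.homogeneousSubmodule (Fin 2) ℂ 2

/-- The exponent of the monomial `ξ₁^a ξ₂^b`. -/
def expo (a b : ℕ) : Fin 2 →₀ ℕ := Finsupp.single 0 a + Finsupp.single 1 b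

theorem expo_eq_iff (a b : ℕ) (e : Fin 2 →₀ ℕ) : expo a b = e ↔ a = e 0 ∧ b = e 1 := by
  rw [Finsupp.ext_iff, Fin.forall_fin_two]
  simp [expo]

/-- Coefficients of `ξ₁²`, `ξ₁ξ₂`, `ξ₂²`. -/
def V3.coords : V3 ≃ₗ[ℂ] (Fin 3 → ℂ) where
  toFun p := ![MvPolynomial.coeff (expo 2 0) p.1, MvPolynomial.coeff (expo 1 1) p.1,
    MvPolynomial.coeff (expo 0 2) p.1]
  map_add' p q := by
    funext i
    fin_cases i <;> simp
  map_smul' c p := by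
    funext i
    fin_cases i <;> simp
  invFun c := ⟨MvPolynomial.monomial (expo 2 0) (c 0) + MvPolynomial.monomial (expo 1 1) (c 1)
      + MvPolynomial.monomial (expo 0 2) (c 2), by
    rw [MvPolynomial.mem_homogeneousSubmodule]
    refine ((MvPolynomial.isHomogeneous_monomial _ ?_).add
      (MvPolynomial.isHomogeneous_monomial _ ?_)).add
      (MvPolynomial.isHomogeneous_monomial _ ?_) <;> simp [expo, map_add]⟩
  left_inv p := by
    apply Subtype.ext
    apply MvPolynomial.ext
    intro d
    have hd : expo (d 0) (d 1) = d := (expo_eq_iff _ _ _).mpr ⟨rfl, rfl⟩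
    simp only [MvPolynomial.coeff_add, MvPolynomial.coeff_monomial, expo_eq_iff]
    by_cases hdeg : d 0 + d 1 = 2
    · have hcases : (d 0 = 2 ∧ d 1 = 0) ∨ (d 0 = 1 ∧ d 1 = 1) ∨ (d 0 = 0 ∧ d 1 = 2) := by omega
      rcases hcases with ⟨ha, hb⟩ | ⟨ha, hb⟩ | ⟨ha, hb⟩ <;>
        · rw [ha, hb] at hd
          simp [ha, hb, hd]
    · have hz : MvPolynomial.coeff d p.1 = 0 :=
        MvPolynomial.IsHomogeneous.coeff_eq_zero p.2 (by
          rw [Finsupp.degree_eq_sum, Fin.sum_univ_two]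
          exact hdeg)
      rw [hz, if_neg (by omega), if_neg (by omega), if_neg (by omega)]
      simp
  right_inv c := by
    funext i
    have e (a b a' b' : ℕ) : expo a b = expo a' b' ↔ a = a' ∧ b = b' := by
      rw [expo_eq_iff]
      simp [expo]
    fin_cases i <;> simp [MvPolynomial.coeff_monomial, e]

/-- The basis `u₁ = ξ₁²`, `u₂ = ξ₁ξ₂`, `u₃ = ξ₂²` of `V³`. -/
def u : Module.Basis (Fin 3) ℂ V3 := Module.Basis.ofEquivFun V3.coords

theorem coe_u (i : Fin 3) : (u i : MvPolynomial (Fin 2) ℂ)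
    = ![MvPolynomial.X 0 ^ 2, MvPolynomial.X 0 * MvPolynomial.X 1, MvPolynomial.X 1 ^ 2] i := by
  have h : u i = V3.coords.symm (Pi.single i 1) := by
    simp [u, Module.Basis.coe_ofEquivFun]
  have hm : (MvPolynomial.monomial (expo 1 1) (1 : ℂ) :
      MvPolynomial (Fin 2) ℂ) = MvPolynomial.X 0 * MvPolynomial.X 1 := by
    simp [MvPolynomial.X, MvPolynomial.monomial_mul, expo]
  have hx : (u i : MvPolynomial (Fin 2) ℂ)
      = MvPolynomial.monomial (expo 2 0) ((Pi.single i 1 : Fin 3 → ℂ) 0)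
      + MvPolynomial.monomial (expo 1 1) ((Pi.single i 1 : Fin 3 → ℂ) 1)
      + MvPolynomial.monomial (expo 0 2) ((Pi.single i 1 : Fin 3 → ℂ) 2) := by
    rw [h]
    rfl
  rw [hx]
  rw [← mul_one ((Pi.single i 1 : Fin 3 → ℂ) 1), ← MvPolynomial.C_mul_monomial, hm]
  fin_cases i <;> simp [MvPolynomial.X_pow_eq_monomial, expo]

/-- The action `p ↦ p(g⁻¹ ·)` of `2 × 2` matrices on `V³`. -/
def theta (g : Matrix (Fin 2) (Fin 2) ℂ) : V3 →ₗ[ℂ] V3 :=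
  ((MvPolynomial.aeval fun i : Fin 2 =>
      ∑ j, MvPolynomial.C (g⁻¹ i j) * (MvPolynomial.X j : MvPolynomial (Fin 2) ℂ)).toLinearMap
    ).restrict (p := MvPolynomial.homogeneousSubmodule (Fin 2) ℂ 2)
      (q := MvPolynomial.homogeneousSubmodule (Fin 2) ℂ 2) (by
    intro p hp
    rw [MvPolynomial.mem_homogeneousSubmodule] at hp ⊢
    have h := hp.aeval (fun i : Fin 2 =>
      ∑ j, MvPolynomial.C (g⁻¹ i j) * (MvPolynomial.X j : MvPolynomial (Fin 2) ℂ)) (n := 1)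
      (fun i => MvPolynomial.IsHomogeneous.sum _ _ _ fun j _ =>
        MvPolynomial.isHomogeneous_C_mul_X _ j)
    simpa using h)

/-- The covering map `SU(2) → SO(3)`; here `x = g 0 0` and `y = g 0 1` are the entries of the first
row of an element of `SU(2)`. -/
def varpi (g : Matrix (Fin 2) (Fin 2) ℂ) : Matrix (Fin 3) (Fin 3) ℝ :=
  let x := g 0 0
  let y := g 0 1
  !![(x ^ 2 - y ^ 2).re, (x ^ 2 + y ^ 2).im, -2 * (x * y).re;
     -(x ^ 2 - y ^ 2).im, (x ^ 2 + y ^ 2).re, 2 * (x * y).im;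
     2 * (x * star y).re, 2 * (x * star y).im, Complex.normSq x - Complex.normSq y]

open Classical in
/-- The representation `σ³` of `SO(3)` on `V³`: the element `B` acts as any preimage of `B` in
`SU(2)` does (the two preimages differ by a sign, which acts trivially on `V³`). -/
def sigma3 (B : Matrix (Fin 3) (Fin 3) ℝ) : V3 →ₗ[ℂ] V3 :=
  if h : ∃ g ∈ Matrix.specialUnitaryGroup (Fin 2) ℂ, varpi g = B then theta h.choose else 0

/-- The differential of `σ³` at `S ∈ 𝔰𝔬(3)`: the derivative at `t = 0` of `σ³(exp(tS))`, taken
entrywise in the basis `u`. -/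
def dsigma3Real (S : Matrix (Fin 3) (Fin 3) ℝ) : V3 →ₗ[ℂ] V3 :=
  Matrix.toLin u u (Matrix.of fun i j =>
    deriv (fun t : ℝ => u.repr (sigma3 (NormedSpace.exp (t • S)) (u j)) i) 0)

/-- The differential `dμ` of `μ = (σ³)^∨ ⊠ ℂ_{2ρ-λ}` on `𝔩 = 𝔪 + 𝔞` (complexified), with values in
the endomorphisms of `(V³)^∨`. An element `X` of `𝔩` is `X 0 4 • H₀` plus the sum over `p < q` of
`X (mid q) (mid p)` times the image of `X_{p,q}` in `𝔪`. The action on `(V³)^∨` is contragredient,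
and `2ρ(H₀) = 3` is the trace of `ad H₀`, the identity, on the three-dimensional `𝔫₊`. -/
def dmu (lam : ℂ) (X : Matrix (Fin 5) (Fin 5) ℂ) : Module.End ℂ (Module.Dual ℂ V3) :=
  ((3 - lam) * X 0 4) • LinearMap.id
    - (∑ p : Fin 3, ∑ q ∈ Finset.Ioi p, X (mid q) (mid p) • dsigma3Real (Xso p q)).dualMap

/-! ## The F-system -/

/-- The infinitesimal action `dπ_μ(Y)`, a differential operator on `𝔫₋` with values in
endomorphisms of `(V³)^∨`, given by
`(dπ_μ(Y)F)(Z) = dμ(α(Y, Z)) F(Z) - (β(Y, ·)F)(Z)`;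
`α(Y, Z)` is expanded in the basis of `𝔩` and `β(Y, Z)` in that of `𝔫₋`. -/
def dpi (lam : ℂ) (Y : Matrix (Fin 5) (Fin 5) ℂ) :
    Weyl 3 ⊗[ℂ] Module.End ℂ (Module.Dual ℂ V3) :=
  Weyl.ofPoly (polyOf fun z => alpha Y z 0 4) ⊗ₜ dmu lam H0
    + (∑ p : Fin 3, ∑ q ∈ Finset.Ioi p,
        Weyl.ofPoly (polyOf fun z => alpha Y z (mid q) (mid p)) ⊗ₜ dmu lam (embed 0 (Xso p q)))
    - ∑ j : Fin 3, (Weyl.ofPoly (polyOf fun z => beta Y z j) * Weyl.del j) ⊗ₜ LinearMap.id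

/-- The Fourier transform of `dπ_μ(Y)`, a differential operator on `𝔫₊`. -/
def dpiHat (lam : ℂ) (Y : Matrix (Fin 5) (Fin 5) ℂ) :
    Weyl 3 ⊗[ℂ] Module.End ℂ (Module.Dual ℂ V3) :=
  TensorProduct.map (Weyl.fourier 3).toLinearMap LinearMap.id (dpi lam Y)

/-- `Pol(𝔫₊)`, polynomials in the coordinates `ζ₁, ζ₂, ζ₃` with respect to the basis `C_j⁺`. -/
abbrev Pol : Type := MvPolynomial (Fin 3) ℂ

/-- The action of a differential operator on `𝔫₊` with values in the endomorphisms of `(V³)^∨` on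
`Hom(V³, Pol(𝔫₊))`, which is identified with `(V³)^∨ ⊗ Pol(𝔫₊)`. -/
def actHom (P : Weyl 3 ⊗[ℂ] Module.End ℂ (Module.Dual ℂ V3)) :
    (V3 →ₗ[ℂ] Pol) →ₗ[ℂ] (V3 →ₗ[ℂ] Pol) :=
  dualTensorHom ℂ V3 Pol
    ∘ₗ TensorProduct.homTensorHomMap (RingHom.id ℂ) (Module.Dual ℂ V3) Pol (Module.Dual ℂ V3) Pol
        (TensorProduct.comm ℂ _ _ (TensorProduct.map (Weyl.act 3).toLinearMap LinearMap.id P))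
    ∘ₗ (dualTensorHomEquivOfBasis u).symm.toLinearMap

/-- The rotation by the angle `s` in the first two coordinates: the elements of
`SO(2) ⊆ SO(3)`. -/
def rot (s : ℝ) : Matrix (Fin 3) (Fin 3) ℝ :=
  !![Real.cos s, -Real.sin s, 0; Real.sin s, Real.cos s, 0; 0, 0, 1]

/-- The element of `L' = M'A` which is the product of the rotation by `s` and `exp(tH₀)`. -/
def leviPrime (s t : ℝ) : Matrix (Fin 5) (Fin 5) ℂ :=
  embed 1 (rot s) * NormedSpace.exp ((t : ℂ) • H0)

/-- `Ad_#(l) p = p(Ad(l⁻¹) ·)` on `Pol(𝔫₊)`. -/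
def AdSharp (l : Matrix (Fin 5) (Fin 5) ℂ) : Pol →ₗ[ℂ] Pol :=
  (MvPolynomial.aeval fun k : Fin 3 =>
    ∑ j, MvPolynomial.C (coordPlus (l⁻¹ * Cplus j * l) k) * (MvPolynomial.X j : Pol)).toLinearMap

/-- The representation `σ³_λ` of `L = MA` at the element `B exp(tH₀)`. -/
def sigmaLam (lam : ℂ) (B : Matrix (Fin 3) (Fin 3) ℝ) (t : ℝ) : V3 →ₗ[ℂ] V3 :=
  Complex.exp (lam * t) • sigma3 B

/-- The character `τ_{m,ν}` of `L' = M'A` at the product of the rotation by `s` and `exp(tH₀)`. -/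
def tau (m : ℤ) (nu : ℂ) (s t : ℝ) : ℂ := Complex.exp (Complex.I * m * s) * Complex.exp (nu * t)

/-- The space `Sol(𝔫₊; σ³_λ, τ_{m,ν})` of solutions of the F-system, where
`ℂ_{m,ν} ⊗ Pol(𝔫₊)` is identified with `Pol(𝔫₊)`. -/
def Sol (lam nu : ℂ) (m : ℤ) : Submodule ℂ (V3 →ₗ[ℂ] Pol) where
  carrier := {ψ | (∀ s t : ℝ, ψ ∘ₗ sigmaLam lam (rot s) t
      = tau m nu s t • (AdSharp (leviPrime s t) ∘ₗ ψ)) ∧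
    ∀ C ∈ nPlusPrime, actHom (dpiHat lam C) ψ = 0}
  add_mem' {ψ φ} hψ hφ := by
    refine ⟨fun s t => ?_, fun C hC => ?_⟩
    · rw [LinearMap.add_comp, LinearMap.comp_add, smul_add, hψ.1, hφ.1]
    · rw [map_add, hψ.2 C hC, hφ.2 C hC, add_zero]
  zero_mem' := by
    refine ⟨fun s t => ?_, fun C hC => ?_⟩
    · rw [LinearMap.zero_comp, LinearMap.comp_zero, smul_zero]
    · rw [map_zero]
  smul_mem' c ψ hψ := by
    refine ⟨fun s t => ?_, fun C hC => ?_⟩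
    · rw [LinearMap.smul_comp, LinearMap.comp_smul, hψ.1, smul_comm]
    · rw [map_smul, hψ.2 C hC, smul_zero]

/-! ## The generators -/

open Polynomial in
/-- The renormalized Gegenbauer polynomial of degree index `l` and parameter `mu`, and `0` if
`l < 0`. The quotient `Γ(μ + l - k) / Γ(μ + [(l+1)/2])` is written as the product
`(μ + [(l+1)/2]) (μ + [(l+1)/2] + 1) ⋯ (μ + l - k - 1)`, which makes sense for all `μ`. -/
def gegenbauer (mu : ℂ) (l : ℤ) : ℂ[X] :=
  if l < 0 then 0 else
    ∑ k ∈ Finset.range (l.toNat / 2 + 1),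
      C ((-1) ^ k * (ascPochhammer ℂ (l.toNat / 2 - k)).eval (mu + ((l.toNat + 1) / 2 : ℕ))
          / ((k.factorial : ℂ) * ((l.toNat - 2 * k).factorial : ℂ)))
        * (2 * X) ^ (l.toNat - 2 * k)

open Polynomial in
/-- The polynomial in `t` obtained from the renormalized Gegenbauer polynomial at `it`. -/
def gegenbauerI (mu : ℂ) (l : ℤ) : ℂ[X] := (gegenbauer mu l).comp (C Complex.I * X)

/-- `γ(μ, l)` is `1` if `l` is odd and `μ + l/2` if `l` is even. -/
def gammaConst (mu : ℂ) (l : ℕ) : ℂ := if Odd l then 1 else mu + (l : ℂ) / 2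

/-- `(T_b g)(ζ) = (ζ₁² + ζ₂²)^{b/2} g(ζ₃ / √(ζ₁² + ζ₂²))` for `g` in the span of the monomials
`t^{b-2j}`, `0 ≤ j ≤ b/2` (the zero space if `b < 0`), written out as a polynomial. -/
def Tmap (b : ℤ) (g : Polynomial ℂ) : Pol :=
  if b < 0 then 0 else
    ∑ j ∈ Finset.range (b.toNat / 2 + 1),
      MvPolynomial.C (g.coeff (b.toNat - 2 * j))
        * (MvPolynomial.X 0 ^ 2 + MvPolynomial.X 1 ^ 2) ^ j
        * MvPolynomial.X 2 ^ (b.toNat - 2 * j)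

/-- The map `h_k⁺ : V³ → ℂ_m ⊗ Pol` for `k = m - 1 + r`, `r = 0, 1, 2`: it sends the basis vector
`u (r)` to `(ζ₁ + iζ₂)^k` and the other two basis vectors to `0`. -/
def hplus (m : ℕ) (r : Fin 3) : V3 →ₗ[ℂ] Pol :=
  u.constr ℂ (Pi.single r
    ((MvPolynomial.X 0 + MvPolynomial.C Complex.I * MvPolynomial.X 1) ^ (m - 1 + (r : ℕ))))

/-- The map `∑_{k=m-1}^{m+1} (T_{a-k} g_k) h_k⁺`, where `g r` stands for `g_{m-1+r}`. -/
def psiOf (m a : ℕ) (g : Fin 3 → Polynomial ℂ) : V3 →ₗ[ℂ] Pol :=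
  ∑ r : Fin 3, LinearMap.mulLeft ℂ (Tmap ((a : ℤ) - ((m : ℤ) - 1 + (r : ℕ))) (g r)) ∘ₗ hplus m r

open Polynomial in
/-- The triple `(g₀, g₁, g₂)` for `m = 1` and `a > 0`. -/
def tripleOne (lam : ℂ) (a : ℕ) : Fin 3 → ℂ[X] :=
  ![-(C (lam + ((a - 1) / 2 : ℕ)) * gegenbauerI lam a),
    -(C (Complex.I * gammaConst (lam - 1) a) * gegenbauerI lam ((a : ℤ) - 1)),
    gegenbauerI lam ((a : ℤ) - 2)]

/-- The constant `A = (-1)^ν (λ + [(-λ-m)/2])^{1-ν}` for integers `λ` and `ν`; the division by `2`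
is the integer division, which rounds down. -/
def constA (l n : ℤ) (m : ℕ) : ℂ := (-1) ^ n * (((l + (-l - m) / 2 : ℤ) : ℂ)) ^ (1 - n)

/-- The constant `B = -2γ(λ-1, a-m)`, for `a ≥ m`. -/
def constB (l : ℤ) (m a : ℕ) : ℂ := -2 * gammaConst ((l : ℂ) - 1) (a - m)

/-- The constant `C = m(ν-1) + λ - 2`. -/
def constC (l n : ℤ) (m : ℕ) : ℂ := (m : ℂ) * ((n : ℂ) - 1) + l - 2

open Polynomial in
/-- The triple `(g_{m-1}, g_m, g_{m+1})` for `m > 1` and `a > m - 1`, where `λ = l` and `ν = n`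
are integers. -/
def tripleGeneral (l n : ℤ) (m a : ℕ) : Fin 3 → ℂ[X] :=
  ![C ((-1) ^ (n + 1) * Complex.I * constA l n m * constB l m a)
      * gegenbauerI l ((a : ℤ) - m + 1 - 2 * n),
    -(C (constC l n m) * gegenbauerI ((l : ℂ) - 1) ((a : ℤ) - m))
      + C (Complex.I * constB l m a) * X * gegenbauerI l ((a : ℤ) - m - 1),
    C (Complex.I * constB l m a) * gegenbauerI l ((a : ℤ) - m - 1)]

/-- The parameter condition: either `m = 1` and `ν - λ ∈ ℕ`, or `m > 1`, `λ` is an integer which is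
at most `1 - m`, and `ν ∈ {0, 1, 2}`. -/
def ParamCondition (lam nu : ℂ) (m : ℕ) : Prop :=
  (m = 1 ∧ ∃ a : ℕ, nu - lam = a) ∨
  (1 < m ∧ (∃ l : ℤ, lam = l ∧ l ≤ 1 - (m : ℤ)) ∧ (nu = 0 ∨ nu = 1 ∨ nu = 2))

end FSystem

end

/-!
The proof makes the F-system explicit, turns it into recurrences for the coefficients of three
polynomials, and compares the solutions of these recurrences with Gegenbauer polynomials.

*The differential operators.* The factorization `exp(Y) exp(Z) = exp(p₋) p₀ exp(p₊)` for `Y ∈ 𝔫₊` and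
`Z ∈ 𝔫₋` can be read off from the action on the highest and lowest weight vectors of `H₀`
(`IsGelfandNaimark.eq`, `isGelfandNaimark_expPlus_mul_expMinus`). Its factors are rational with a
denominator that is `1` at `Y = 0`, so `β(Y, ·)` is a quadratic and `α(Y, ·)` a linear polynomial
(`beta_nPlus`, `alpha_nPlus_mid`). The matrix coefficients of `σ³(B)` are linear in the entries of `B`,
which gives `dσ³` (`dsigma3Real_Xso`). Together they give the second-order operators of the F-system
(`actHom_dpiHat_nPlus`).

*Reduction to recurrences.* The torus `M'` is diagonal in the null coordinates `ζ₁ ± iζ₂`, and `𝔫₊'` is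
spanned by two null vectors. In these coordinates the equivariance under `L'` says which monomials
occur (`equivariant_iff`): a nonzero solution is homogeneous of degree `a = ν - λ`, which must be an
integer `≥ m - 1`, and with `M = m - 1`, `n = a - M` its component `r ∈ {0, 1, 2}` is a combination of
the monomials `(ζ₁ + iζ₂)^(M+r+j) (ζ₁ - iζ₂)^j ζ₃^(n-r-2j)`. Comparing coefficients in the equations of
the two null vectors gives two two-term or three-term recurrences for each component (`FRec`,
`mem_Sol_iff_fRec`).

*Uniqueness and the parameters.* The differences of the two recurrences link neighbouring components
(`FRec.link₀`, `FRec.link₁`, `FRec.link₂`). Consequently a solution vanishes with a single one of its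
coefficients (`FRec.eq_zero_of_leadCoeff`), and the solution space is at most one-dimensional. For
`m > 1` the recurrences force `ν ∈ {0, 1, 2}` and `ν ≤ n`, that is `λ ≤ 1 - m`, when a nonzero solution exists
(`FRec.exists_nu`).

*Existence.* The coefficients of the explicit triples are products of powers of two, factorials and
rising factorials, and satisfy the recurrences (`fRec_bottom`, `fRec_tripleOne`,
`fRec_tripleGeneral`). Their determining coefficient is not zero, so each of them spans the solution
space (`Sol_eq_span_psiOf`).
-/

noncomputable section

namespace FSystem

/-! ### Exponentials and the Gelfand–Naimark factorization -/

theorem nMinus_eq (z : Fin 3 → ℂ) : nMinus z =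
    !![0, -z 0, -z 1, -z 2, 0;
       z 0, 0, 0, 0, z 0;
       z 1, 0, 0, 0, z 1;
       z 2, 0, 0, 0, z 2;
       0, z 0, z 1, z 2, 0] := by
  ext i j
  fin_cases i <;> fin_cases j <;> simp [nMinus, Cminus, mid, Fin.sum_univ_three]

theorem nPlus_eq (w : Fin 3 → ℂ) : nPlus w =
    !![0, -w 0, -w 1, -w 2, 0;
       w 0, 0, 0, 0, -w 0;
       w 1, 0, 0, 0, -w 1;
       w 2, 0, 0, 0, -w 2;
       0, -w 0, -w 1, -w 2, 0] := by
  ext i j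
  fin_cases i <;> fin_cases j <;> simp [nPlus, Cplus, mid, Fin.sum_univ_three]

theorem exp_of_cube_eq_zero {N : Matrix (Fin 5) (Fin 5) ℂ} (h : N * N * N = 0) :
    NormedSpace.exp N = 1 + N + (1 / 2 : ℂ) • (N * N) := by
  rw [NormedSpace.exp_eq_tsum ℂ]
  have h3 : ∀ n, n ∉ Finset.range 3 → ((n.factorial : ℂ)⁻¹ • N ^ n) = 0 := by
    intro n hn
    obtain ⟨k, rfl⟩ : ∃ k, n = 3 + k := ⟨n - 3, by simp at hn; omega⟩
    rw [pow_add, show N ^ 3 = 0 by rw [pow_succ, pow_two, h], zero_mul, smul_zero]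
  simp only
  rw [tsum_eq_sum h3]
  simp [Finset.sum_range_succ, pow_two]

/-- The exponential of the element of `𝔫₋` with coordinates `z`. -/
def expMinus (z : Fin 3 → ℂ) : Matrix (Fin 5) (Fin 5) ℂ :=
  !![1 - (z 0 ^ 2 + z 1 ^ 2 + z 2 ^ 2) / 2, -z 0, -z 1, -z 2,
        -(z 0 ^ 2 + z 1 ^ 2 + z 2 ^ 2) / 2;
     z 0, 1, 0, 0, z 0;
     z 1, 0, 1, 0, z 1;
     z 2, 0, 0, 1, z 2;
     (z 0 ^ 2 + z 1 ^ 2 + z 2 ^ 2) / 2, z 0, z 1, z 2,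
        1 + (z 0 ^ 2 + z 1 ^ 2 + z 2 ^ 2) / 2]

/-- The exponential of the element of `𝔫₊` with coordinates `w`. -/
def expPlus (w : Fin 3 → ℂ) : Matrix (Fin 5) (Fin 5) ℂ :=
  !![1 - (w 0 ^ 2 + w 1 ^ 2 + w 2 ^ 2) / 2, -w 0, -w 1, -w 2,
        (w 0 ^ 2 + w 1 ^ 2 + w 2 ^ 2) / 2;
     w 0, 1, 0, 0, -w 0;
     w 1, 0, 1, 0, -w 1;
     w 2, 0, 0, 1, -w 2;
     -(w 0 ^ 2 + w 1 ^ 2 + w 2 ^ 2) / 2, -w 0, -w 1, -w 2,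
        1 + (w 0 ^ 2 + w 1 ^ 2 + w 2 ^ 2) / 2]

theorem nMinus_sq (z : Fin 3 → ℂ) : nMinus z * nMinus z =
    !![-(z 0 ^ 2 + z 1 ^ 2 + z 2 ^ 2), 0, 0, 0, -(z 0 ^ 2 + z 1 ^ 2 + z 2 ^ 2);
       0, 0, 0, 0, 0;
       0, 0, 0, 0, 0;
       0, 0, 0, 0, 0;
       z 0 ^ 2 + z 1 ^ 2 + z 2 ^ 2, 0, 0, 0, z 0 ^ 2 + z 1 ^ 2 + z 2 ^ 2] := by
  rw [nMinus_eq]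
  ext i j
  fin_cases i <;> fin_cases j <;> simp [Matrix.mul_apply, Fin.sum_univ_five] <;> ring

theorem nPlus_sq (w : Fin 3 → ℂ) : nPlus w * nPlus w =
    !![-(w 0 ^ 2 + w 1 ^ 2 + w 2 ^ 2), 0, 0, 0, w 0 ^ 2 + w 1 ^ 2 + w 2 ^ 2;
       0, 0, 0, 0, 0;
       0, 0, 0, 0, 0;
       0, 0, 0, 0, 0;
       -(w 0 ^ 2 + w 1 ^ 2 + w 2 ^ 2), 0, 0, 0, w 0 ^ 2 + w 1 ^ 2 + w 2 ^ 2] := by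
  rw [nPlus_eq]
  ext i j
  fin_cases i <;> fin_cases j <;> simp [Matrix.mul_apply, Fin.sum_univ_five] <;> ring

theorem exp_nMinus (z : Fin 3 → ℂ) : NormedSpace.exp (nMinus z) = expMinus z := by
  rw [exp_of_cube_eq_zero]
  · rw [nMinus_sq, nMinus_eq, expMinus]
    ext i j
    fin_cases i <;> fin_cases j <;> simp <;> ring
  · rw [nMinus_sq, nMinus_eq]
    ext i j
    fin_cases i <;> fin_cases j <;> simp [Matrix.mul_apply, Fin.sum_univ_five]

theorem exp_nPlus (w : Fin 3 → ℂ) : NormedSpace.exp (nPlus w) = expPlus w := by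
  rw [exp_of_cube_eq_zero]
  · rw [nPlus_sq, nPlus_eq, expPlus]
    ext i j
    fin_cases i <;> fin_cases j <;> simp <;> ring
  · rw [nPlus_sq, nPlus_eq]
    ext i j
    fin_cases i <;> fin_cases j <;> simp [Matrix.mul_apply, Fin.sum_univ_five] <;> ring

theorem expMinus_mul_neg (z : Fin 3 → ℂ) : expMinus (-z) * expMinus z = 1 := by
  ext i j
  fin_cases i <;> fin_cases j <;> simp [expMinus, Matrix.mul_apply, Fin.sum_univ_five] <;> ring

theorem expPlus_mul_neg (w : Fin 3 → ℂ) : expPlus w * expPlus (-w) = 1 := by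
  ext i j
  fin_cases i <;> fin_cases j <;> simp [expPlus, Matrix.mul_apply, Fin.sum_univ_five] <;> ring

theorem smul_nPlus (t : ℂ) (y : Fin 3 → ℂ) : t • nPlus y = nPlus (t • y) := by
  simp [nPlus, Finset.smul_sum, smul_smul]

/-- The block matrix with central block `b` whose restriction to the hyperbolic plane spanned by the
outer coordinates is `p + q H₀`: the general form of an element of `L_ℂ`. -/
def leviMat (p q : ℂ) (b : Matrix (Fin 3) (Fin 3) ℂ) : Matrix (Fin 5) (Fin 5) ℂ :=
  !![p, 0, 0, 0, q;
     0, b 0 0, b 0 1, b 0 2, 0;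
     0, b 1 0, b 1 1, b 1 2, 0;
     0, b 2 0, b 2 1, b 2 2, 0;
     q, 0, 0, 0, p]

theorem exists_leviMat_of_mem_leviC {l : Matrix (Fin 5) (Fin 5) ℂ} (hl : l ∈ leviC) :
    ∃ p q b, l = leviMat p q b ∧ p + q ≠ 0 := by
  obtain ⟨hJ, -, hH⟩ := hl
  have e (i j : Fin 5) : (l * H0) i j = (H0 * l) i j := by rw [hH]
  have f : (l.transpose * J * l) 0 0 = J 0 0 := by rw [hJ]
  have e04 := e 0 4
  have e00 := e 0 0
  have a1 := e 4 1
  have a2 := e 4 2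
  have a3 := e 4 3
  have b1 := e 0 1
  have b2 := e 0 2
  have b3 := e 0 3
  have c1 := e 1 4
  have c2 := e 2 4
  have c3 := e 3 4
  have d1 := e 1 0
  have d2 := e 2 0
  have d3 := e 3 0
  clear e
  simp [H0, J, Matrix.mul_apply, Fin.sum_univ_five, Matrix.single_apply,
    Matrix.diagonal_apply] at f e04 e00 a1 a2 a3 b1 b2 b3 c1 c2 c3 d1 d2 d3
  rw [c1, c2, c3, ← e00] at f
  refine ⟨l 0 0, l 0 4, !![l 1 1, l 1 2, l 1 3; l 2 1, l 2 2, l 2 3; l 3 1, l 3 2, l 3 3], ?_, ?_⟩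
  · ext i j
    fin_cases i <;> fin_cases j <;>
      simp [leviMat, e04, e00, ← a1, ← a2, ← a3, ← b1, ← b2, ← b3, c1, c2, c3, d1, d2, d3]
  · intro h0
    have : (l 0 0 + l 0 4) * (l 0 0 - l 0 4) = 1 := by linear_combination f
    rw [h0, zero_mul] at this
    exact zero_ne_one this

/-- The factors of a Gelfand–Naimark factorization are read off from the action of `g` on the
highest weight vector `(1, 0, 0, 0, 1)` of `H₀`, from the left and from the right. -/
theorem IsGelfandNaimark.eq {g l : Matrix (Fin 5) (Fin 5) ℂ} {z w : Fin 3 → ℂ}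
    (h : IsGelfandNaimark g z l w) :
    (z = fun j => (g (mid j) 0 + g (mid j) 4) / (g 0 0 + g 0 4 + g 4 0 + g 4 4)) ∧
    (w = fun j => -(g 0 (mid j) + g 4 (mid j)) / (g 0 0 + g 0 4 + g 4 0 + g 4 4)) := by
  obtain ⟨hl, rfl⟩ := h
  obtain ⟨p, q, b, rfl, hpq⟩ := exists_leviMat_of_mem_leviC hl
  rw [exp_nMinus, exp_nPlus]
  have hc : ∀ x : Fin 3 → ℂ, ∀ s : ℂ, s = 2 * (p + q) → ∀ y : Fin 3 → ℂ,
      (∀ j, y j = x j * s) → x = fun j => y j / s := by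
    intro x s hs y hy
    funext j
    rw [hy, mul_div_cancel_right₀]
    rw [hs]
    exact mul_ne_zero two_ne_zero hpq
  have hs : (expMinus z * leviMat p q b * expPlus w) 0 0
      + (expMinus z * leviMat p q b * expPlus w) 0 4
      + (expMinus z * leviMat p q b * expPlus w) 4 0
      + (expMinus z * leviMat p q b * expPlus w) 4 4 = 2 * (p + q) := by
    simp [leviMat, Matrix.mul_apply, Fin.sum_univ_five, expMinus, expPlus]
    ring
  constructor
  · refine hc _ _ hs _ fun j => ?_
    rw [hs]
    fin_cases j <;>
    · simp [mid, leviMat, Matrix.mul_apply, Fin.sum_univ_five, expMinus, expPlus]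
      ring
  · refine hc _ _ hs _ fun j => ?_
    rw [hs]
    fin_cases j <;>
    · simp [mid, leviMat, Matrix.mul_apply, Fin.sum_univ_five, expMinus, expPlus]
      ring

theorem IsGelfandNaimark.pMinus_eq {g l : Matrix (Fin 5) (Fin 5) ℂ} {z w : Fin 3 → ℂ}
    (h : IsGelfandNaimark g z l w) : pMinus g = z := by
  have hex : ∃ z l w, IsGelfandNaimark g z l w := ⟨z, l, w, h⟩
  rw [pMinus, dif_pos hex]
  obtain ⟨l', w', h'⟩ := hex.choose_spec
  rw [h'.eq.1, h.eq.1]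

theorem IsGelfandNaimark.pZero_eq {g l : Matrix (Fin 5) (Fin 5) ℂ} {z w : Fin 3 → ℂ}
    (h : IsGelfandNaimark g z l w) : pZero g = l := by
  have hex : ∃ l z w, IsGelfandNaimark g z l w := ⟨l, z, w, h⟩
  rw [pZero, dif_pos hex]
  obtain ⟨z', w', h'⟩ := hex.choose_spec
  have hz : z' = z := by rw [h'.eq.1, h.eq.1]
  have hw : w' = w := by rw [h'.eq.2, h.eq.2]
  have hl (l : Matrix (Fin 5) (Fin 5) ℂ) (hg : IsGelfandNaimark g z l w) :
      l = expMinus (-z) * g * expPlus (-w) := by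
    rw [← hg.2, exp_nMinus, exp_nPlus]
    rw [show expMinus (-z) * (expMinus z * l * expPlus w) * expPlus (-w)
      = (expMinus (-z) * expMinus z) * l * (expPlus w * expPlus (-w)) by
        simp only [Matrix.mul_assoc], expMinus_mul_neg, expPlus_mul_neg, Matrix.one_mul,
      Matrix.mul_one]
  rw [hz, hw] at h'
  rw [hl _ h', ← hl _ h]

/-! ### The infinitesimal action of `𝔫₊` -/

/-- The denominator of the factorization of `exp(Y) exp(Z)`, for `Y ∈ 𝔫₊` and `Z ∈ 𝔫₋` with
coordinates `y` and `z`. -/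
def gnDenom (y z : Fin 3 → ℂ) : ℂ :=
  1 - 2 * (y 0 * z 0 + y 1 * z 1 + y 2 * z 2)
    + (y 0 ^ 2 + y 1 ^ 2 + y 2 ^ 2) * (z 0 ^ 2 + z 1 ^ 2 + z 2 ^ 2)

/-- The factor `p₋(exp(Y) exp(Z))`. -/
def gnMinus (y z : Fin 3 → ℂ) : Fin 3 → ℂ := fun j =>
  (z j - (z 0 ^ 2 + z 1 ^ 2 + z 2 ^ 2) * y j) / gnDenom y z

/-- The factor `p₊(exp(Y) exp(Z))`. -/
def gnPlus (y z : Fin 3 → ℂ) : Fin 3 → ℂ := fun j =>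
  (y j - (y 0 ^ 2 + y 1 ^ 2 + y 2 ^ 2) * z j) / gnDenom y z

/-- The factor `p₀(exp(Y) exp(Z))`. -/
def gnLevi (y z : Fin 3 → ℂ) : Matrix (Fin 5) (Fin 5) ℂ :=
  expMinus (-gnMinus y z) * (expPlus y * expMinus z) * expPlus (-gnPlus y z)

theorem expMinus_J (z : Fin 3 → ℂ) : (expMinus z).transpose * J * expMinus z = J := by
  ext i j
  fin_cases i <;> fin_cases j <;>
    simp [expMinus, J, Matrix.mul_apply, Fin.sum_univ_five, Matrix.diagonal_apply] <;> ring

theorem expPlus_J (z : Fin 3 → ℂ) : (expPlus z).transpose * J * expPlus z = J := by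
  ext i j
  fin_cases i <;> fin_cases j <;>
    simp [expPlus, J, Matrix.mul_apply, Fin.sum_univ_five, Matrix.diagonal_apply] <;> ring

theorem det_sq_of_J {l : Matrix (Fin 5) (Fin 5) ℂ} (h : l.transpose * J * l = J) :
    l.det ^ 2 = 1 := by
  have hJ : J.det = -1 := by simp [J, Matrix.det_diagonal, Fin.prod_univ_five]
  have := congrArg Matrix.det h
  rw [Matrix.det_mul, Matrix.det_mul, Matrix.det_transpose, hJ] at this
  linear_combination -this

theorem det_expMinus (z : Fin 3 → ℂ) : (expMinus z).det = 1 := by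
  have h : expMinus z = expMinus (fun j => z j / 2) * expMinus (fun j => z j / 2) := by
    ext i j
    fin_cases i <;> fin_cases j <;>
      simp [expMinus, Matrix.mul_apply, Fin.sum_univ_five] <;> ring
  rw [h, Matrix.det_mul, ← pow_two, det_sq_of_J (expMinus_J _)]

theorem det_expPlus (z : Fin 3 → ℂ) : (expPlus z).det = 1 := by
  have h : expPlus z = expPlus (fun j => z j / 2) * expPlus (fun j => z j / 2) := by
    ext i j
    fin_cases i <;> fin_cases j <;>
      simp [expPlus, Matrix.mul_apply, Fin.sum_univ_five] <;> ring
  rw [h, Matrix.det_mul, ← pow_two, det_sq_of_J (expPlus_J _)]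

theorem J_mul {k l : Matrix (Fin 5) (Fin 5) ℂ} (hk : k.transpose * J * k = J)
    (hl : l.transpose * J * l = J) : (k * l).transpose * J * (k * l) = J := by
  rw [Matrix.transpose_mul, show l.transpose * k.transpose * J * (k * l)
    = l.transpose * (k.transpose * J * k) * l by simp only [Matrix.mul_assoc], hk, hl]

theorem gnLevi_J (y z : Fin 3 → ℂ) : (gnLevi y z).transpose * J * gnLevi y z = J :=
  J_mul (J_mul (expMinus_J _) (J_mul (expPlus_J _) (expMinus_J _))) (expPlus_J _)

theorem det_gnLevi (y z : Fin 3 → ℂ) : (gnLevi y z).det = 1 := by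
  simp [gnLevi, Matrix.det_mul, det_expMinus, det_expPlus]

/-- An orthogonal matrix that has the highest weight vector of `H₀` as an eigenvector, from the left
and from the right, is block diagonal. -/
theorem eq_leviMat_of_eigenvector {l : Matrix (Fin 5) (Fin 5) ℂ} {c : ℂ} (hc : c ≠ 0)
    (hJ : l.transpose * J * l = J) (hcol : ∀ i, l i 0 + l i 4 = ![c, 0, 0, 0, c] i)
    (hrow : ∀ j, l 0 j + l 4 j = ![c, 0, 0, 0, c] j) :
    l = leviMat ((c + c⁻¹) / 2) ((c - c⁻¹) / 2) (Matrix.of fun i j => l (mid i) (mid j)) := by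
  have hJ2 : l * J * l.transpose = J := by
    have hJJ : J * J = 1 := by
      rw [J, Matrix.diagonal_mul_diagonal, ← Matrix.diagonal_one]
      congr 1
      ext i
      fin_cases i <;> simp
    have h1 : (J * l.transpose * J) * l = 1 := by
      rw [show J * l.transpose * J * l = J * (l.transpose * J * l) by
        simp only [Matrix.mul_assoc], hJ, hJJ]
    have h2 : l * (J * l.transpose * J) = 1 := mul_eq_one_comm.mp h1
    calc l * J * l.transpose = l * (J * l.transpose * J) * J := by
          simp only [Matrix.mul_assoc, hJJ, Matrix.mul_one]
      _ = J := by rw [h2, Matrix.one_mul]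
  have hrow' : ∀ j, l 0 j - l 4 j = ![c⁻¹, 0, 0, 0, -c⁻¹] j := by
    intro j
    have e0 : (l.transpose * J * l) j 0 + (l.transpose * J * l) j 4 = J j 0 + J j 4 := by rw [hJ]
    simp only [J, Matrix.mul_apply, Fin.sum_univ_five, Matrix.diagonal_apply,
      Matrix.transpose_apply] at e0
    have h0 := hcol 0
    have h1 := hcol 1
    have h2 := hcol 2
    have h3 := hcol 3
    have h4 := hcol 4
    simp at h0 h1 h2 h3 h4
    have e1 : c * (l 0 j - l 4 j) = ![1, 0, 0, 0, -1] j := by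
      have e2 : l 0 j * (l 0 0 + l 0 4) + l 1 j * (l 1 0 + l 1 4) + l 2 j * (l 2 0 + l 2 4)
          + l 3 j * (l 3 0 + l 3 4) - l 4 j * (l 4 0 + l 4 4) = ![1, 0, 0, 0, -1] j := by
        fin_cases j <;> simp at e0 ⊢ <;> linear_combination e0
      rw [h0, h1, h2, h3, h4] at e2
      linear_combination e2
    have e3 : l 0 j - l 4 j = c⁻¹ * ![1, 0, 0, 0, -1] j := by
      rw [← e1, inv_mul_cancel_left₀ hc]
    rw [e3]
    fin_cases j <;> simp
  have hcol' : ∀ j, l j 0 - l j 4 = ![c⁻¹, 0, 0, 0, -c⁻¹] j := by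
    intro j
    have e0 : (l * J * l.transpose) j 0 + (l * J * l.transpose) j 4 = J j 0 + J j 4 := by rw [hJ2]
    simp only [J, Matrix.mul_apply, Fin.sum_univ_five, Matrix.diagonal_apply,
      Matrix.transpose_apply] at e0
    have h0 := hrow 0
    have h1 := hrow 1
    have h2 := hrow 2
    have h3 := hrow 3
    have h4 := hrow 4
    simp at h0 h1 h2 h3 h4
    have e1 : c * (l j 0 - l j 4) = ![1, 0, 0, 0, -1] j := by
      have e2 : l j 0 * (l 0 0 + l 4 0) + l j 1 * (l 0 1 + l 4 1) + l j 2 * (l 0 2 + l 4 2)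
          + l j 3 * (l 0 3 + l 4 3) - l j 4 * (l 0 4 + l 4 4) = ![1, 0, 0, 0, -1] j := by
        fin_cases j <;> simp at e0 ⊢ <;> linear_combination e0
      rw [h0, h1, h2, h3, h4] at e2
      linear_combination e2
    have e3 : l j 0 - l j 4 = c⁻¹ * ![1, 0, 0, 0, -1] j := by
      rw [← e1, inv_mul_cancel_left₀ hc]
    rw [e3]
    fin_cases j <;> simp
  ext i j
  have a := hcol i
  have b := hcol' i
  have a' := hrow j
  have b' := hrow' j
  fin_cases i <;> fin_cases j <;> simp [leviMat, mid] at a b a' b' ⊢ <;>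
    first
      | linear_combination (a + b) / 2
      | linear_combination (a - b) / 2
      | linear_combination (a' + b') / 2
      | linear_combination (a' - b') / 2

theorem mul_expPlus_add (A : Matrix (Fin 5) (Fin 5) ℂ) (w : Fin 3 → ℂ) (i : Fin 5) :
    (A * expPlus w) i 0 + (A * expPlus w) i 4 = A i 0 + A i 4 := by
  simp [Matrix.mul_apply, Fin.sum_univ_five, expPlus]
  ring

theorem expMinus_mul_add (A : Matrix (Fin 5) (Fin 5) ℂ) (z : Fin 3 → ℂ) (j : Fin 5) :
    (expMinus z * A) 0 j + (expMinus z * A) 4 j = A 0 j + A 4 j := by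
  simp [Matrix.mul_apply, Fin.sum_univ_five, expMinus]
  ring

theorem gnLevi_col {y z : Fin 3 → ℂ} (h : gnDenom y z ≠ 0) (i : Fin 5) :
    gnLevi y z i 0 + gnLevi y z i 4 = ![gnDenom y z, 0, 0, 0, gnDenom y z] i := by
  rw [gnLevi, mul_expPlus_add]
  have hg (k : Fin 5) : (expPlus y * expMinus z) k 0 + (expPlus y * expMinus z) k 4
      = ![gnDenom y z - (z 0 ^ 2 + z 1 ^ 2 + z 2 ^ 2), 2 * (gnDenom y z * gnMinus y z 0),
        2 * (gnDenom y z * gnMinus y z 1), 2 * (gnDenom y z * gnMinus y z 2),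
        gnDenom y z + (z 0 ^ 2 + z 1 ^ 2 + z 2 ^ 2)] k := by
    fin_cases k <;> simp only [gnMinus, mul_div_cancel₀ _ h] <;>
      simp [Matrix.mul_apply, Fin.sum_univ_five, expPlus, expMinus, gnDenom] <;> ring
  have hq : gnDenom y z * (gnMinus y z 0 ^ 2 + gnMinus y z 1 ^ 2 + gnMinus y z 2 ^ 2)
      = z 0 ^ 2 + z 1 ^ 2 + z 2 ^ 2 := by
    have hd : gnDenom y z = 1 - 2 * (y 0 * z 0 + y 1 * z 1 + y 2 * z 2)
      + (y 0 ^ 2 + y 1 ^ 2 + y 2 ^ 2) * (z 0 ^ 2 + z 1 ^ 2 + z 2 ^ 2) := rfl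
    simp only [gnMinus]
    generalize gnDenom y z = c at *
    field_simp
    rw [hd]
    ring
  have hs : (expMinus (-gnMinus y z) * (expPlus y * expMinus z)) i 0
      + (expMinus (-gnMinus y z) * (expPlus y * expMinus z)) i 4
      = ∑ k, expMinus (-gnMinus y z) i k *
        ((expPlus y * expMinus z) k 0 + (expPlus y * expMinus z) k 4) := by
    rw [Matrix.mul_apply, Matrix.mul_apply, ← Finset.sum_add_distrib]
    simp only [mul_add]
  rw [hs]
  simp only [hg, Fin.sum_univ_five]
  rw [← hq]
  fin_cases i <;> simp [expMinus] <;> ring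

theorem gnLevi_row {y z : Fin 3 → ℂ} (h : gnDenom y z ≠ 0) (j : Fin 5) :
    gnLevi y z 0 j + gnLevi y z 4 j = ![gnDenom y z, 0, 0, 0, gnDenom y z] j := by
  rw [gnLevi, Matrix.mul_assoc, expMinus_mul_add]
  have hg (k : Fin 5) : (expPlus y * expMinus z) 0 k + (expPlus y * expMinus z) 4 k
      = ![gnDenom y z - (y 0 ^ 2 + y 1 ^ 2 + y 2 ^ 2), -2 * (gnDenom y z * gnPlus y z 0),
        -2 * (gnDenom y z * gnPlus y z 1), -2 * (gnDenom y z * gnPlus y z 2),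
        gnDenom y z + (y 0 ^ 2 + y 1 ^ 2 + y 2 ^ 2)] k := by
    fin_cases k <;> simp only [gnPlus, mul_div_cancel₀ _ h] <;>
      simp [Matrix.mul_apply, Fin.sum_univ_five, expPlus, expMinus, gnDenom] <;> ring
  have hq : gnDenom y z * (gnPlus y z 0 ^ 2 + gnPlus y z 1 ^ 2 + gnPlus y z 2 ^ 2)
      = y 0 ^ 2 + y 1 ^ 2 + y 2 ^ 2 := by
    have hd : gnDenom y z = 1 - 2 * (y 0 * z 0 + y 1 * z 1 + y 2 * z 2)
      + (y 0 ^ 2 + y 1 ^ 2 + y 2 ^ 2) * (z 0 ^ 2 + z 1 ^ 2 + z 2 ^ 2) := rfl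
    simp only [gnPlus]
    generalize gnDenom y z = c at *
    field_simp
    rw [hd]
    ring
  have hs : (expPlus y * expMinus z * expPlus (-gnPlus y z)) 0 j
      + (expPlus y * expMinus z * expPlus (-gnPlus y z)) 4 j
      = ∑ k, ((expPlus y * expMinus z) 0 k + (expPlus y * expMinus z) 4 k)
        * expPlus (-gnPlus y z) k j := by
    rw [Matrix.mul_apply, Matrix.mul_apply, ← Finset.sum_add_distrib]
    simp only [add_mul]
  rw [hs]
  simp only [hg, Fin.sum_univ_five]
  rw [← hq]
  fin_cases j <;> simp [expPlus] <;> ring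

theorem gnLevi_mid {y z : Fin 3 → ℂ} (h : gnDenom y z ≠ 0) (i j : Fin 3) :
    gnLevi y z (mid i) (mid j) = (if i = j then 1 else 0) - 2 * z j * y i
      + 2 * (z i - (z 0 ^ 2 + z 1 ^ 2 + z 2 ^ 2) * y i) * gnPlus y z j := by
  have hp (a b : Fin 3) : gnDenom y z * (gnMinus y z a * gnPlus y z b)
      = (z a - (z 0 ^ 2 + z 1 ^ 2 + z 2 ^ 2) * y a) * gnPlus y z b := by
    rw [gnMinus]
    field_simp
  have h1 (A : Matrix (Fin 5) (Fin 5) ℂ) (w : Fin 3 → ℂ) (k : Fin 5) :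
      (A * expPlus w) k (mid j) = A k (mid j) - w j * (A k 0 + A k 4) := by
    fin_cases j <;> simp [Matrix.mul_apply, Fin.sum_univ_five, expPlus, mid] <;> ring
  have h2 (A : Matrix (Fin 5) (Fin 5) ℂ) (w : Fin 3 → ℂ) (k : Fin 5) :
      (expMinus w * A) (mid i) k = A (mid i) k + w i * (A 0 k + A 4 k) := by
    fin_cases i <;> simp [Matrix.mul_apply, Fin.sum_univ_five, expMinus, mid] <;> ring
  have h3 (A : Matrix (Fin 5) (Fin 5) ℂ) (w : Fin 3 → ℂ) (k : Fin 5) :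
      (expPlus w * A) (mid i) k = A (mid i) k + w i * (A 0 k - A 4 k) := by
    fin_cases i <;> simp [Matrix.mul_apply, Fin.sum_univ_five, expPlus, mid] <;> ring
  have hr : (expPlus y * expMinus z) 0 (mid j) + (expPlus y * expMinus z) 4 (mid j)
      = -2 * (gnDenom y z * gnPlus y z j) := by
    rw [gnPlus, mul_div_cancel₀ _ h]
    fin_cases j <;> simp [Matrix.mul_apply, Fin.sum_univ_five, expPlus, expMinus, mid] <;> ring
  have hc := gnLevi_col h (mid i)
  rw [gnLevi, mul_expPlus_add] at hc
  rw [gnLevi, h1, hc, h2, hr, h3]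
  have he : expMinus z (mid i) (mid j) + y i * (expMinus z 0 (mid j) - expMinus z 4 (mid j))
      = (if i = j then 1 else 0) - 2 * z j * y i := by
    fin_cases i <;> fin_cases j <;> simp [expMinus, mid] <;> ring
  have h0 : ![gnDenom y z, 0, 0, 0, gnDenom y z] (mid i) = 0 := by
    fin_cases i <;> simp [mid]
  rw [he, h0, Pi.neg_apply]
  linear_combination 2 * hp i j

theorem gnLevi_eq {y z : Fin 3 → ℂ} (h : gnDenom y z ≠ 0) :
    gnLevi y z = leviMat ((gnDenom y z + (gnDenom y z)⁻¹) / 2)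
      ((gnDenom y z - (gnDenom y z)⁻¹) / 2)
      (Matrix.of fun i j => gnLevi y z (mid i) (mid j)) :=
  eq_leviMat_of_eigenvector h (gnLevi_J y z) (gnLevi_col h) (gnLevi_row h)

theorem isGelfandNaimark_expPlus_mul_expMinus {y z : Fin 3 → ℂ} (h : gnDenom y z ≠ 0) :
    IsGelfandNaimark (expPlus y * expMinus z) (gnMinus y z) (gnLevi y z) (gnPlus y z) := by
  refine ⟨⟨gnLevi_J y z, det_gnLevi y z, ?_⟩, ?_⟩
  · rw [gnLevi_eq h]
    ext i j
    fin_cases i <;> fin_cases j <;>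
      simp [leviMat, H0, Matrix.mul_apply, Matrix.single_apply]
  · rw [exp_nMinus, exp_nPlus, gnLevi]
    have h1 := expMinus_mul_neg (-gnMinus y z)
    have h2 := expPlus_mul_neg (-gnPlus y z)
    rw [neg_neg] at h1 h2
    generalize expPlus y * expMinus z = g
    calc _ = (expMinus (gnMinus y z) * expMinus (-gnMinus y z)) * g
          * (expPlus (-gnPlus y z) * expPlus (gnPlus y z)) := by simp only [Matrix.mul_assoc]
      _ = g := by rw [h1, h2, Matrix.one_mul, Matrix.mul_one]

theorem gnDenom_smul (y z : Fin 3 → ℂ) (t : ℂ) : gnDenom (t • y) z =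
    1 - t * (2 * (y 0 * z 0 + y 1 * z 1 + y 2 * z 2))
    + t ^ 2 * ((y 0 ^ 2 + y 1 ^ 2 + y 2 ^ 2) * (z 0 ^ 2 + z 1 ^ 2 + z 2 ^ 2)) := by
  simp [gnDenom]
  ring

theorem hasDerivAt_gnDenom (y z : Fin 3 → ℂ) : HasDerivAt (fun t : ℂ => gnDenom (t • y) z)
    (-(2 * (y 0 * z 0 + y 1 * z 1 + y 2 * z 2))) 0 := by
  simp only [gnDenom_smul]
  have h1 := ((hasDerivAt_id (0 : ℂ)).mul_const (2 * (y 0 * z 0 + y 1 * z 1 + y 2 * z 2))).const_sub 1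
  have h2 := ((hasDerivAt_id (0 : ℂ)).pow 2).mul_const
    ((y 0 ^ 2 + y 1 ^ 2 + y 2 ^ 2) * (z 0 ^ 2 + z 1 ^ 2 + z 2 ^ 2))
  convert! h1.add h2 using 1
  simp

theorem gnDenom_zero (z : Fin 3 → ℂ) : gnDenom 0 z = 1 := by
  simp [gnDenom]

theorem gnDenom_zero_smul (y z : Fin 3 → ℂ) : gnDenom ((0 : ℂ) • y) z = 1 := by
  simp [gnDenom]

theorem eventually_gnDenom_ne_zero (y z : Fin 3 → ℂ) :
    ∀ᶠ t : ℂ in nhds 0, gnDenom (t • y) z ≠ 0 := by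
  refine (hasDerivAt_gnDenom y z).continuousAt.eventually_ne ?_
  rw [gnDenom_zero_smul]
  exact one_ne_zero

theorem hasDerivAt_gnPlus (y z : Fin 3 → ℂ) (j : Fin 3) :
    HasDerivAt (fun t : ℂ => gnPlus (t • y) z j) (y j) 0 := by
  have e : (fun t : ℂ => gnPlus (t • y) z j) = fun t : ℂ =>
      (t * y j - t ^ 2 * ((y 0 ^ 2 + y 1 ^ 2 + y 2 ^ 2) * z j)) / gnDenom (t • y) z := by
    funext t
    simp only [gnPlus, Pi.smul_apply, smul_eq_mul]
    ring
  rw [e]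
  have h1 := (hasDerivAt_id (0 : ℂ)).mul_const (y j)
  have h2 := ((hasDerivAt_id (0 : ℂ)).pow 2).mul_const ((y 0 ^ 2 + y 1 ^ 2 + y 2 ^ 2) * z j)
  have h3 := (h1.sub h2).div (hasDerivAt_gnDenom y z) (by rw [gnDenom_zero_smul]; exact one_ne_zero)
  convert! h3 using 1
  simp [gnDenom_zero]

theorem beta_nPlus (y z : Fin 3 → ℂ) (j : Fin 3) : beta (nPlus y) z j =
    2 * (y 0 * z 0 + y 1 * z 1 + y 2 * z 2) * z j - (z 0 ^ 2 + z 1 ^ 2 + z 2 ^ 2) * y j := by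
  have e : (fun t : ℂ => pMinus (NormedSpace.exp (t • nPlus y) * NormedSpace.exp (nMinus z)) j)
      =ᶠ[nhds 0] fun t : ℂ =>
        (z j - t * ((z 0 ^ 2 + z 1 ^ 2 + z 2 ^ 2) * y j)) / gnDenom (t • y) z := by
    filter_upwards [eventually_gnDenom_ne_zero y z] with t ht
    rw [smul_nPlus, exp_nPlus, exp_nMinus, (isGelfandNaimark_expPlus_mul_expMinus ht).pMinus_eq]
    simp only [gnMinus, Pi.smul_apply, smul_eq_mul]
    ring
  rw [beta, e.deriv_eq]
  have h1 := ((hasDerivAt_id (0 : ℂ)).mul_const ((z 0 ^ 2 + z 1 ^ 2 + z 2 ^ 2) * y j)).const_sub (z j)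
  have h3 := h1.div (hasDerivAt_gnDenom y z) (by rw [gnDenom_zero_smul]; exact one_ne_zero)
  refine HasDerivAt.deriv ?_
  convert! h3 using 1
  simp [gnDenom_zero]
  ring

theorem alpha_nPlus_zero_four (y z : Fin 3 → ℂ) :
    alpha (nPlus y) z 0 4 = -(2 * (y 0 * z 0 + y 1 * z 1 + y 2 * z 2)) := by
  have e : (fun t : ℂ => pZero (NormedSpace.exp (t • nPlus y) * NormedSpace.exp (nMinus z)) 0 4)
      =ᶠ[nhds 0] fun t : ℂ => (gnDenom (t • y) z - (gnDenom (t • y) z)⁻¹) / 2 := by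
    filter_upwards [eventually_gnDenom_ne_zero y z] with t ht
    rw [smul_nPlus, exp_nPlus, exp_nMinus, (isGelfandNaimark_expPlus_mul_expMinus ht).pZero_eq,
      gnLevi_eq ht]
    simp [leviMat]
  rw [alpha, Matrix.of_apply, e.deriv_eq]
  have h := hasDerivAt_gnDenom y z
  have h3 := (h.sub (h.inv (by rw [gnDenom_zero_smul]; exact one_ne_zero))).div_const 2
  refine HasDerivAt.deriv ?_
  convert! h3 using 1
  simp [gnDenom_zero]
  ring

theorem alpha_nPlus_mid (y z : Fin 3 → ℂ) (i j : Fin 3) :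
    alpha (nPlus y) z (mid i) (mid j) = 2 * (z i * y j - y i * z j) := by
  have e : (fun t : ℂ =>
      pZero (NormedSpace.exp (t • nPlus y) * NormedSpace.exp (nMinus z)) (mid i) (mid j))
      =ᶠ[nhds 0] fun t : ℂ => ((if i = j then 1 else 0) - t * (2 * z j * y i))
      + (2 * z i - t * (2 * (z 0 ^ 2 + z 1 ^ 2 + z 2 ^ 2) * y i)) * gnPlus (t • y) z j := by
    filter_upwards [eventually_gnDenom_ne_zero y z] with t ht
    rw [smul_nPlus, exp_nPlus, exp_nMinus, (isGelfandNaimark_expPlus_mul_expMinus ht).pZero_eq,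
      gnLevi_mid ht]
    simp only [Pi.smul_apply, smul_eq_mul]
    ring
  rw [alpha, Matrix.of_apply, e.deriv_eq]
  have h1 := ((hasDerivAt_id (0 : ℂ)).mul_const (2 * z j * y i)).const_sub (if i = j then 1 else 0)
  have h2 := ((hasDerivAt_id (0 : ℂ)).mul_const
    (2 * (z 0 ^ 2 + z 1 ^ 2 + z 2 ^ 2) * y i)).const_sub (2 * z i)
  have h3 := h1.add (h2.mul (hasDerivAt_gnPlus y z j))
  refine HasDerivAt.deriv ?_
  convert! h3 using 1
  simp [gnPlus]
  ring

/-! ### The representation `σ³` and its differential -/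

theorem theta_u (g : Matrix (Fin 2) (Fin 2) ℂ) :
    theta g (u 0) = (g⁻¹ 0 0 ^ 2) • u 0 + (2 * g⁻¹ 0 0 * g⁻¹ 0 1) • u 1 + (g⁻¹ 0 1 ^ 2) • u 2 ∧
    theta g (u 1) = (g⁻¹ 0 0 * g⁻¹ 1 0) • u 0 + (g⁻¹ 0 0 * g⁻¹ 1 1 + g⁻¹ 0 1 * g⁻¹ 1 0) • u 1
      + (g⁻¹ 0 1 * g⁻¹ 1 1) • u 2 ∧
    theta g (u 2) = (g⁻¹ 1 0 ^ 2) • u 0 + (2 * g⁻¹ 1 0 * g⁻¹ 1 1) • u 1 + (g⁻¹ 1 1 ^ 2) • u 2 := by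
  have h (r : Fin 3) : ((theta g (u r) : V3) : MvPolynomial (Fin 2) ℂ)
      = MvPolynomial.aeval (fun i : Fin 2 =>
        ∑ j, MvPolynomial.C (g⁻¹ i j) * (MvPolynomial.X j : MvPolynomial (Fin 2) ℂ))
        (u r : MvPolynomial (Fin 2) ℂ) := rfl
  refine ⟨?_, ?_, ?_⟩ <;>
  · apply Subtype.ext
    rw [h]
    simp [coe_u, Fin.sum_univ_two, MvPolynomial.smul_eq_C_mul]
    try simp only [show (MvPolynomial.C (2 : ℂ) : MvPolynomial (Fin 2) ℂ) = 2 from map_ofNat _ 2]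
    ring

theorem inv_of_mem_specialUnitaryGroup {g : Matrix (Fin 2) (Fin 2) ℂ}
    (hg : g ∈ Matrix.specialUnitaryGroup (Fin 2) ℂ) :
    g⁻¹ 0 0 = star (g 0 0) ∧ g⁻¹ 0 1 = -g 0 1 ∧ g⁻¹ 1 0 = star (g 0 1) ∧ g⁻¹ 1 1 = g 0 0 := by
  rw [Matrix.mem_specialUnitaryGroup_iff] at hg
  obtain ⟨h1, h2⟩ := hg
  have h3 : g⁻¹ = star g := Matrix.inv_eq_right_inv (Matrix.mem_unitaryGroup_iff.mp h1)
  have h4 : g⁻¹ = g.adjugate := by rw [Matrix.inv_def, h2]; simp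
  refine ⟨?_, ?_, ?_, ?_⟩
  · rw [h3]; rfl
  · rw [h4, Matrix.adjugate_fin_two]; rfl
  · rw [h3]; rfl
  · rw [h4, Matrix.adjugate_fin_two]; rfl

/-- The matrix coefficients of `σ³(B)` are linear in the entries of `B`; the column `r` contains the
coordinates of the image of `u r`. -/
def sigma3Coeff (B : Matrix (Fin 3) (Fin 3) ℝ) : Matrix (Fin 3) (Fin 3) ℂ :=
  !![(B 0 0 + B 1 1 - Complex.I * (B 0 1 - B 1 0)) / 2, (-B 0 2 - Complex.I * B 1 2) / 2,
      (B 1 1 - B 0 0 - Complex.I * (B 0 1 + B 1 0)) / 2;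
    -(B 2 0 - Complex.I * B 2 1), B 2 2, B 2 0 + Complex.I * B 2 1;
    (B 1 1 - B 0 0 + Complex.I * (B 0 1 + B 1 0)) / 2, (B 0 2 - Complex.I * B 1 2) / 2,
      (B 0 0 + B 1 1 + Complex.I * (B 0 1 - B 1 0)) / 2]

theorem theta_eq_sigma3Coeff {g : Matrix (Fin 2) (Fin 2) ℂ}
    (hg : g ∈ Matrix.specialUnitaryGroup (Fin 2) ℂ) (r : Fin 3) :
    theta g (u r) = ∑ i, sigma3Coeff (varpi g) i r • u i := by
  obtain ⟨h00, h01, h10, h11⟩ := inv_of_mem_specialUnitaryGroup hg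
  obtain ⟨e0, e1, e2⟩ := theta_u g
  simp only [h00, h01, h10, h11] at e0 e1 e2
  rw [Fin.sum_univ_three]
  fin_cases r
  · refine e0.trans ?_
    congr 1; congr 1
    all_goals congr 1; simp [sigma3Coeff, varpi]
    all_goals
      apply Complex.ext <;> simp [pow_two] <;> ring
  · refine e1.trans ?_
    congr 1; congr 1
    all_goals congr 1; simp [sigma3Coeff, varpi]
    all_goals
      apply Complex.ext <;> simp [Complex.normSq_apply] <;> ring
  · refine e2.trans ?_
    congr 1; congr 1
    all_goals congr 1; simp [sigma3Coeff, varpi]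
    all_goals
      apply Complex.ext <;> simp [pow_two] <;> ring

theorem sigma3_u {B : Matrix (Fin 3) (Fin 3) ℝ}
    (hB : ∃ g ∈ Matrix.specialUnitaryGroup (Fin 2) ℂ, varpi g = B) (r : Fin 3) :
    sigma3 B (u r) = ∑ i, sigma3Coeff B i r • u i := by
  rw [sigma3, dif_pos hB, theta_eq_sigma3Coeff hB.choose_spec.1, hB.choose_spec.2]

theorem mem_specialUnitaryGroup_of {x y : ℂ} (h : Complex.normSq x + Complex.normSq y = 1) :
    !![x, y; -star y, star x] ∈ Matrix.specialUnitaryGroup (Fin 2) ℂ := by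
  have h' : x * star x + y * star y = 1 := by
    have := congrArg (Complex.ofReal) h
    simpa [← Complex.mul_conj] using this
  rw [Matrix.mem_specialUnitaryGroup_iff, Matrix.mem_unitaryGroup_iff]
  constructor
  · ext i j
    fin_cases i <;> fin_cases j <;>
      simp [Matrix.mul_apply, Fin.sum_univ_two, Matrix.star_apply] at h' ⊢ <;>
      first | linear_combination h' | ring1
  · simp [Matrix.det_fin_two] at h' ⊢
    linear_combination h'

theorem sigma3_rot (s : ℝ) (r : Fin 3) :
    sigma3 (rot s) (u r) = Complex.exp (Complex.I * (1 - (r : ℕ)) * s) • u r := by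
  have hB : ∃ g ∈ Matrix.specialUnitaryGroup (Fin 2) ℂ, varpi g = rot s := by
    refine ⟨_, mem_specialUnitaryGroup_of (x := ⟨Real.cos (s / 2), -Real.sin (s / 2)⟩) (y := 0) ?_,
      ?_⟩
    · simp [Complex.normSq_apply]
      nlinarith [Real.sin_sq_add_cos_sq (s / 2)]
    · have hc : Real.cos s = Real.cos (s / 2) ^ 2 - Real.sin (s / 2) ^ 2 := by
        rw [← Real.cos_two_mul', mul_div_cancel₀ _ two_ne_zero]
      have hs : Real.sin s = 2 * Real.sin (s / 2) * Real.cos (s / 2) := by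
        rw [← Real.sin_two_mul, mul_div_cancel₀ _ two_ne_zero]
      have h1 := Real.sin_sq_add_cos_sq (s / 2)
      rw [rot, hc, hs]
      ext i j
      fin_cases i <;> fin_cases j <;> simp [varpi, pow_two, Complex.normSq_apply] <;>
        first | ring1 | linear_combination h1
  have he (z : ℂ) : Complex.exp (Complex.I * z) = Complex.cos z + Complex.sin z * Complex.I := by
    rw [mul_comm, Complex.exp_mul_I]
  rw [sigma3_u hB, Fin.sum_univ_three, mul_assoc, he]
  fin_cases r
  · simp [sigma3Coeff, rot]
    ring_nf
  · simp [sigma3Coeff, rot]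
  · simp only [Fin.reduceFinMk]
    simp [sigma3Coeff, rot]
    norm_num
    ring_nf

open scoped Matrix.Norms.Operator in
/-- Rodrigues' formula. -/
theorem exp_smul_of_cube_eq_neg {X : Matrix (Fin 3) (Fin 3) ℝ} (h : X * X * X = -X) (t : ℝ) :
    NormedSpace.exp (t • X) = 1 + Real.sin t • X + (1 - Real.cos t) • (X * X) := by
  let R : ℝ → Matrix (Fin 3) (Fin 3) ℝ :=
    fun t => 1 + Real.sin t • X + (1 - Real.cos t) • (X * X)
  have hR (t : ℝ) : HasDerivAt R (X * R t) t := by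
    have h1 := (((Real.hasDerivAt_sin t).smul_const X).const_add 1).add
      (((Real.hasDerivAt_cos t).const_sub 1).smul_const (X * X))
    convert! h1 using 1
    simp only [R, mul_add, mul_one, mul_smul_comm, ← mul_assoc, h]
    module
  have hE (t : ℝ) : HasDerivAt (fun t : ℝ => NormedSpace.exp (t • -X))
      (NormedSpace.exp (t • -X) * -X) t := hasDerivAt_exp_smul_const (-X) t
  have hc (t : ℝ) : NormedSpace.exp (t • -X) * R t = 1 := by
    have hd (t : ℝ) : HasDerivAt (fun t => NormedSpace.exp (t • -X) * R t) 0 t := by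
      convert! (hE t).mul (hR t) using 1
      noncomm_ring
    have := is_const_of_deriv_eq_zero (fun t => (hd t).differentiableAt) (fun t => (hd t).deriv) t 0
    refine this.trans ?_
    simp [R]
  have hi := hc t
  rw [smul_neg, Matrix.exp_neg] at hi
  have hu := Matrix.isUnit_exp (t • X)
  calc NormedSpace.exp (t • X)
      = NormedSpace.exp (t • X) * ((NormedSpace.exp (t • X))⁻¹ * R t) := by rw [hi, mul_one]
    _ = R t := by
      rw [← mul_assoc, Matrix.mul_nonsing_inv _ ((Matrix.isUnit_iff_isUnit_det _).mp hu), one_mul]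

/-- If `exp(tX)`, as given by Rodrigues' formula, lifts to `SU(2)` for all `t`, then `dσ³(X)` has the
matrix `sigma3Coeff X`. -/
theorem dsigma3Real_u {X : Matrix (Fin 3) (Fin 3) ℝ} (hX : X * X * X = -X)
    (hg : ∀ t : ℝ, ∃ g ∈ Matrix.specialUnitaryGroup (Fin 2) ℂ,
      varpi g = 1 + Real.sin t • X + (1 - Real.cos t) • (X * X)) (r : Fin 3) :
    dsigma3Real X (u r) = ∑ i, sigma3Coeff X i r • u i := by
  rw [dsigma3Real, Matrix.toLin_self]
  refine Finset.sum_congr rfl fun i _ => ?_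
  congr 1
  rw [Matrix.of_apply]
  have e : (fun t : ℝ => u.repr (sigma3 (NormedSpace.exp (t • X)) (u r)) i)
      = fun t : ℝ => sigma3Coeff 1 i r + (Real.sin t : ℂ) * sigma3Coeff X i r
        + ((1 - Real.cos t : ℝ) : ℂ) * sigma3Coeff (X * X) i r := by
    funext t
    rw [exp_smul_of_cube_eq_neg hX, sigma3_u (hg t), map_sum, Finsupp.finsetSum_apply]
    simp only [map_smul, Module.Basis.repr_self, Finsupp.smul_apply, Finsupp.single_apply,
      smul_eq_mul, mul_ite, mul_one, mul_zero, Finset.sum_ite_eq', Finset.mem_univ, if_true]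
    generalize X * X = Y
    fin_cases i <;> fin_cases r <;> simp [sigma3Coeff] <;> ring
  rw [e]
  have h1 := ((Real.hasDerivAt_sin 0).ofReal_comp.mul_const (sigma3Coeff X i r)).const_add
    (sigma3Coeff 1 i r)
  have h2 := ((Real.hasDerivAt_cos 0).const_sub 1).ofReal_comp.mul_const (sigma3Coeff (X * X) i r)
  refine HasDerivAt.deriv ?_
  convert! h1.add h2 using 1
  simp

/-- The one-parameter groups `exp(t X_{p,q})` lift to `SU(2)` with half the angle, so that Rodrigues'
formula and the linearity of the matrix coefficients of `σ³` give the differential. -/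
theorem dsigma3Real_Xso (r : Fin 3) :
    dsigma3Real (Xso 0 1) (u r) = ∑ i, sigma3Coeff (Xso 0 1) i r • u i ∧
    dsigma3Real (Xso 0 2) (u r) = ∑ i, sigma3Coeff (Xso 0 2) i r • u i ∧
    dsigma3Real (Xso 1 2) (u r) = ∑ i, sigma3Coeff (Xso 1 2) i r • u i := by
  have hc (t : ℝ) : Real.cos t = Real.cos (t / 2) ^ 2 - Real.sin (t / 2) ^ 2 := by
    rw [← Real.cos_two_mul', mul_div_cancel₀ _ two_ne_zero]
  have hs (t : ℝ) : Real.sin t = 2 * Real.sin (t / 2) * Real.cos (t / 2) := by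
    rw [← Real.sin_two_mul, mul_div_cancel₀ _ two_ne_zero]
  refine ⟨dsigma3Real_u ?_ (fun t => ⟨_, mem_specialUnitaryGroup_of
      (x := ⟨Real.cos (t / 2), -Real.sin (t / 2)⟩) (y := 0) ?_, ?_⟩) r,
    dsigma3Real_u ?_ (fun t => ⟨_, mem_specialUnitaryGroup_of
      (x := ⟨Real.cos (t / 2), 0⟩) (y := ⟨Real.sin (t / 2), 0⟩) ?_, ?_⟩) r,
    dsigma3Real_u ?_ (fun t => ⟨_, mem_specialUnitaryGroup_of
      (x := ⟨Real.cos (t / 2), 0⟩) (y := ⟨0, -Real.sin (t / 2)⟩) ?_, ?_⟩) r⟩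
  case refine_1 | refine_4 | refine_7 =>
    ext i j
    fin_cases i <;> fin_cases j <;> simp [Xso, Matrix.mul_apply,
      Matrix.single_apply]
  case refine_2 | refine_5 | refine_8 =>
    have h1 := Real.sin_sq_add_cos_sq (t / 2)
    simp [Complex.normSq_apply]
    linear_combination h1
  case refine_3 | refine_6 | refine_9 =>
    have h1 := Real.sin_sq_add_cos_sq (t / 2)
    rw [hc t, hs t]
    ext i j
    fin_cases i <;> fin_cases j <;> simp [varpi, pow_two, Complex.normSq_apply, Xso,
      Matrix.mul_apply, Matrix.single_apply] <;>
      first | ring1 | linear_combination h1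

theorem dsigma3Real_01 :
    dsigma3Real (Xso 0 1) (u 0) = Complex.I • u 0 ∧ dsigma3Real (Xso 0 1) (u 1) = 0 ∧
    dsigma3Real (Xso 0 1) (u 2) = -Complex.I • u 2 := by
  refine ⟨?_, ?_, ?_⟩ <;> rw [(dsigma3Real_Xso _).1, Fin.sum_univ_three] <;>
    simp [sigma3Coeff, Xso]
  · congr 1
    ring
  · congr 1
    ring

theorem dsigma3Real_02 :
    dsigma3Real (Xso 0 2) (u 0) = -u 1 ∧
    dsigma3Real (Xso 0 2) (u 1) = (1 / 2 : ℂ) • u 0 - (1 / 2 : ℂ) • u 2 ∧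
    dsigma3Real (Xso 0 2) (u 2) = u 1 := by
  refine ⟨?_, ?_, ?_⟩ <;> rw [(dsigma3Real_Xso _).2.1, Fin.sum_univ_three] <;>
    simp [sigma3Coeff, Xso]
  · module
  · rw [show (-1 / 2 : ℂ) = -2⁻¹ by norm_num]
    module

theorem dsigma3Real_12 :
    dsigma3Real (Xso 1 2) (u 0) = Complex.I • u 1 ∧
    dsigma3Real (Xso 1 2) (u 1) = (Complex.I / 2) • u 0 + (Complex.I / 2) • u 2 ∧
    dsigma3Real (Xso 1 2) (u 2) = Complex.I • u 1 := by
  refine ⟨?_, ?_, ?_⟩ <;> rw [(dsigma3Real_Xso _).2.2, Fin.sum_univ_three] <;>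
    simp [sigma3Coeff, Xso]

/-! ### The differential operators of the F-system -/

theorem polyOf_eq {n : ℕ} {f : (Fin n → ℂ) → ℂ} (p : MvPolynomial (Fin n) ℂ)
    (h : ∀ z, MvPolynomial.eval z p = f z) : polyOf f = p := by
  have hex : ∃ p : MvPolynomial (Fin n) ℂ, ∀ z, MvPolynomial.eval z p = f z := ⟨p, h⟩
  rw [polyOf, dif_pos hex]
  exact MvPolynomial.funext fun z => (hex.choose_spec z).trans (h z).symm

theorem ofPoly_monomial {n : ℕ} (s : Fin n →₀ ℕ) :
    Weyl.ofPoly (MvPolynomial.monomial s (1 : ℂ)) = (List.ofFn fun j => Weyl.coord j ^ s j).prod := by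
  have : MvPolynomial.monomial s (1 : ℂ) = MvPolynomial.basisMonomials (Fin n) ℂ s := by
    rw [MvPolynomial.coe_basisMonomials]
  rw [this, Weyl.ofPoly, Module.Basis.constr_basis]

theorem ofPoly_X (i : Fin 3) : Weyl.ofPoly (MvPolynomial.X i) = Weyl.coord i := by
  rw [MvPolynomial.X, ofPoly_monomial]
  fin_cases i <;> simp [List.ofFn_succ]

theorem ofPoly_X_mul_X (i j : Fin 3) :
    Weyl.ofPoly (MvPolynomial.X i * MvPolynomial.X j) = Weyl.coord i * Weyl.coord j := by
  rw [MvPolynomial.X, MvPolynomial.X, MvPolynomial.monomial_mul, one_mul, ofPoly_monomial]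
  have h10 := Weyl.coord_mul_coord (1 : Fin 3) 0
  have h20 := Weyl.coord_mul_coord (2 : Fin 3) 0
  have h21 := Weyl.coord_mul_coord (2 : Fin 3) 1
  fin_cases i <;> fin_cases j <;> simp [List.ofFn_succ, pow_two, h10, h20, h21]

theorem act_fourier_coord (i : Fin 3) (p : Pol) :
    Weyl.act 3 (Weyl.fourier 3 (Weyl.coord i)) p = MvPolynomial.pderiv i p := by
  rw [Weyl.fourier, Weyl.lift_coord, Weyl.act, Weyl.lift_del]
  rfl

theorem act_fourier_del (i : Fin 3) (p : Pol) :
    Weyl.act 3 (Weyl.fourier 3 (Weyl.del i)) p = -(MvPolynomial.X i * p) := by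
  rw [Weyl.fourier, Weyl.lift_del, map_neg, Weyl.act, Weyl.lift_coord]
  rfl

theorem actHom_tmul_dualMap (W : Weyl 3) (T : V3 →ₗ[ℂ] V3) (ψ : V3 →ₗ[ℂ] Pol) :
    actHom (W ⊗ₜ T.dualMap) ψ = Weyl.act 3 W ∘ₗ ψ ∘ₗ T := by
  have h (x : Module.Dual ℂ V3 ⊗[ℂ] Pol) :
      dualTensorHom ℂ V3 Pol (TensorProduct.map T.dualMap (Weyl.act 3 W) x)
        = Weyl.act 3 W ∘ₗ dualTensorHom ℂ V3 Pol x ∘ₗ T := by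
    induction x using TensorProduct.induction_on with
    | zero => simp
    | tmul f p =>
      ext v
      simp [dualTensorHom_apply]
    | add x y hx hy => rw [map_add, map_add, hx, hy, map_add, LinearMap.add_comp, LinearMap.comp_add]
  have h2 : dualTensorHom ℂ V3 Pol ((dualTensorHomEquivOfBasis u).symm ψ) = ψ := by
    have := LinearEquiv.apply_symm_apply (dualTensorHomEquivOfBasis (N := Pol) u) ψ
    simp
  have h3 := h ((dualTensorHomEquivOfBasis u).symm ψ)
  rw [h2] at h3
  rw [← h3]
  simp [actHom]

theorem actHom_add (P Q : Weyl 3 ⊗[ℂ] Module.End ℂ (Module.Dual ℂ V3)) :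
    actHom (P + Q) = actHom P + actHom Q := by
  ext ψ : 1
  simp [actHom]

theorem actHom_sub (P Q : Weyl 3 ⊗[ℂ] Module.End ℂ (Module.Dual ℂ V3)) :
    actHom (P - Q) = actHom P - actHom Q := by
  have h := actHom_add (P - Q) Q
  rw [sub_add_cancel] at h
  rw [h]
  ext ψ : 1
  simp

theorem dmu_H0 (lam : ℂ) : dmu lam H0 = ((3 - lam) • LinearMap.id : V3 →ₗ[ℂ] V3).dualMap := by
  have hz (p q : Fin 3) : H0 (mid q) (mid p) = 0 := by
    fin_cases p <;> fin_cases q <;> simp [H0, mid]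
  have h1 : H0 0 4 = 1 := by simp [H0]
  rw [dmu, h1]
  simp only [hz, zero_smul, Finset.sum_const_zero]
  ext f v
  simp

theorem sum_Ioi_fin_three {M : Type*} [AddCommMonoid M] (f : Fin 3 → Fin 3 → M) :
    ∑ p : Fin 3, ∑ q ∈ Finset.Ioi p, f p q = f 0 1 + f 0 2 + f 1 2 := by
  rw [Fin.sum_univ_three, show Finset.Ioi (0 : Fin 3) = {1, 2} from rfl,
    show Finset.Ioi (1 : Fin 3) = {2} from rfl, show Finset.Ioi (2 : Fin 3) = ∅ from rfl]
  simp

theorem dmu_embed (lam : ℂ) {p q : Fin 3} (h : p < q) :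
    dmu lam (embed 0 (Xso p q)) = (-dsigma3Real (Xso p q)).dualMap := by
  have h1 : embed 0 (Xso p q) 0 4 = 0 := by simp [embed]
  have h2 : ∀ p q p' q', embed 0 (Xso p q) (mid q') (mid p') = (Xso p q q' p' : ℂ) := by
    intro p q p' q'
    fin_cases p' <;> fin_cases q' <;> simp [embed, mid]
  have h3 : (∑ p' : Fin 3, ∑ q' ∈ Finset.Ioi p', embed 0 (Xso p q) (mid q') (mid p') •
      dsigma3Real (Xso p' q')) = dsigma3Real (Xso p q) := by
    simp only [h2]
    rw [sum_Ioi_fin_three]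
    fin_cases p <;> fin_cases q <;> simp at h <;> simp [Xso]
  rw [dmu, h1, h3]
  ext f v
  simp

/-- The equation of the F-system that belongs to the element of `𝔫₊` with coordinates `y`. -/
theorem actHom_dpiHat_nPlus (lam : ℂ) (y : Fin 3 → ℂ) (ψ : V3 →ₗ[ℂ] Pol) (v : V3) :
    actHom (dpiHat lam (nPlus y)) ψ v =
      MvPolynomial.C (2 * lam) * (∑ j, MvPolynomial.C (y j) * MvPolynomial.pderiv j (ψ v))
      + 2 * (∑ k, MvPolynomial.X k * MvPolynomial.pderiv k
          (∑ j, MvPolynomial.C (y j) * MvPolynomial.pderiv j (ψ v)))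
      - (∑ j, MvPolynomial.C (y j) * MvPolynomial.X j) *
        ∑ k, MvPolynomial.pderiv k (MvPolynomial.pderiv k (ψ v))
      - (∑ p, ∑ q ∈ Finset.Ioi p,
          2 * (MvPolynomial.C (y p) * MvPolynomial.pderiv q (ψ (dsigma3Real (Xso p q) v))
            - MvPolynomial.C (y q) * MvPolynomial.pderiv p (ψ (dsigma3Real (Xso p q) v)))) := by
  have hα : (Weyl.ofPoly (polyOf fun z => alpha (nPlus y) z 0 4)) =
      ∑ j, (-2 * y j) • Weyl.coord j := by
    rw [polyOf_eq (∑ j, (-2 * y j) • MvPolynomial.X j)]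
    · simp [ofPoly_X]
    · intro z
      rw [alpha_nPlus_zero_four]
      simp [MvPolynomial.smul_eval, Fin.sum_univ_three]
      ring
  have hα' (p q : Fin 3) : (Weyl.ofPoly (polyOf fun z => alpha (nPlus y) z (mid q) (mid p))) =
      (2 * y p) • Weyl.coord q - (2 * y q) • Weyl.coord p := by
    rw [polyOf_eq ((2 * y p) • MvPolynomial.X q - (2 * y q) • MvPolynomial.X p)]
    · simp [ofPoly_X]
    · intro z
      rw [alpha_nPlus_mid]
      simp [MvPolynomial.smul_eval]
      ring
  have hβ (j : Fin 3) : (Weyl.ofPoly (polyOf fun z => beta (nPlus y) z j)) =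
      ∑ k, (2 * y k) • (Weyl.coord k * Weyl.coord j) - y j • ∑ k, Weyl.coord k * Weyl.coord k := by
    rw [polyOf_eq (∑ k, (2 * y k) • (MvPolynomial.X k * MvPolynomial.X j)
      - y j • ∑ k, MvPolynomial.X k * MvPolynomial.X k)]
    · simp [ofPoly_X_mul_X]
    · intro z
      rw [beta_nPlus]
      simp [MvPolynomial.smul_eval, Fin.sum_univ_three]
      ring
  have hid : (LinearMap.id : Module.End ℂ (Module.Dual ℂ V3))
      = (LinearMap.id : V3 →ₗ[ℂ] V3).dualMap := by
    rw [LinearMap.dualMap_id]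
  have hX (i j : Fin 3) (p : Pol) : MvPolynomial.pderiv i (MvPolynomial.X j * p)
      = MvPolynomial.X j * MvPolynomial.pderiv i p + (if i = j then p else 0) := by
    rw [Derivation.leibniz, MvPolynomial.pderiv_X, Pi.single_apply, smul_eq_mul, smul_eq_mul]
    simp only [eq_comm (a := i)]
    split_ifs <;> simp
  have hC (i : Fin 3) (c : ℂ) (p : Pol) : MvPolynomial.pderiv i (MvPolynomial.C c * p)
      = MvPolynomial.C c * MvPolynomial.pderiv i p := MvPolynomial.pderiv_C_mul
  rw [dpiHat, dpi]
  simp only [hα, hα', hβ, hid, dmu_H0, sum_Ioi_fin_three]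
  rw [dmu_embed lam (show (0 : Fin 3) < 1 by decide), dmu_embed lam (show (0 : Fin 3) < 2 by decide),
    dmu_embed lam (show (1 : Fin 3) < 2 by decide)]
  rw [Fin.sum_univ_three (f := fun j => (_ ⊗ₜ[ℂ] LinearMap.dualMap LinearMap.id))]
  simp only [map_add, map_sub, TensorProduct.map_tmul, LinearMap.id_apply, actHom_add, actHom_sub,
    AlgHom.toLinearMap_apply, LinearMap.add_apply, LinearMap.sub_apply, actHom_tmul_dualMap,
    LinearMap.comp_apply, map_mul, map_smul, Fin.sum_univ_three, Module.End.mul_apply,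
    LinearMap.smul_apply, act_fourier_coord, act_fourier_del, map_neg, LinearMap.neg_apply, hX, hC]
  simp only [pderiv_pderiv 1 0, pderiv_pderiv 2 0, pderiv_pderiv 2 1,
    MvPolynomial.smul_eq_C_mul, map_mul, map_sub, map_neg,
    show (MvPolynomial.C (2 : ℂ) : Pol) = 2 from map_ofNat _ 2,
    show (MvPolynomial.C (3 : ℂ) : Pol) = 3 from map_ofNat _ 3]
  simp
  ring

/-! ### The recurrence system -/

/-- The F-system in terms of the coefficients `c_r(j)` of a solution; here `M = m - 1` and
`n = a - M`, and `c_r(j)` has a meaning for `r + 2 * j ≤ n`. The equations `raise` come from one of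
the two generators of `𝔫₊'`, the equations `lower` from the other. -/
structure FRec (M n : ℕ) (nu : ℂ) (c₀ c₁ c₂ : ℕ → ℂ) : Prop where
  raise₀_zero : M * nu * c₀ 0 = 0
  raise₀ : ∀ j N : ℕ, 2 * (j + 1) + N = n →
    4 * (M + j + 1) * (nu - j - 1) * c₀ (j + 1) = (N + 2) * (N + 1) * c₀ j
  raise₁_zero : ∀ N : ℕ, N + 1 = n → 4 * (M + 1) * (nu - 1) * c₁ 0 = 2 * (N + 1) * c₀ 0
  raise₁ : ∀ j N : ℕ, 1 + 2 * (j + 1) + N = n →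
    4 * (M + j + 2) * (nu - j - 2) * c₁ (j + 1)
      = (N + 2) * (N + 1) * c₁ j + 2 * (N + 1) * c₀ (j + 1)
  raise₂_zero : ∀ N : ℕ, N + 2 = n → 4 * (M + 2) * (nu - 2) * c₂ 0 = 4 * (N + 1) * c₁ 0
  raise₂ : ∀ j N : ℕ, 2 + 2 * (j + 1) + N = n →
    4 * (M + j + 3) * (nu - j - 3) * c₂ (j + 1)
      = (N + 2) * (N + 1) * c₂ j + 4 * (N + 1) * c₁ (j + 1)
  lower₀ : ∀ j N : ℕ, 2 * (j + 1) + N = n →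
    4 * (j + 1) * (nu - M - 3 - j) * c₀ (j + 1) = (N + 2) * (N + 1) * c₀ j - 4 * (N + 1) * c₁ j
  lower₁ : ∀ j N : ℕ, 1 + 2 * (j + 1) + N = n →
    4 * (j + 1) * (nu - M - 3 - j) * c₁ (j + 1) = (N + 2) * (N + 1) * c₁ j - 2 * (N + 1) * c₂ j
  lower₂ : ∀ j N : ℕ, 2 + 2 * (j + 1) + N = n →
    4 * (j + 1) * (nu - M - 3 - j) * c₂ (j + 1) = (N + 2) * (N + 1) * c₂ j

namespace FRec

variable {M n : ℕ} {nu : ℂ} {c₀ c₁ c₂ : ℕ → ℂ}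

/-! The equations `raise` and `lower` with the same indices contain the same term `(N + 2) (N + 1) c_r(j)`, so
that their differences relate `c_r(j + 1)` to coefficients of the other components. -/

theorem link₀ (h : FRec M n nu c₀ c₁ c₂) (j N : ℕ) (hj : 2 * (j + 1) + N = n) :
    (N + 1) * c₁ j = (2 * (j + 1) + M * nu) * c₀ (j + 1) := by
  linear_combination (h.lower₀ j N hj - h.raise₀ j N hj) / 4

theorem link₁_zero (h : FRec M n nu c₀ c₁ c₂) (N : ℕ) (hN : N + 1 = n) :
    2 * (M + 1) * (nu - 1) * c₁ 0 = (N + 1) * c₀ 0 := by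
  linear_combination h.raise₁_zero N hN / 2

theorem link₁ (h : FRec M n nu c₀ c₁ c₂) (j N : ℕ) (hj : 1 + 2 * (j + 1) + N = n) :
    2 * (M + 1) * (nu - 1) * c₁ (j + 1) = (N + 1) * (c₀ (j + 1) + c₂ j) := by
  linear_combination (h.raise₁ j N hj - h.lower₁ j N hj) / 2

theorem link₂ (h : FRec M n nu c₀ c₁ c₂) (j N : ℕ) (hj : 2 + 2 * j + N = n) :
    ((M + 2) * (nu - 2) - 2 * j) * c₂ j = (N + 1) * c₁ j := by
  cases j with
  | zero =>
    have := h.raise₂_zero N (by omega)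
    push_cast
    linear_combination this / 4
  | succ j =>
    push_cast
    linear_combination (h.raise₂ j N hj - h.lower₂ j N hj) / 4

/-- The recurrence system follows from the equations `lower` for `c₁` and `c₂`, the equation `raise`
for `c₀`, and the relations between the coefficients of different components. -/
theorem of_link (h₀ : M * nu * c₀ 0 = 0)
    (hr : ∀ j N : ℕ, 2 * (j + 1) + N = n →
      4 * (M + j + 1) * (nu - j - 1) * c₀ (j + 1) = (N + 2) * (N + 1) * c₀ j)
    (hl₁ : ∀ j N : ℕ, 1 + 2 * (j + 1) + N = n →
      4 * (j + 1) * (nu - M - 3 - j) * c₁ (j + 1) = (N + 2) * (N + 1) * c₁ j - 2 * (N + 1) * c₂ j)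
    (hl₂ : ∀ j N : ℕ, 2 + 2 * (j + 1) + N = n →
      4 * (j + 1) * (nu - M - 3 - j) * c₂ (j + 1) = (N + 2) * (N + 1) * c₂ j)
    (k₀ : ∀ j N : ℕ, 2 * (j + 1) + N = n → (N + 1) * c₁ j = (2 * (j + 1) + M * nu) * c₀ (j + 1))
    (k₁z : ∀ N : ℕ, N + 1 = n → 2 * (M + 1) * (nu - 1) * c₁ 0 = (N + 1) * c₀ 0)
    (k₁ : ∀ j N : ℕ, 1 + 2 * (j + 1) + N = n →
      2 * (M + 1) * (nu - 1) * c₁ (j + 1) = (N + 1) * (c₀ (j + 1) + c₂ j))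
    (k₂ : ∀ j N : ℕ, 2 + 2 * j + N = n → ((M + 2) * (nu - 2) - 2 * j) * c₂ j = (N + 1) * c₁ j) :
    FRec M n nu c₀ c₁ c₂ where
  raise₀_zero := h₀
  raise₀ := hr
  raise₁_zero N hN := by linear_combination 2 * k₁z N hN
  raise₁ j N hj := by linear_combination hl₁ j N hj + 2 * k₁ j N hj
  raise₂_zero N hN := by
    have := k₂ 0 N (by omega)
    push_cast at this
    linear_combination 4 * this
  raise₂ j N hj := by
    have := k₂ (j + 1) N hj
    push_cast at this
    linear_combination hl₂ j N hj + 4 * this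
  lower₀ j N hj := by linear_combination hr j N hj + 4 * k₀ j N hj
  lower₁ := hl₁
  lower₂ := hl₂

/-- If `c₂` vanishes then so does everything, provided that `2 ≤ n`. -/
theorem eq_zero_of_c₂ (h : FRec M n nu c₀ c₁ c₂) (hn : 2 ≤ n) (h₂ : ∀ j, 2 + 2 * j ≤ n → c₂ j = 0) :
    (∀ j, 2 * j ≤ n → c₀ j = 0) ∧ (∀ j, 1 + 2 * j ≤ n → c₁ j = 0) := by
  have ne (N : ℕ) : (N : ℂ) + 1 ≠ 0 := Nat.cast_add_one_ne_zero N
  have h₁ (j : ℕ) (hj : 2 + 2 * j ≤ n) : c₁ j = 0 := by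
    have e := h.link₂ j (n - 2 - 2 * j) (by omega)
    rw [h₂ j hj, mul_zero, eq_comm, mul_eq_zero] at e
    exact e.resolve_left (ne _)
  -- At the two largest indices a coefficient can vanish for special `ν`; there one of two equations
  -- applies.
  have h₀ (j : ℕ) (hj : 2 + 2 * j ≤ n) : c₀ j = 0 := by
    cases j with
    | zero =>
      have e := h.link₁_zero (n - 1) (by omega)
      rw [h₁ 0 (by omega), mul_zero, eq_comm, mul_eq_zero] at e
      exact e.resolve_left (ne _)
    | succ j =>
      have e := h.link₁ j (n - 1 - 2 * (j + 1)) (by omega)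
      rw [h₁ (j + 1) hj, h₂ j (by omega), mul_zero, add_zero, eq_comm, mul_eq_zero] at e
      exact e.resolve_left (ne _)
  have h₀' (j : ℕ) (hj : 2 * j ≤ n) : c₀ j = 0 := by
    by_cases hj2 : 2 + 2 * j ≤ n
    · exact h₀ j hj2
    obtain ⟨j, rfl⟩ : ∃ i, j = i + 1 := ⟨j - 1, by omega⟩
    have e1 := h.link₀ j (n - 2 * (j + 1)) (by omega)
    have e2 := h.raise₀ j (n - 2 * (j + 1)) (by omega)
    rw [h₁ j (by omega), mul_zero, eq_comm, mul_eq_zero] at e1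
    rw [h₀ j (by omega), mul_zero, mul_eq_zero] at e2
    by_contra hne
    have f1 := e1.resolve_right hne
    have f2 := e2.resolve_right hne
    have f3 : (4 * ((M : ℂ) + j + 1)) ≠ 0 := by
      have := ne (M + j)
      push_cast at this
      exact mul_ne_zero (by norm_num) this
    have f4 : nu = j + 1 := by
      have := (mul_eq_zero.mp f2).resolve_left f3
      linear_combination this
    rw [f4] at f1
    have f5 : ((2 + M : ℕ) : ℂ) * ((j + 1 : ℕ) : ℂ) = 0 := by
      push_cast
      linear_combination f1
    rw [← Nat.cast_mul, Nat.cast_eq_zero] at f5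
    simp at f5
  refine ⟨h₀', fun j hj => ?_⟩
  by_cases hj2 : 2 + 2 * j ≤ n
  · exact h₁ j hj2
  obtain ⟨j, rfl⟩ : ∃ i, j = i + 1 := ⟨j - 1, by omega⟩
  have e1 := h.link₁ j (n - 1 - 2 * (j + 1)) (by omega)
  have e2 := h.lower₁ j (n - 1 - 2 * (j + 1)) (by omega)
  rw [h₀' (j + 1) (by omega), h₂ j (by omega), add_zero, mul_zero, mul_eq_zero] at e1
  rw [h₁ j (by omega), h₂ j (by omega), mul_zero, mul_zero, sub_zero, mul_eq_zero] at e2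
  by_contra hne
  have f1 := e1.resolve_right hne
  have f2 := e2.resolve_right hne
  have f3 : (2 * ((M : ℂ) + 1)) ≠ 0 := mul_ne_zero two_ne_zero (ne M)
  have f4 : nu = 1 := by
    have := (mul_eq_zero.mp f1).resolve_left f3
    linear_combination this
  rw [f4] at f2
  have f5 : ((j + 1 : ℕ) : ℂ) * ((M + 2 + j : ℕ) : ℂ) = 0 := by
    push_cast
    linear_combination -f2 / 4
  rw [← Nat.cast_mul, Nat.cast_eq_zero] at f5
  simp at f5

/-- The index of a coefficient that determines a solution: the last one of `c₂` if `n ≥ 2`, and the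
only one of `c_n` if `n ≤ 1`. -/
def leadCoeff (n : ℕ) (c₀ c₁ c₂ : ℕ → ℂ) : ℂ :=
  if n = 0 then c₀ 0 else if n = 1 then c₁ 0 else c₂ ((n - 2) / 2)

theorem eq_zero_of_leadCoeff (h : FRec M n nu c₀ c₁ c₂) (hl : leadCoeff n c₀ c₁ c₂ = 0) :
    (∀ j, 2 * j ≤ n → c₀ j = 0) ∧ (∀ j, 1 + 2 * j ≤ n → c₁ j = 0) ∧
      (∀ j, 2 + 2 * j ≤ n → c₂ j = 0) := by
  rw [leadCoeff] at hl
  split_ifs at hl with hn0 hn1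
  · refine ⟨fun j hj => ?_, fun j hj => by omega, fun j hj => by omega⟩
    rw [show j = 0 by omega, hl]
  · have e := h.link₁_zero 0 (by omega)
    rw [hl, mul_zero] at e
    refine ⟨fun j hj => ?_, fun j hj => ?_, fun j hj => by omega⟩
    · rw [show j = 0 by omega]
      simpa using e.symm
    · rw [show j = 0 by omega, hl]
  · have h₂ (i : ℕ) : ∀ j, j + i = (n - 2) / 2 → c₂ j = 0 := by
      induction i with
      | zero =>
        intro j hj
        rw [show j = (n - 2) / 2 by omega, hl]
      | succ i ih =>
        intro j hj
        have e := h.lower₂ j (n - 2 - 2 * (j + 1)) (by omega)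
        rw [ih (j + 1) (by omega), mul_zero, eq_comm, mul_eq_zero] at e
        refine e.resolve_left (mul_ne_zero ?_ (Nat.cast_add_one_ne_zero _))
        have := Nat.cast_add_one_ne_zero (R := ℂ) (n - 2 - 2 * (j + 1) + 1)
        rw [Nat.cast_add, Nat.cast_one, add_assoc, one_add_one_eq_two] at this
        exact this
    have h₂' : ∀ j, 2 + 2 * j ≤ n → c₂ j = 0 := fun j hj => h₂ ((n - 2) / 2 - j) j (by omega)
    exact ⟨(h.eq_zero_of_c₂ (by omega) h₂').1, (h.eq_zero_of_c₂ (by omega) h₂').2, h₂'⟩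

/-- For `m > 1` the recurrence system has only the zero solution unless `ν ∈ {0, 1, 2}` and
`ν ≤ n`. -/
theorem exists_nu (h : FRec M n nu c₀ c₁ c₂) (hM : 1 ≤ M) (hl : leadCoeff n c₀ c₁ c₂ ≠ 0) :
    ∃ k : ℕ, nu = k ∧ k ≤ 2 ∧ k ≤ n := by
  have ne (N : ℕ) : (N : ℂ) + 1 ≠ 0 := Nat.cast_add_one_ne_zero N
  have hM' : (M : ℂ) ≠ 0 := by exact_mod_cast (by omega : M ≠ 0)
  by_cases h0 : nu = 0
  · exact ⟨0, by simpa using h0, by omega, by omega⟩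
  have z₀ : c₀ 0 = 0 := by
    have := h.raise₀_zero
    exact (mul_eq_zero.mp this).resolve_left (mul_ne_zero hM' h0)
  by_cases hn0 : n = 0
  · simp [leadCoeff, hn0, z₀] at hl
  by_cases h1 : nu = 1
  · exact ⟨1, by simpa using h1, by omega, by omega⟩
  have z₁ : c₁ 0 = 0 := by
    have e := h.link₁_zero (n - 1) (by omega)
    rw [z₀, mul_zero] at e
    exact (mul_eq_zero.mp e).resolve_left
      (mul_ne_zero (mul_ne_zero two_ne_zero (ne M)) (sub_ne_zero.mpr h1))
  by_cases hn1 : n = 1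
  · simp [leadCoeff, hn1, z₁] at hl
  by_cases h2 : nu = 2
  · exact ⟨2, by simpa using h2, by omega, by omega⟩
  exfalso
  have z₂ : ∀ j, 2 + 2 * j ≤ n → c₂ j = 0 := by
    intro j
    induction j with
    | zero =>
      intro hj
      have e := h.link₂ 0 (n - 2) (by omega)
      rw [z₁, mul_zero, Nat.cast_zero, mul_zero, sub_zero] at e
      have hM2 : (M : ℂ) + 2 ≠ 0 := by exact_mod_cast (by omega : M + 2 ≠ 0)
      exact (mul_eq_zero.mp e).resolve_left (mul_ne_zero hM2 (sub_ne_zero.mpr h2))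
    | succ j ih =>
      intro hj
      have p₂ := ih (by omega)
      have e := h.lower₂ j (n - 2 - 2 * (j + 1)) (by omega)
      rw [p₂, mul_zero] at e
      by_cases hres : nu - M - 3 - j = 0
      · -- In the resonant case `ν = M + 3 + j` the coefficient of `c₂ (j + 1)` vanishes, but the
        -- relations between the components still force it to be zero.
        have p₁ : c₁ j = 0 := by
          have e := h.link₂ j (n - 2 - 2 * j) (by omega)
          rw [p₂, mul_zero, eq_comm] at e
          exact (mul_eq_zero.mp e).resolve_left (ne _)
        have hnu : nu = ((M + 3 + j : ℕ) : ℂ) := by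
          push_cast
          linear_combination hres
        have q₀ : c₀ (j + 1) = 0 := by
          have e := h.link₀ j (n - 2 * (j + 1)) (by omega)
          rw [p₁, mul_zero, eq_comm, mul_eq_zero] at e
          refine e.resolve_left ?_
          rw [hnu]
          exact_mod_cast (by positivity : 2 * (j + 1) + M * (M + 3 + j) ≠ 0)
        have q₁ : c₁ (j + 1) = 0 := by
          have e := h.link₁ j (n - 1 - 2 * (j + 1)) (by omega)
          rw [q₀, p₂, add_zero, mul_zero] at e
          exact (mul_eq_zero.mp e).resolve_left
            (mul_ne_zero (mul_ne_zero two_ne_zero (ne M)) (sub_ne_zero.mpr h1))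
        have e := h.link₂ (j + 1) (n - 2 - 2 * (j + 1)) (by omega)
        rw [q₁, mul_zero, mul_eq_zero] at e
        refine e.resolve_left ?_
        have hs : ((M : ℂ) + 2) * (nu - 2) - 2 * ((j + 1 : ℕ) : ℂ)
            = ((M * (M + 3 + j) : ℕ) : ℂ) := by
          rw [hnu]
          push_cast
          ring
        rw [hs]
        exact_mod_cast (by positivity : M * (M + 3 + j) ≠ 0)
      · exact (mul_eq_zero.mp e).resolve_left
          (mul_ne_zero (mul_ne_zero (by norm_num) (ne j)) hres)
  apply hl
  rw [leadCoeff, if_neg hn0, if_neg hn1]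
  exact z₂ _ (by omega)

end FRec

/-! ### Explicit solutions of the recurrence system -/

/-- The coefficient of `t ^ e` in `exp (2 * t)`. -/
def expCoeff (e : ℕ) : ℂ := 2 ^ e / e.factorial

/-- The inverse of the factorial. -/
def invFact (j : ℕ) : ℂ := (j.factorial : ℂ)⁻¹

theorem expCoeff_succ (e : ℕ) : (e + 1) * expCoeff (e + 1) = 2 * expCoeff e := by
  have h1 : (e.factorial : ℂ) ≠ 0 := by exact_mod_cast e.factorial_ne_zero
  have h2 := Nat.cast_add_one_ne_zero (R := ℂ) e
  rw [expCoeff, expCoeff, Nat.factorial_succ, pow_succ]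
  push_cast
  field_simp

theorem expCoeff_add_two (e : ℕ) : (e + 2) * (e + 1) * expCoeff (e + 2) = 4 * expCoeff e := by
  have h1 := expCoeff_succ e
  have h2 := expCoeff_succ (e + 1)
  push_cast at h2
  rw [show e + 2 = e + 1 + 1 from rfl]
  linear_combination (e + 1 : ℂ) * h2 + 2 * h1

theorem invFact_succ (j : ℕ) : (j + 1) * invFact (j + 1) = invFact j := by
  have h1 : (j.factorial : ℂ) ≠ 0 := by exact_mod_cast j.factorial_ne_zero
  have h2 := Nat.cast_add_one_ne_zero (R := ℂ) j
  rw [invFact, invFact, Nat.factorial_succ]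
  push_cast
  field_simp

theorem expCoeff_ne_zero (e : ℕ) : expCoeff e ≠ 0 :=
  div_ne_zero (pow_ne_zero _ two_ne_zero) (by exact_mod_cast e.factorial_ne_zero)

theorem invFact_ne_zero (j : ℕ) : invFact j ≠ 0 :=
  inv_ne_zero (by exact_mod_cast j.factorial_ne_zero)

theorem FRec.smul {M n : ℕ} {nu : ℂ} {c₀ c₁ c₂ : ℕ → ℂ} (h : FRec M n nu c₀ c₁ c₂) (s : ℂ) :
    FRec M n nu (fun j => s * c₀ j) (fun j => s * c₁ j) (fun j => s * c₂ j) where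
  raise₀_zero := by linear_combination s * h.raise₀_zero
  raise₀ j N hj := by linear_combination s * h.raise₀ j N hj
  raise₁_zero N hN := by linear_combination s * h.raise₁_zero N hN
  raise₁ j N hj := by linear_combination s * h.raise₁ j N hj
  raise₂_zero N hN := by linear_combination s * h.raise₂_zero N hN
  raise₂ j N hj := by linear_combination s * h.raise₂ j N hj
  lower₀ j N hj := by linear_combination s * h.lower₀ j N hj
  lower₁ j N hj := by linear_combination s * h.lower₁ j N hj
  lower₂ j N hj := by linear_combination s * h.lower₂ j N hj

/-- The recurrence system only involves the meaningful coefficients. -/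
theorem FRec.congr {M n : ℕ} {nu : ℂ} {c₀ c₁ c₂ d₀ d₁ d₂ : ℕ → ℂ} (h : FRec M n nu c₀ c₁ c₂)
    (h₀ : ∀ j, 2 * j ≤ n → d₀ j = c₀ j) (h₁ : ∀ j, 1 + 2 * j ≤ n → d₁ j = c₁ j)
    (h₂ : ∀ j, 2 + 2 * j ≤ n → d₂ j = c₂ j) : FRec M n nu d₀ d₁ d₂ where
  raise₀_zero := by rw [h₀ 0 (by omega)]; exact h.raise₀_zero
  raise₀ j N hj := by rw [h₀ _ (by omega), h₀ _ (by omega)]; exact h.raise₀ j N hj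
  raise₁_zero N hN := by rw [h₀ _ (by omega), h₁ _ (by omega)]; exact h.raise₁_zero N hN
  raise₁ j N hj := by
    rw [h₁ _ (by omega), h₁ _ (by omega), h₀ _ (by omega)]; exact h.raise₁ j N hj
  raise₂_zero N hN := by rw [h₂ _ (by omega), h₁ _ (by omega)]; exact h.raise₂_zero N hN
  raise₂ j N hj := by
    rw [h₂ _ (by omega), h₂ _ (by omega), h₁ _ (by omega)]; exact h.raise₂ j N hj
  lower₀ j N hj := by
    rw [h₀ _ (by omega), h₀ _ (by omega), h₁ _ (by omega)]; exact h.lower₀ j N hj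
  lower₁ j N hj := by
    rw [h₁ _ (by omega), h₁ _ (by omega), h₂ _ (by omega)]; exact h.lower₁ j N hj
  lower₂ j N hj := by rw [h₂ _ (by omega), h₂ _ (by omega)]; exact h.lower₂ j N hj

/-- The solution for `m = 1`. The function `V` stands for a sequence of rising factorials, all with the
same argument; only its recurrence matters. -/
theorem fRec_one {n : ℕ} {nu : ℂ} {V : ℕ → ℂ}
    (hV : ∀ j, 2 * j ≤ n → V j = (nu - 1 - j) * V (j + 1)) :
    FRec 0 n nu (fun j => V j * expCoeff (n - 2 * j) * invFact j)
      (fun j => V (j + 1) * expCoeff (n - 1 - 2 * j) * invFact j)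
      (fun j => V (j + 2) * expCoeff (n - 2 - 2 * j) * invFact j) := by
  refine FRec.of_link (by simp) ?_ ?_ ?_ ?_ ?_ ?_ ?_
  · intro j N hj
    simp only [show n - 2 * (j + 1) = N by omega, show n - 2 * j = N + 2 by omega]
    rw [hV j (by omega), ← invFact_succ j]
    push_cast
    linear_combination -((nu - 1 - j) * V (j + 1) * (j + 1) * invFact (j + 1)) * expCoeff_add_two N
  · intro j N hj
    simp only [show n - 1 - 2 * (j + 1) = N by omega, show n - 1 - 2 * j = N + 2 by omega,
      show n - 2 - 2 * j = N + 1 by omega]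
    have h1 := hV (j + 1) (by omega)
    rw [h1, ← invFact_succ j]
    push_cast
    linear_combination -((nu - 1 - (j + 1)) * V (j + 1 + 1) * (j + 1) * invFact (j + 1)) *
      expCoeff_add_two N + 2 * V (j + 2) * (j + 1) * invFact (j + 1) * expCoeff_succ N
  · intro j N hj
    simp only [show n - 2 - 2 * (j + 1) = N by omega, show n - 2 - 2 * j = N + 2 by omega]
    have h1 := hV (j + 2) (by omega)
    rw [h1, ← invFact_succ j]
    push_cast
    linear_combination -((nu - 1 - (j + 2)) * V (j + 2 + 1) * (j + 1) * invFact (j + 1)) *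
      expCoeff_add_two N
  · intro j N hj
    simp only [show n - 2 * (j + 1) = N by omega, show n - 1 - 2 * j = N + 1 by omega]
    rw [← invFact_succ j]
    push_cast
    linear_combination V (j + 1) * (j + 1) * invFact (j + 1) * expCoeff_succ N
  · intro N hN
    simp only [show n - 1 - 2 * 0 = N by omega, show n - 2 * 0 = N + 1 by omega]
    rw [hV 0 (by omega)]
    push_cast
    linear_combination -(nu - 1) * V 1 * invFact 0 * expCoeff_succ N
  · intro j N hj
    simp only [show n - 1 - 2 * (j + 1) = N by omega, show n - 2 * (j + 1) = N + 1 by omega,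
      show n - 2 - 2 * j = N + 1 by omega]
    have h1 := hV (j + 1) (by omega)
    rw [h1, ← invFact_succ j]
    push_cast
    linear_combination -(nu - 1) * V (j + 2) * invFact (j + 1) * expCoeff_succ N
  · intro j N hj
    simp only [show n - 2 - 2 * j = N by omega, show n - 1 - 2 * j = N + 1 by omega]
    have h1 := hV (j + 1) (by omega)
    rw [h1]
    push_cast
    linear_combination -(nu - 2 - j) * V (j + 2) * invFact j * expCoeff_succ N

/-- The solutions for `m > 1`, reduced to identities for the factors `v` and `w` of the second and of
the first component, which do not depend on `n`. -/
theorem fRec_of_weights {M n : ℕ} {nu : ℂ} {V v w : ℕ → ℂ}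
    (hV : ∀ j, 1 + 2 * j ≤ n → V j = (nu - M - 2 - j) * V (j + 1))
    (hv : ∀ j, v j = (M + 2) * (2 - nu) + 2 * j)
    (hw₀ : M * nu * w 0 = 0)
    (hw : ∀ j : ℕ, (M + j + 1) * (nu - j - 1) * w (j + 1) = w j * (j + 1) * (nu - M - 2 - j))
    (hvw : ∀ j : ℕ, v j * (j + 1) = (2 * (j + 1) + M * nu) * w (j + 1))
    (hvw₀ : (M + 1) * (nu - 1) * v 0 = 2 * w 0 * (nu - M - 2))
    (hvw₁ : ∀ j : ℕ, (M + 1) * (nu - 1) * v (j + 1)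
      = 2 * (w (j + 1) - (j + 1)) * (nu - M - 3 - j)) :
    FRec M n nu (fun j => 2 * w j * V j * expCoeff (n - 2 * j) * invFact j)
      (fun j => v j * V (j + 1) * expCoeff (n - 1 - 2 * j) * invFact j)
      (fun j => -2 * V (j + 1) * expCoeff (n - 2 - 2 * j) * invFact j) := by
  refine FRec.of_link ?_ ?_ ?_ ?_ ?_ ?_ ?_ ?_
  · linear_combination (2 * V 0 * expCoeff (n - 2 * 0) * invFact 0) * hw₀
  · intro j N hj
    simp only [show n - 2 * (j + 1) = N by omega, show n - 2 * j = N + 2 by omega]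
    rw [hV j (by omega), ← invFact_succ j]
    linear_combination 8 * V (j + 1) * expCoeff N * invFact (j + 1) * hw j -
      2 * w j * ((nu - M - 2 - j) * V (j + 1) * (j + 1) * invFact (j + 1)) * expCoeff_add_two N
  · intro j N hj
    simp only [show n - 1 - 2 * (j + 1) = N by omega, show n - 1 - 2 * j = N + 2 by omega,
      show n - 2 - 2 * j = N + 1 by omega]
    have h1 := hV (j + 1) (by omega)
    have h2 := hv j
    have h3 := hv (j + 1)
    rw [h1, h2, h3, ← invFact_succ j]
    push_cast
    linear_combination -((M + 2) * (2 - nu) + 2 * j) * ((nu - M - 3 - j) * V (j + 1 + 1) * (j + 1)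
      * invFact (j + 1)) * expCoeff_add_two N
      - 4 * (nu - M - 3 - j) * V (j + 2) * (j + 1) * invFact (j + 1) * expCoeff_succ N
  · intro j N hj
    simp only [show n - 2 - 2 * (j + 1) = N by omega, show n - 2 - 2 * j = N + 2 by omega]
    have h1 := hV (j + 1) (by omega)
    rw [h1, ← invFact_succ j]
    push_cast
    linear_combination 2 * ((nu - M - 3 - j) * V (j + 2) * (j + 1) * invFact (j + 1)) *
      expCoeff_add_two N
  · intro j N hj
    simp only [show n - 2 * (j + 1) = N by omega, show n - 1 - 2 * j = N + 1 by omega]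
    rw [← invFact_succ j]
    linear_combination v j * V (j + 1) * (j + 1) * invFact (j + 1) * expCoeff_succ N
      + 2 * V (j + 1) * invFact (j + 1) * expCoeff N * hvw j
  · intro N hN
    simp only [show n - 1 - 2 * 0 = N by omega, show n - 2 * 0 = N + 1 by omega]
    rw [hV 0 (by omega)]
    push_cast
    linear_combination 2 * V 1 * invFact 0 * expCoeff N * hvw₀
      - 2 * w 0 * (nu - M - 2) * V 1 * invFact 0 * expCoeff_succ N
  · intro j N hj
    simp only [show n - 1 - 2 * (j + 1) = N by omega, show n - 2 * (j + 1) = N + 1 by omega,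
      show n - 2 - 2 * j = N + 1 by omega]
    have h1 := hV (j + 1) (by omega)
    rw [h1, ← invFact_succ j]
    push_cast
    linear_combination 2 * V (j + 2) * invFact (j + 1) * expCoeff N * hvw₁ j
      - 2 * (w (j + 1) - (j + 1)) * (nu - M - 3 - j) * V (j + 2) * invFact (j + 1) * expCoeff_succ N
  · intro j N hj
    simp only [show n - 2 - 2 * j = N by omega, show n - 1 - 2 * j = N + 1 by omega]
    rw [hv j]
    linear_combination -((M + 2) * (2 - nu) + 2 * j) * V (j + 1) * invFact j * expCoeff_succ N

/-- The weights of the first component for `ν = 0, 1, 2`. -/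
def weight (M : ℕ) : ℕ → ℕ → ℂ
  | 0, j => M + 1 + j
  | 1, j => j
  | _, j => j * (j - 1) / (M + j)

/-- The solutions for `m > 1` and `ν = k`, in terms of a sequence `V` of rising factorials. -/
theorem fRec_general {M n k : ℕ} (hM : 1 ≤ M) (hk : k ≤ 2) {V : ℕ → ℂ}
    (hV : ∀ j, 1 + 2 * j ≤ n → V j = ((k : ℂ) - M - 2 - j) * V (j + 1)) :
    FRec M n k (fun j => 2 * weight M k j * V j * expCoeff (n - 2 * j) * invFact j)
      (fun j => ((M + 2) * (2 - k) + 2 * j) * V (j + 1) * expCoeff (n - 1 - 2 * j) * invFact j)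
      (fun j => -2 * V (j + 1) * expCoeff (n - 2 - 2 * j) * invFact j) := by
  have ne (j : ℕ) : (M : ℂ) + (j + 1) ≠ 0 := by exact_mod_cast (by omega : M + (j + 1) ≠ 0)
  have ne' (j : ℕ) : (M : ℂ) + j ≠ 0 := by exact_mod_cast (by omega : M + j ≠ 0)
  refine fRec_of_weights hV (v := fun j => (M + 2) * (2 - k) + 2 * j) (fun j => rfl) ?_ ?_ ?_ ?_ ?_
  · interval_cases k <;> simp [weight]
  · intro j
    interval_cases k
    · simp only [weight]
      push_cast
      ring
    · simp only [weight]
      push_cast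
      ring
    · have h1 := ne j
      have h2 := ne' j
      simp only [weight]
      push_cast
      field_simp
      ring
  · intro j
    interval_cases k
    · simp only [weight]
      push_cast
      ring
    · simp only [weight]
      push_cast
      ring
    · have h1 := ne j
      simp only [weight]
      push_cast
      field_simp
      ring
  · interval_cases k <;> simp [weight]
    ring
  · intro j
    interval_cases k
    · simp only [weight]
      push_cast
      ring
    · simp only [weight]
      push_cast
      ring
    · have h1 := ne j
      simp only [weight]
      push_cast
      field_simp
      ring

/-! ### Coefficients of the Gegenbauer polynomials -/

/-- The rising factorial `x (x + 1) ⋯ (x + d - 1)`. -/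
def poch (d : ℕ) (x : ℂ) : ℂ := (ascPochhammer ℂ d).eval x

theorem poch_zero (x : ℂ) : poch 0 x = 1 := by simp [poch]

theorem poch_succ (d : ℕ) (x : ℂ) : poch (d + 1) x = (x + d) * poch d x := by
  rw [poch, ascPochhammer_succ_eval, poch, mul_comm]

theorem poch_succ' (d : ℕ) (x : ℂ) : poch (d + 1) x = x * poch d (x + 1) := by
  simp [poch, ascPochhammer_succ_left, Polynomial.eval_comp]

theorem gegenbauerI_of_neg (mu : ℂ) {l : ℤ} (hl : l < 0) : gegenbauerI mu l = 0 := by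
  simp [gegenbauerI, gegenbauer, hl]

open Polynomial in
theorem gegenbauerI_natCast (mu : ℂ) (l : ℕ) : gegenbauerI mu l =
    ∑ k ∈ Finset.range (l / 2 + 1), C ((-1) ^ k * (poch (l / 2 - k) (mu + ((l + 1) / 2 : ℕ))
      / ((k.factorial : ℂ) * ((l - 2 * k).factorial : ℂ))) * (2 * Complex.I) ^ (l - 2 * k))
      * X ^ (l - 2 * k) := by
  rw [gegenbauerI, gegenbauer, if_neg (by omega), Int.toNat_natCast, ← coe_compRingHom_apply,
    map_sum]
  refine Finset.sum_congr rfl fun k _ => ?_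
  simp only [coe_compRingHom_apply, mul_comp, C_comp, pow_comp, X_comp, ofNat_comp]
  have h2 : ((2 : ℕ) : ℂ[X]) = C 2 := by
    rw [Nat.cast_ofNat]
    exact (map_ofNat C 2).symm
  rw [h2, ← mul_assoc, ← C_mul, mul_pow, ← C_pow, ← mul_assoc, ← C_mul, poch, mul_div_assoc]

theorem gegenbauerI_coeff (mu : ℂ) {l k e : ℕ} (h : 2 * k + e = l) :
    (gegenbauerI mu l).coeff e = Complex.I ^ l * poch (l / 2 - k) (mu + ((l + 1) / 2 : ℕ))
      * expCoeff e * invFact k := by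
  rw [gegenbauerI_natCast, Polynomial.finsetSum_coeff, Finset.sum_eq_single k]
  · rw [Polynomial.coeff_C_mul, Polynomial.coeff_X_pow, if_pos (by omega),
      show l - 2 * k = e by omega, expCoeff, invFact, ← h, pow_add, pow_mul, Complex.I_sq, mul_pow]
    field_simp
  · intro i hi hne
    rw [Finset.mem_range] at hi
    rw [Polynomial.coeff_C_mul, Polynomial.coeff_X_pow, if_neg (by omega), mul_zero]
  · intro hk
    rw [Finset.mem_range] at hk
    omega

theorem gegenbauerI_coeff_eq_zero (mu : ℂ) {l e : ℕ} (h : l < e) :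
    (gegenbauerI mu l).coeff e = 0 := by
  rw [gegenbauerI_natCast, Polynomial.finsetSum_coeff]
  refine Finset.sum_eq_zero fun k _ => ?_
  rw [Polynomial.coeff_C_mul, Polynomial.coeff_X_pow, if_neg (by omega), mul_zero]

theorem leadCoeff_smul (n : ℕ) (s : ℂ) (c₀ c₁ c₂ : ℕ → ℂ) :
    FRec.leadCoeff n (fun j => s * c₀ j) (fun j => s * c₁ j) (fun j => s * c₂ j)
      = s * FRec.leadCoeff n c₀ c₁ c₂ := by
  simp only [FRec.leadCoeff]
  split_ifs <;> rfl

theorem leadCoeff_congr {n : ℕ} {c₀ c₁ c₂ d₀ d₁ d₂ : ℕ → ℂ}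
    (h₀ : ∀ j, 2 * j ≤ n → d₀ j = c₀ j) (h₁ : ∀ j, 1 + 2 * j ≤ n → d₁ j = c₁ j)
    (h₂ : ∀ j, 2 + 2 * j ≤ n → d₂ j = c₂ j) :
    FRec.leadCoeff n d₀ d₁ d₂ = FRec.leadCoeff n c₀ c₁ c₂ := by
  simp only [FRec.leadCoeff]
  split_ifs
  · exact h₀ 0 (by omega)
  · exact h₁ 0 (by omega)
  · exact h₂ _ (by omega)

/-- The coefficients of the three polynomials `g r` that enter the map `psiOf`; the exponent of `t`
is `n - r - 2 * j`. -/
def tripleCoeff (n : ℕ) (g : Fin 3 → Polynomial ℂ) (r : Fin 3) (j : ℕ) : ℂ :=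
  (g r).coeff (n - r - 2 * j)

theorem I_pow_add_two (n : ℕ) : Complex.I ^ (n + 2) = -Complex.I ^ n := by
  rw [pow_add, Complex.I_sq]
  ring

/-- The rising factorials that play the role of the sequence `V` of `fRec_one`. -/
def seqOne (lam : ℂ) (n j : ℕ) : ℂ := poch (n / 2 + 1 - j) (lam + ((n - 1) / 2 : ℕ))

/-- The triple for `m = 1` is `-i ^ n` times the solution of `fRec_one`. -/
theorem tripleOne_coeff (lam : ℂ) {n : ℕ} (hn : 0 < n) :
    (∀ j, 2 * j ≤ n → tripleCoeff n (tripleOne lam n) 0 j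
      = -Complex.I ^ n * (seqOne lam n j * expCoeff (n - 2 * j) * invFact j)) ∧
    (∀ j, 1 + 2 * j ≤ n → tripleCoeff n (tripleOne lam n) 1 j
      = -Complex.I ^ n * (seqOne lam n (j + 1) * expCoeff (n - 1 - 2 * j) * invFact j)) ∧
    (∀ j, 2 + 2 * j ≤ n → tripleCoeff n (tripleOne lam n) 2 j
      = -Complex.I ^ n * (seqOne lam n (j + 2) * expCoeff (n - 2 - 2 * j) * invFact j)) := by
  refine ⟨fun j hj => ?_, fun j hj => ?_, fun j hj => ?_⟩
  · have h1 : tripleCoeff n (tripleOne lam n) 0 j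
        = -((lam + ((n - 1) / 2 : ℕ)) * (gegenbauerI lam n).coeff (n - 2 * j)) := by
      simp [tripleCoeff, tripleOne, ← Polynomial.C_eq_natCast, ← Polynomial.C_add,
        -map_add]
    rw [h1, gegenbauerI_coeff lam (show 2 * j + (n - 2 * j) = n by omega), seqOne,
      show n / 2 + 1 - j = n / 2 - j + 1 by omega, poch_succ',
      show (n + 1) / 2 = (n - 1) / 2 + 1 by omega]
    push_cast
    rw [← add_assoc]
    ring
  · have h1 : tripleCoeff n (tripleOne lam n) 1 j = -(Complex.I * gammaConst (lam - 1) n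
        * (gegenbauerI lam (n - 1 : ℕ)).coeff (n - 1 - 2 * j)) := by
      rw [Nat.cast_sub hn]
      simp only [tripleCoeff, tripleOne]
      simp [-map_mul]
    have h2 : gammaConst (lam - 1) n * poch ((n - 1) / 2 - j) (lam + ((n - 1 + 1) / 2 : ℕ))
        = seqOne lam n (j + 1) := by
      rw [seqOne, gammaConst]
      obtain ⟨p, rfl | rfl⟩ := Nat.even_or_odd' n
      · obtain ⟨d, rfl⟩ : ∃ d, p = j + d + 1 := ⟨p - j - 1, by omega⟩
        rw [if_neg (by simp), show (2 * (j + d + 1) - 1) / 2 - j = d by omega,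
          show (2 * (j + d + 1) - 1 + 1) / 2 = j + d + 1 by omega,
          show 2 * (j + d + 1) / 2 + 1 - (j + 1) = d + 1 by omega,
          show (2 * (j + d + 1) - 1) / 2 = j + d by omega, poch_succ']
        push_cast
        ring_nf
      · rw [if_pos (by simp), one_mul]
        rw [show (2 * p + 1 - 1) / 2 = p by omega, show (2 * p + 1 - 1 + 1) / 2 = p by omega,
          show (2 * p + 1) / 2 = p by omega, show p + 1 - (j + 1) = p - j by omega]
    rw [h1, gegenbauerI_coeff lam (show 2 * j + (n - 1 - 2 * j) = n - 1 by omega), ← h2]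
    obtain ⟨n, rfl⟩ : ∃ i, n = i + 1 := ⟨n - 1, by omega⟩
    simp only [Nat.add_sub_cancel, pow_succ]
    ring
  · have h1 : tripleCoeff n (tripleOne lam n) 2 j
        = (gegenbauerI lam (n - 2 : ℕ)).coeff (n - 2 - 2 * j) := by
      rw [Nat.cast_sub (by omega)]
      simp [tripleCoeff, tripleOne]
    rw [h1, gegenbauerI_coeff lam (show 2 * j + (n - 2 - 2 * j) = n - 2 by omega), seqOne]
    obtain ⟨n, rfl⟩ : ∃ i, n = i + 2 := ⟨n - 2, by omega⟩
    rw [I_pow_add_two, show (n + 2) / 2 + 1 - (j + 2) = n / 2 - j by omega]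
    simp only [Nat.add_sub_cancel, show n + 2 - 1 = n + 1 by omega]
    ring

theorem fRec_tripleOne (lam : ℂ) {n : ℕ} (hn : 0 < n) :
    FRec 0 n (lam + n) (tripleCoeff n (tripleOne lam n) 0) (tripleCoeff n (tripleOne lam n) 1)
      (tripleCoeff n (tripleOne lam n) 2) ∧
    FRec.leadCoeff n (tripleCoeff n (tripleOne lam n) 0) (tripleCoeff n (tripleOne lam n) 1)
      (tripleCoeff n (tripleOne lam n) 2) ≠ 0 := by
  obtain ⟨h₀, h₁, h₂⟩ := tripleOne_coeff lam hn
  refine ⟨((fRec_one ?_).smul _).congr h₀ h₁ h₂, ?_⟩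
  · intro j hj
    have e : n = (n - 1) / 2 + n / 2 + 1 := by omega
    have e' : (n : ℂ) = ((n - 1) / 2 : ℕ) + (n / 2 : ℕ) + 1 := by exact_mod_cast e
    rw [seqOne, seqOne, show n / 2 + 1 - j = n / 2 - j + 1 by omega, poch_succ,
      show n / 2 + 1 - (j + 1) = n / 2 - j by omega, e', Nat.cast_sub (by omega)]
    ring
  · rw [leadCoeff_congr h₀ h₁ h₂, leadCoeff_smul, FRec.leadCoeff, if_neg (by omega)]
    refine mul_ne_zero (neg_ne_zero.mpr (pow_ne_zero _ Complex.I_ne_zero)) ?_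
    split_ifs with hn1
    · rw [seqOne, show n / 2 + 1 - (0 + 1) = 0 by omega, poch_zero, one_mul]
      exact mul_ne_zero (expCoeff_ne_zero _) (invFact_ne_zero _)
    · rw [seqOne, show n / 2 + 1 - ((n - 2) / 2 + 2) = 0 by omega, poch_zero, one_mul]
      exact mul_ne_zero (expCoeff_ne_zero _) (invFact_ne_zero _)

/-! ### The explicit solutions for `m > 1` -/

/-- The rising factorials that play the role of the sequence `V` of `fRec_general`; with
`p = [(n - 1) / 2]` their argument is `ν - M - 2 - p`, where `ν = k`. -/
def seqGeneral (M n k j : ℕ) : ℂ :=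
  poch ((n - 1) / 2 + 1 - j) ((k : ℂ) - M - 2 - ((n - 1) / 2 : ℕ))

theorem seqGeneral_succ {M n k j : ℕ} (hj : 1 + 2 * j ≤ n) :
    seqGeneral M n k j = ((k : ℂ) - M - 2 - j) * seqGeneral M n k (j + 1) := by
  rw [seqGeneral, seqGeneral, show (n - 1) / 2 + 1 - j = (n - 1) / 2 - j + 1 by omega, poch_succ,
    show (n - 1) / 2 + 1 - (j + 1) = (n - 1) / 2 - j by omega, Nat.cast_sub (by omega)]
  ring

theorem eq_add_one_or_add_two {n : ℕ} (hn : 1 ≤ n) : ∃ p, n = 2 * p + 1 ∨ n = 2 * p + 2 :=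
  ⟨(n - 1) / 2, by omega⟩

/-- The second and the third component contain the same rising factorials. -/
theorem gammaConst_mul_poch {M n k j : ℕ} (hj : 2 + 2 * j ≤ n) :
    gammaConst ((k : ℂ) - M - n - 1) (n - 1)
      * poch ((n - 2) / 2 - j) ((k : ℂ) - M - n + ((n - 1) / 2 : ℕ)) = seqGeneral M n k (j + 1) := by
  rw [seqGeneral, gammaConst]
  obtain ⟨p, rfl | rfl⟩ := eq_add_one_or_add_two (show 1 ≤ n by omega)
  · obtain ⟨d, rfl⟩ : ∃ d, p = j + d + 1 := ⟨p - j - 1, by omega⟩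
    rw [if_neg (by simp), show (2 * (j + d + 1) + 1 - 2) / 2 - j = d by omega,
      show (2 * (j + d + 1) + 1 - 1) / 2 = j + d + 1 by omega,
      show j + d + 1 + 1 - (j + 1) = d + 1 by omega, poch_succ',
      show 2 * (j + d + 1) + 1 - 1 = 2 * (j + d + 1) by omega]
    push_cast
    ring_nf
  · rw [if_pos (by rw [show 2 * p + 2 - 1 = 2 * p + 1 by omega]; simp), one_mul,
      show (2 * p + 2 - 2) / 2 - j = p - j by omega, show (2 * p + 2 - 1) / 2 = p by omega,
      show p + 1 - (j + 1) = p - j by omega]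
    congr 1
    push_cast
    ring

/-- The rising factorials of `C̃^{λ-1}_{n-1}`, in the first summand of the second component. -/
theorem gegenbauer_pred_poch {M n k j : ℕ} (hj : 1 + 2 * j ≤ n) :
    poch ((n - 1) / 2 - j) ((k : ℂ) - M - n - 1 + ((n - 1 + 1) / 2 : ℕ))
      = seqGeneral M n k (j + 1) := by
  rw [seqGeneral]
  obtain ⟨p, rfl | rfl⟩ := eq_add_one_or_add_two (show 1 ≤ n by omega)
  · rw [show (2 * p + 1 - 1) / 2 = p by omega, show (2 * p + 1 - 1 + 1) / 2 = p by omega,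
      show p + 1 - (j + 1) = p - j by omega]
    congr 1
    push_cast
    ring
  · rw [show (2 * p + 2 - 1) / 2 = p by omega, show (2 * p + 2 - 1 + 1) / 2 = p + 1 by omega,
      show p + 1 - (j + 1) = p - j by omega]
    congr 1
    push_cast
    ring

/-- The constant `λ + [(-λ - m) / 2]` for `λ = k - M - n` and `m = M + 1`. -/
def floorConst (M n k : ℕ) : ℤ :=
  (k : ℤ) - M - n + (-((k : ℤ) - M - n) - (M + 1 : ℕ)) / 2

/-- The first component for `ν = k`, for indices `j` where the Gegenbauer polynomial contributes. -/
theorem first_component_poch {M n k j : ℕ} (hM : 1 ≤ M) (hn : 1 ≤ n) (hk : k ≤ 2) (hkj : k ≤ j)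
    (hj : 2 * j ≤ n) :
    (-1 : ℂ) ^ ((k : ℤ) + 1) * Complex.I *
      ((-1) ^ (k : ℤ) * (floorConst M n k : ℂ) ^ (1 - (k : ℤ))) *
      (-2 * gammaConst ((k : ℂ) - M - n - 1) (n - 1)) *
      (Complex.I ^ (n - 2 * k) * poch ((n - 2 * k) / 2 - (j - k))
        ((k : ℂ) - M - n + ((n - 2 * k + 1) / 2 : ℕ)) * invFact (j - k))
      = Complex.I ^ (n - 1) * (2 * weight M k j * seqGeneral M n k j * invFact j) := by
  obtain ⟨p, hp⟩ := eq_add_one_or_add_two hn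
  have hp1 : (n - 1) / 2 = p := by omega
  have hγ : gammaConst ((k : ℂ) - M - n - 1) (n - 1)
      = if n = 2 * p + 1 then (k : ℂ) - M - n - 1 + p else 1 := by
    rw [gammaConst]
    rcases hp with rfl | rfl
    · rw [if_neg (by simp), if_pos rfl, show 2 * p + 1 - 1 = 2 * p by omega]
      push_cast
      ring
    · rw [if_pos (by rw [show 2 * p + 2 - 1 = 2 * p + 1 by omega]; simp), if_neg (by omega)]
  obtain ⟨d, hd⟩ : ∃ d, p + 1 = j + d := ⟨p + 1 - j, by omega⟩
  have hdp : p + 1 - j = d := by omega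
  have hp' : (p : ℂ) = j + d - 1 := by
    have : (p : ℂ) + 1 = j + d := by exact_mod_cast hd
    linear_combination this
  rw [hγ, seqGeneral, hp1, hdp]
  clear hγ hp1 hdp
  interval_cases k
  · have hA : (floorConst M n 0 : ℂ) = -M - n + p := by
      have : floorConst M n 0 = -M - n + p := by rw [floorConst]; omega
      rw [this]
      push_cast
      ring
    have hI : Complex.I * Complex.I ^ (n - 2 * 0) = -Complex.I ^ (n - 1) := by
      rw [← pow_succ', ← I_pow_add_two]
      congr 1
      omega
    have key : -((if n = 2 * p + 1 then ((0 : ℕ) : ℂ) - M - n - 1 + p else 1) * (-M - n + p) *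
        poch ((n - 2 * 0) / 2 - (j - 0)) (((0 : ℕ) : ℂ) - M - n + ((n - 2 * 0 + 1) / 2 : ℕ)))
        = (M + 1 + j) * poch d (((0 : ℕ) : ℂ) - M - 2 - p) := by
      rcases hp with rfl | rfl
      · obtain ⟨e, rfl⟩ : ∃ e, d = e + 1 := ⟨d - 1, by omega⟩
        have h1 := poch_succ (e + 1) (((0 : ℕ) : ℂ) - M - 2 - p)
        rw [poch_succ', poch_succ' e] at h1
        rw [if_pos rfl, show (2 * p + 1 - 2 * 0) / 2 - (j - 0) = e by omega,
          show (2 * p + 1 - 2 * 0 + 1) / 2 = p + 1 by omega,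
          show ((0 : ℕ) : ℂ) - M - (2 * p + 1 : ℕ) + (p + 1 : ℕ)
            = ((0 : ℕ) : ℂ) - M - 2 - p + 1 + 1 by push_cast; ring]
        push_cast at h1 hp' ⊢
        linear_combination -h1 + poch (e + 1) (0 - M - 2 - p) * hp'
      · have h1 := poch_succ d (((0 : ℕ) : ℂ) - M - 2 - p)
        rw [poch_succ'] at h1
        rw [if_neg (by omega), show (2 * p + 2 - 2 * 0) / 2 - (j - 0) = d by omega,
          show (2 * p + 2 - 2 * 0 + 1) / 2 = p + 1 by omega,
          show ((0 : ℕ) : ℂ) - M - (2 * p + 2 : ℕ) + (p + 1 : ℕ)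
            = ((0 : ℕ) : ℂ) - M - 2 - p + 1 by push_cast; ring]
        push_cast at h1 hp' ⊢
        linear_combination -h1 + poch d (0 - M - 2 - p) * hp'
    rw [hA, weight]
    generalize poch (_ / _ - _) _ = P at key ⊢
    generalize (if n = 2 * p + 1 then _ else _ : ℂ) = G at key ⊢
    generalize poch _ _ = Q at key ⊢
    norm_num at hI ⊢
    linear_combination (2 * G * (-M - n + p) * P * invFact j) * hI
      + 2 * Complex.I ^ (n - 1) * invFact j * key
  · have hI : Complex.I * Complex.I ^ (n - 2 * 1) = Complex.I ^ (n - 1) := by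
      rw [← pow_succ']
      congr 1
      omega
    have key : (if n = 2 * p + 1 then ((1 : ℕ) : ℂ) - M - n - 1 + p else 1) *
        poch ((n - 2 * 1) / 2 - (j - 1)) (((1 : ℕ) : ℂ) - M - n + ((n - 2 * 1 + 1) / 2 : ℕ))
        = poch d (((1 : ℕ) : ℂ) - M - 2 - p) := by
      rcases hp with rfl | rfl
      · obtain ⟨e, rfl⟩ : ∃ e, d = e + 1 := ⟨d - 1, by omega⟩
        rw [if_pos rfl, show (2 * p + 1 - 2 * 1) / 2 - (j - 1) = e by omega,
          show (2 * p + 1 - 2 * 1 + 1) / 2 = p by omega,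
          show ((1 : ℕ) : ℂ) - M - (2 * p + 1 : ℕ) + p
            = ((1 : ℕ) : ℂ) - M - 2 - p + 1 by push_cast; ring, poch_succ' e]
        push_cast
        ring
      · rw [if_neg (by omega), show (2 * p + 2 - 2 * 1) / 2 - (j - 1) = d by omega,
          show (2 * p + 2 - 2 * 1 + 1) / 2 = p by omega,
          show ((1 : ℕ) : ℂ) - M - (2 * p + 2 : ℕ) + p
            = ((1 : ℕ) : ℂ) - M - 2 - p by push_cast; ring, one_mul]
    have hf : invFact (j - 1) = j * invFact j := by
      obtain ⟨i, rfl⟩ : ∃ i, j = i + 1 := ⟨j - 1, by omega⟩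
      rw [Nat.add_sub_cancel, ← invFact_succ]
      push_cast
      ring
    rw [weight, ← key, hf]
    generalize poch _ _ = P
    generalize (if n = 2 * p + 1 then _ else _ : ℂ) = G
    norm_num
    linear_combination (2 * G * P * j * invFact j) * hI
  · have hA : (floorConst M n 2 : ℂ) = 1 - M - n + p := by
      have : floorConst M n 2 = 1 - M - n + p := by rw [floorConst]; omega
      rw [this]
      push_cast
      ring
    have hA0 : (1 - M - n + p : ℂ) ≠ 0 := by
      have : (1 - M - n + p : ℂ) = ((1 - M - n + p : ℤ) : ℂ) := by push_cast; rfl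
      rw [this]
      exact_mod_cast (by omega : (1 - M - n + p : ℤ) ≠ 0)
    have hMj : (M + j : ℂ) ≠ 0 := by exact_mod_cast (by omega : M + j ≠ 0)
    have hI : Complex.I * Complex.I ^ (n - 2 * 2) = -Complex.I ^ (n - 1) := by
      rw [← pow_succ', ← I_pow_add_two, show n - 1 = n - 2 * 2 + 1 + 2 by omega, I_pow_add_two,
        I_pow_add_two, neg_neg]
    have key : -(M + j : ℂ) * (if n = 2 * p + 1 then ((2 : ℕ) : ℂ) - M - n - 1 + p else 1) *
        poch ((n - 2 * 2) / 2 - (j - 2)) (((2 : ℕ) : ℂ) - M - n + ((n - 2 * 2 + 1) / 2 : ℕ))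
        = (1 - M - n + p) * poch d (((2 : ℕ) : ℂ) - M - 2 - p) := by
      rcases hp with rfl | rfl
      · obtain ⟨e, rfl⟩ : ∃ e, d = e + 1 := ⟨d - 1, by omega⟩
        obtain ⟨q, rfl⟩ : ∃ q, p = q + 1 := ⟨p - 1, by omega⟩
        rw [if_pos rfl, show (2 * (q + 1) + 1 - 2 * 2) / 2 - (j - 2) = e by omega,
          show (2 * (q + 1) + 1 - 2 * 2 + 1) / 2 = q by omega,
          show ((2 : ℕ) : ℂ) - M - (2 * (q + 1) + 1 : ℕ) + q
            = ((2 : ℕ) : ℂ) - M - 2 - (q + 1 : ℕ) by push_cast; ring, poch_succ e]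
        push_cast at hp' ⊢
        linear_combination (M + q + 1 : ℂ) * poch e (2 - M - 2 - (q + 1)) * -hp'
      · obtain ⟨q, rfl⟩ : ∃ q, p = q + 1 := ⟨p - 1, by omega⟩
        have h1 := poch_succ d (((2 : ℕ) : ℂ) - M - 2 - (q + 1 : ℕ) - 1)
        rw [poch_succ', sub_add_cancel] at h1
        rw [if_neg (by omega), show (2 * (q + 1) + 2 - 2 * 2) / 2 - (j - 2) = d by omega,
          show (2 * (q + 1) + 2 - 2 * 2 + 1) / 2 = q by omega,
          show ((2 : ℕ) : ℂ) - M - (2 * (q + 1) + 2 : ℕ) + q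
            = ((2 : ℕ) : ℂ) - M - 2 - (q + 1 : ℕ) - 1 by push_cast; ring]
        push_cast at h1 hp' ⊢
        linear_combination -h1 + poch d (2 - M - 2 - (q + 1) - 1) * hp'
    have hf : invFact (j - 2) = j * (j - 1) * invFact j := by
      obtain ⟨i, rfl⟩ : ∃ i, j = i + 2 := ⟨j - 2, by omega⟩
      rw [Nat.add_sub_cancel, ← invFact_succ, ← invFact_succ (i + 1)]
      push_cast
      ring
    have hw : weight M 2 j = j * (j - 1) / (M + j) := rfl
    rw [hA, hw, hf]
    generalize poch (_ / _ - _) _ = P at key ⊢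
    generalize (if n = 2 * p + 1 then _ else _ : ℂ) = G at key ⊢
    generalize poch _ _ = Q at key ⊢
    have hz : (1 : ℤ) - ((2 : ℕ) : ℤ) = -1 := by norm_num
    rw [hz, zpow_neg_one]
    norm_num
    field_simp
    linear_combination (G * P * j * (j - 1) * invFact j * (M + j)) * hI
      + Complex.I ^ (n - 1) * j * (j - 1) * invFact j * key

/-- The triple for `m > 1` is `i ^ (n - 1)` times the solution of `fRec_general`. -/
theorem tripleGeneral_coeff {M n k : ℕ} (hM : 1 ≤ M) (hn : 1 ≤ n) (hk : k ≤ 2) :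
    (∀ j, 2 * j ≤ n → tripleCoeff n (tripleGeneral ((k : ℤ) - M - n) k (M + 1) (M + n)) 0 j
      = Complex.I ^ (n - 1) *
        (2 * weight M k j * seqGeneral M n k j * expCoeff (n - 2 * j) * invFact j)) ∧
    (∀ j, 1 + 2 * j ≤ n → tripleCoeff n (tripleGeneral ((k : ℤ) - M - n) k (M + 1) (M + n)) 1 j
      = Complex.I ^ (n - 1) * (((M + 2) * (2 - k) + 2 * j) * seqGeneral M n k (j + 1)
        * expCoeff (n - 1 - 2 * j) * invFact j)) ∧
    (∀ j, 2 + 2 * j ≤ n → tripleCoeff n (tripleGeneral ((k : ℤ) - M - n) k (M + 1) (M + n)) 2 j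
      = Complex.I ^ (n - 1) *
        (-2 * seqGeneral M n k (j + 1) * expCoeff (n - 2 - 2 * j) * invFact j)) := by
  have hB : constB ((k : ℤ) - M - n) (M + 1) (M + n)
      = -2 * gammaConst ((k : ℂ) - M - n - 1) (n - 1) := by
    rw [constB, show M + n - (M + 1) = n - 1 by omega]
    push_cast
    rfl
  have hl : (((k : ℤ) - M - n : ℤ) : ℂ) = (k : ℂ) - M - n := by push_cast; rfl
  have hlow (j : ℕ) (hj : 2 + 2 * j ≤ n) :
      Complex.I * constB ((k : ℤ) - M - n) (M + 1) (M + n) *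
        (gegenbauerI ((k : ℂ) - M - n) (n - 2 : ℕ)).coeff (n - 2 - 2 * j)
      = Complex.I ^ (n - 1) *
        (-2 * seqGeneral M n k (j + 1) * expCoeff (n - 2 - 2 * j) * invFact j) := by
    rw [gegenbauerI_coeff _ (show 2 * j + (n - 2 - 2 * j) = n - 2 by omega), hB,
      ← gammaConst_mul_poch hj, show n - 2 + 1 = n - 1 by omega,
      show Complex.I ^ (n - 1) = Complex.I * Complex.I ^ (n - 2) by
        rw [← pow_succ', show n - 2 + 1 = n - 1 by omega]]
    ring
  have hcast : ((M + n : ℕ) : ℤ) - ((M + 1 : ℕ) : ℤ) = ((n - 1 : ℕ) : ℤ) := by omega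
  refine ⟨fun j hj => ?_, fun j hj => ?_, fun j hj => ?_⟩
  · have h1 : tripleCoeff n (tripleGeneral ((k : ℤ) - M - n) k (M + 1) (M + n)) 0 j
        = (-1 : ℂ) ^ ((k : ℤ) + 1) * Complex.I * constA ((k : ℤ) - M - n) k (M + 1) *
          constB ((k : ℤ) - M - n) (M + 1) (M + n) *
          (gegenbauerI ((k : ℂ) - M - n) ((n : ℤ) - 2 * k)).coeff (n - 2 * j) := by
      simp only [tripleCoeff, tripleGeneral, Matrix.cons_val_zero, Polynomial.coeff_C_mul, hl]
      congr 3
      push_cast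
      ring
    have hA : constA ((k : ℤ) - M - n) k (M + 1)
        = (-1) ^ (k : ℤ) * (floorConst M n k : ℂ) ^ (1 - (k : ℤ)) := rfl
    have hw : j < k → weight M k j = 0 := by
      intro hjk
      interval_cases k
      · omega
      · obtain rfl : j = 0 := by omega
        simp [weight]
      · obtain rfl | rfl : j = 0 ∨ j = 1 := by omega
        all_goals simp [weight]
    rw [h1]
    by_cases hkj : k ≤ j
    · rw [show (n : ℤ) - 2 * k = ((n - 2 * k : ℕ) : ℤ) by omega, gegenbauerI_coeff _
        (show 2 * (j - k) + (n - 2 * j) = n - 2 * k by omega), hA, hB]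
      linear_combination expCoeff (n - 2 * j) * first_component_poch hM hn hk hkj hj
    · rw [hw (by omega)]
      have hz : (gegenbauerI ((k : ℂ) - M - n) ((n : ℤ) - 2 * k)).coeff (n - 2 * j) = 0 := by
        by_cases hneg : (n : ℤ) - 2 * k < 0
        · rw [gegenbauerI_of_neg _ hneg, Polynomial.coeff_zero]
        · rw [show (n : ℤ) - 2 * k = ((n - 2 * k : ℕ) : ℤ) by omega]
          exact gegenbauerI_coeff_eq_zero _ (by omega)
      rw [hz]
      ring
  · have h1 : tripleCoeff n (tripleGeneral ((k : ℤ) - M - n) k (M + 1) (M + n)) 1 j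
        = -(constC ((k : ℤ) - M - n) k (M + 1) *
            (gegenbauerI ((k : ℂ) - M - n - 1) (n - 1 : ℕ)).coeff (n - 1 - 2 * j))
          + Complex.I * constB ((k : ℤ) - M - n) (M + 1) (M + n) * (Polynomial.X *
            gegenbauerI ((k : ℂ) - M - n) ((n - 1 : ℕ) - 1 : ℤ)).coeff (n - 1 - 2 * j) := by
      simp only [tripleCoeff, tripleGeneral, hl, hcast, Matrix.cons_val_one, Matrix.cons_val_zero,
        mul_assoc, Polynomial.coeff_add, Polynomial.coeff_neg, Polynomial.coeff_C_mul]
      rfl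
    rw [h1, gegenbauerI_coeff _ (show 2 * j + (n - 1 - 2 * j) = n - 1 by omega),
      gegenbauer_pred_poch hj]
    have hC : constC ((k : ℤ) - M - n) k (M + 1)
        = -((M + 2) * (2 - k) + 2 * j) - ((n : ℂ) - 1 - 2 * j) := by
      rw [constC]
      push_cast
      ring
    rw [hC]
    obtain ⟨N, hN⟩ : ∃ N, n = 1 + 2 * j + N := ⟨n - 1 - 2 * j, by omega⟩
    rw [show n - 1 - 2 * j = N by omega]
    cases N with
    | zero =>
      rw [Polynomial.coeff_X_mul_zero]
      have : (n : ℂ) = 1 + 2 * j := by rw [hN]; push_cast; ring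
      rw [this]
      ring
    | succ N =>
      have h2 := hlow j (by omega)
      rw [show n - 2 - 2 * j = N by omega] at h2
      rw [Polynomial.coeff_X_mul, show ((n - 1 : ℕ) - 1 : ℤ) = ((n - 2 : ℕ) : ℤ) by omega, h2]
      have : (n : ℂ) = 1 + 2 * j + (N + 1) := by rw [hN]; push_cast; ring
      rw [this]
      linear_combination Complex.I ^ (n - 1) * seqGeneral M n k (j + 1) * invFact j *
        expCoeff_succ N
  · have h1 : tripleCoeff n (tripleGeneral ((k : ℤ) - M - n) k (M + 1) (M + n)) 2 j
        = Complex.I * constB ((k : ℤ) - M - n) (M + 1) (M + n) *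
          (gegenbauerI ((k : ℂ) - M - n) (n - 2 : ℕ)).coeff (n - 2 - 2 * j) := by
      simp only [tripleCoeff, tripleGeneral, hl, hcast,
        show ((n - 1 : ℕ) - 1 : ℤ) = ((n - 2 : ℕ) : ℤ) by omega]
      exact Polynomial.coeff_C_mul _
    rw [h1, hlow j hj]

theorem fRec_tripleGeneral {M n k : ℕ} (hM : 1 ≤ M) (hn : 1 ≤ n) (hk : k ≤ 2) (hkn : k ≤ n) :
    FRec M n k (tripleCoeff n (tripleGeneral ((k : ℤ) - M - n) k (M + 1) (M + n)) 0)
      (tripleCoeff n (tripleGeneral ((k : ℤ) - M - n) k (M + 1) (M + n)) 1)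
      (tripleCoeff n (tripleGeneral ((k : ℤ) - M - n) k (M + 1) (M + n)) 2) ∧
    FRec.leadCoeff n (tripleCoeff n (tripleGeneral ((k : ℤ) - M - n) k (M + 1) (M + n)) 0)
      (tripleCoeff n (tripleGeneral ((k : ℤ) - M - n) k (M + 1) (M + n)) 1)
      (tripleCoeff n (tripleGeneral ((k : ℤ) - M - n) k (M + 1) (M + n)) 2) ≠ 0 := by
  obtain ⟨h₀, h₁, h₂⟩ := tripleGeneral_coeff hM hn hk
  refine ⟨((fRec_general hM hk fun j hj => seqGeneral_succ hj).smul _).congr h₀ h₁ h₂, ?_⟩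
  rw [leadCoeff_congr h₀ h₁ h₂, leadCoeff_smul, FRec.leadCoeff, if_neg (by omega)]
  refine mul_ne_zero (pow_ne_zero _ Complex.I_ne_zero) ?_
  split_ifs with hn1
  · refine mul_ne_zero (mul_ne_zero (mul_ne_zero ?_ ?_) (expCoeff_ne_zero _)) (invFact_ne_zero _)
    · obtain rfl | rfl : k = 0 ∨ k = 1 := by omega
      · have : (M : ℂ) + 2 ≠ 0 := by exact_mod_cast (by omega : M + 2 ≠ 0)
        simpa using this
      · have : (M : ℂ) + 2 ≠ 0 := by exact_mod_cast (by omega : M + 2 ≠ 0)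
        norm_num
        exact this
    · rw [seqGeneral, show (n - 1) / 2 + 1 - (0 + 1) = 0 by omega, poch_zero]
      exact one_ne_zero
  · refine mul_ne_zero (mul_ne_zero (mul_ne_zero (by norm_num) ?_) (expCoeff_ne_zero _))
      (invFact_ne_zero _)
    -- The rising factorial has length at most one, and its argument is negative.
    obtain h | h : (n - 1) / 2 + 1 - ((n - 2) / 2 + 1) = 0
        ∨ (n - 1) / 2 + 1 - ((n - 2) / 2 + 1) = 0 + 1 := by omega
    · rw [seqGeneral, h, poch_zero]
      exact one_ne_zero
    · rw [seqGeneral, h, poch_succ, poch_zero, mul_one, Nat.cast_zero, add_zero]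
      have : ((k : ℂ) - M - 2 - ((n - 1) / 2 : ℕ))
          = (((k : ℤ) - M - 2 - ((n - 1) / 2 : ℕ) : ℤ) : ℂ) := by push_cast; rfl
      rw [this]
      exact_mod_cast (by omega : (k : ℤ) - M - 2 - ((n - 1) / 2 : ℕ) ≠ 0)

open MvPolynomial (X C pderiv)

/-! ### Null coordinates -/

/-- The substitution of the null coordinates `ζ₁ + iζ₂`, `ζ₁ - iζ₂`, `ζ₃` for the three variables. -/
def nullCoord : Pol ≃ₐ[ℂ] Pol :=
  AlgEquiv.ofAlgHom
    (MvPolynomial.aeval ![X 0 + C Complex.I * X 1, X 0 - C Complex.I * X 1, X 2])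
    (MvPolynomial.aeval ![C (1 / 2) * (X 0 + X 1), C (-Complex.I / 2) * (X 0 - X 1), X 2])
    (by
      ext i : 1
      fin_cases i
      · simp only [Fin.zero_eta, AlgHom.coe_comp, Function.comp_apply, MvPolynomial.aeval_X,
          Matrix.cons_val_zero, Matrix.cons_val_one, map_mul, map_add, AlgHom.coe_id, id,
          MvPolynomial.algHom_C]
        change C (1 / 2 : ℂ) * _ = _
        rw [show (X 0 + C Complex.I * X 1 + (X 0 - C Complex.I * X 1) : Pol) = C 2 * X 0 by
          rw [map_ofNat]; ring, ← mul_assoc, ← C.map_mul]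
        norm_num
      · simp only [Fin.mk_one, AlgHom.coe_comp, Function.comp_apply, MvPolynomial.aeval_X,
          Matrix.cons_val_zero, Matrix.cons_val_one, map_mul, map_sub, AlgHom.coe_id, id,
          MvPolynomial.algHom_C]
        change C (-Complex.I / 2 : ℂ) * _ = _
        rw [show (X 0 + C Complex.I * X 1 - (X 0 - C Complex.I * X 1) : Pol)
          = C (2 * Complex.I) * X 1 by rw [C.map_mul, map_ofNat]; ring, ← mul_assoc, ← C.map_mul,
          show -Complex.I / 2 * (2 * Complex.I) = 1 by linear_combination -Complex.I_mul_I]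
        simp
      · simp)
    (by
      ext i : 1
      fin_cases i
      · simp only [Fin.zero_eta, AlgHom.coe_comp, Function.comp_apply, MvPolynomial.aeval_X,
          Matrix.cons_val_zero, Matrix.cons_val_one, map_mul, map_add, AlgHom.coe_id, id,
          MvPolynomial.algHom_C]
        change _ + C Complex.I * _ = _
        rw [← mul_assoc, ← C.map_mul, show Complex.I * (-Complex.I / 2) = 1 / 2 by
          linear_combination -(1 / 2) * Complex.I_mul_I, mul_add, mul_sub]
        have : (C (1 / 2) + C (1 / 2) : Pol) = 1 := by rw [← C.map_add]; norm_num
        linear_combination this * X 0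
      · simp only [Fin.mk_one, AlgHom.coe_comp, Function.comp_apply, MvPolynomial.aeval_X,
          Matrix.cons_val_zero, Matrix.cons_val_one, map_mul, map_sub, AlgHom.coe_id, id,
          MvPolynomial.algHom_C]
        change _ - C Complex.I * _ = _
        rw [← mul_assoc, ← C.map_mul, show Complex.I * (-Complex.I / 2) = 1 / 2 by
          linear_combination -(1 / 2) * Complex.I_mul_I, mul_add, mul_sub]
        have : (C (1 / 2) + C (1 / 2) : Pol) = 1 := by rw [← C.map_add]; norm_num
        linear_combination this * X 1
      · simp)

theorem nullCoord_C (c : ℂ) : nullCoord (C c) = C c := nullCoord.commutes c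

theorem nullCoord_X_zero : nullCoord (X 0) = X 0 + C Complex.I * X 1 :=
  MvPolynomial.aeval_X _ _

theorem nullCoord_X_one : nullCoord (X 1) = X 0 - C Complex.I * X 1 :=
  MvPolynomial.aeval_X _ _

theorem nullCoord_X_two : nullCoord (X 2) = X 2 := MvPolynomial.aeval_X _ _

theorem C_I_mul_C_I : (C Complex.I * C Complex.I : Pol) = -1 := by
  rw [← C.map_mul, Complex.I_mul_I]
  simp

theorem pderiv_nullCoord (q : Pol) :
    pderiv 0 (nullCoord q) = nullCoord (pderiv 0 q + pderiv 1 q) ∧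
    pderiv 1 (nullCoord q) = C Complex.I * nullCoord (pderiv 0 q - pderiv 1 q) ∧
    pderiv 2 (nullCoord q) = nullCoord (pderiv 2 q) := by
  induction q using MvPolynomial.induction_on with
  | C a => simp [nullCoord_C]
  | add p q hp hq =>
    simp only [map_add, map_sub] at hp hq ⊢
    refine ⟨?_, ?_, ?_⟩
    · linear_combination hp.1 + hq.1
    · linear_combination hp.2.1 + hq.2.1
    · linear_combination hp.2.2 + hq.2.2
  | mul_X p i hp =>
    obtain ⟨h0, h1, h2⟩ := hp
    simp only [map_add, map_sub] at h0 h1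
    have e10 : pderiv 1 (X 0 : Pol) = 0 := MvPolynomial.pderiv_X_of_ne (by decide)
    have e20 : pderiv 2 (X 0 : Pol) = 0 := MvPolynomial.pderiv_X_of_ne (by decide)
    have e01 : pderiv 0 (X 1 : Pol) = 0 := MvPolynomial.pderiv_X_of_ne (by decide)
    have e21 : pderiv 2 (X 1 : Pol) = 0 := MvPolynomial.pderiv_X_of_ne (by decide)
    have e02 : pderiv 0 (X 2 : Pol) = 0 := MvPolynomial.pderiv_X_of_ne (by decide)
    have e12 : pderiv 1 (X 2 : Pol) = 0 := MvPolynomial.pderiv_X_of_ne (by decide)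
    fin_cases i <;>
      simp only [Fin.zero_eta, Fin.mk_one, Fin.reduceFinMk, map_mul, map_add, map_sub,
        MvPolynomial.pderiv_mul, nullCoord_X_zero, nullCoord_X_one, nullCoord_X_two, h0, h1, h2,
        MvPolynomial.pderiv_X_self, MvPolynomial.pderiv_C, e10, e20, e01, e21, e02, e12, map_zero,
        map_one] <;>
      refine ⟨?_, ?_, ?_⟩ <;>
      first
      | trivial
      | ring1

theorem nullCoord_euler (q : Pol) :
    ∑ k, X k * pderiv k (nullCoord q) = nullCoord (∑ k, X k * pderiv k q) := by
  obtain ⟨h0, h1, h2⟩ := pderiv_nullCoord q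
  simp only [Fin.sum_univ_three, h0, h1, h2, map_add, map_sub, map_mul, nullCoord_X_zero,
    nullCoord_X_one, nullCoord_X_two]
  ring

theorem nullCoord_laplacian (q : Pol) :
    ∑ k, pderiv k (pderiv k (nullCoord q))
      = nullCoord (4 * pderiv 0 (pderiv 1 q) + pderiv 2 (pderiv 2 q)) := by
  obtain ⟨h0, h1, h2⟩ := pderiv_nullCoord q
  rw [Fin.sum_univ_three, h0, h1, h2, (pderiv_nullCoord _).1, MvPolynomial.pderiv_C_mul,
    (pderiv_nullCoord _).2.1, (pderiv_nullCoord _).2.2]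
  simp only [map_add, map_sub, map_mul, map_ofNat, pderiv_pderiv 1 0]
  linear_combination (nullCoord (pderiv 0 (pderiv 0 q)) - 2 * nullCoord (pderiv 0 (pderiv 1 q)) +
    nullCoord (pderiv 1 (pderiv 1 q))) * C_I_mul_C_I

/-- The component `r` of the operator of the first of the two null vectors that span `𝔫₊'`, in null
coordinates. -/
def opRaise (lam : ℂ) (q : Fin 3 → Pol) (r : Fin 3) : Pol :=
  C (4 * (lam + 1 - ((r : ℕ) : ℂ))) * pderiv 0 (q r) + 4 * ∑ k : Fin 3, X k * pderiv k (pderiv 0 (q r))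
    - X 1 * (4 * pderiv 0 (pderiv 1 (q r)) + pderiv 2 (pderiv 2 (q r)))
    - C (2 * ((r : ℕ) : ℂ)) * pderiv 2 (q (r - 1))

/-- The component `r` of the operator of the second of the two null vectors that span `𝔫₊'`, in null
coordinates. -/
def opLower (lam : ℂ) (q : Fin 3 → Pol) (r : Fin 3) : Pol :=
  C (4 * (lam - 1 + ((r : ℕ) : ℂ))) * pderiv 1 (q r) + 4 * ∑ k : Fin 3, X k * pderiv k (pderiv 1 (q r))
    - X 0 * (4 * pderiv 0 (pderiv 1 (q r)) + pderiv 2 (pderiv 2 (q r)))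
    + C (2 * (2 - ((r : ℕ) : ℂ))) * pderiv 2 (q (r + 1))

theorem actHom_dpiHat_nullCoord (lam a b : ℂ) {ψ : V3 →ₗ[ℂ] Pol} {q : Fin 3 → Pol}
    (hψ : ∀ r, ψ (u r) = nullCoord (q r)) (r : Fin 3) :
    actHom (dpiHat lam (nPlus ![a + b, Complex.I * (b - a), 0])) ψ (u r)
      = nullCoord (C a * opRaise lam q r + C b * opLower lam q r) := by
  have hd : ∀ p : Pol, ∑ j, C ((![a + b, Complex.I * (b - a), 0] : Fin 3 → ℂ) j) * pderiv j (nullCoord p)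
      = C 2 * nullCoord (C a * pderiv 0 p + C b * pderiv 1 p) := by
    intro p
    obtain ⟨h0, h1, h2⟩ := pderiv_nullCoord p
    simp only [Fin.sum_univ_three, h0, h1, h2, map_add, map_sub, map_mul, map_ofNat, nullCoord_C,
      Matrix.cons_val_zero, Matrix.cons_val_one, Matrix.cons_val]
    simp only [C.map_zero]
    linear_combination (C b - C a) * (nullCoord (pderiv 0 p) - nullCoord (pderiv 1 p)) * C_I_mul_C_I
  have hx : ∑ j, C ((![a + b, Complex.I * (b - a), 0] : Fin 3 → ℂ) j) * X j
      = nullCoord (C a * X 1 + C b * X 0) := by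
    simp only [Fin.sum_univ_three, map_add, map_sub, map_mul, nullCoord_C, nullCoord_X_zero,
      nullCoord_X_one, Matrix.cons_val_zero, Matrix.cons_val_one, Matrix.cons_val]
    simp only [C.map_zero]
    ring
  have hr : ∀ p : Pol, C (a + b) * pderiv 1 (nullCoord p) - C (Complex.I * (b - a)) * pderiv 0 (nullCoord p)
      = C (2 * Complex.I) * nullCoord (C a * pderiv 0 p - C b * pderiv 1 p) := by
    intro p
    obtain ⟨h0, h1, h2⟩ := pderiv_nullCoord p
    simp only [h0, h1, map_add, map_sub, map_mul, map_ofNat, nullCoord_C]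
    ring
  have h2 : ∀ p : Pol, pderiv 2 (nullCoord p) = nullCoord (pderiv 2 p) := fun p =>
    (pderiv_nullCoord p).2.2
  have hs (c : ℂ) (p : Pol) : c • p = C c * p := MvPolynomial.smul_eq_C_mul p c
  have hC2 : (C 2 : Pol) = 2 := map_ofNat _ _
  have hC4 : (C 4 : Pol) = 4 := map_ofNat _ _
  have hh : (C (1 / 2) * 2 : Pol) = 1 := by
    rw [← hC2, ← C.map_mul]
    norm_num
  have hh' : (C (Complex.I / 2) * 2 : Pol) = C Complex.I := by
    rw [← hC2, ← C.map_mul, div_mul_cancel₀ _ two_ne_zero]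
  obtain ⟨d010, d011, d012⟩ := dsigma3Real_01
  obtain ⟨d020, d021, d022⟩ := dsigma3Real_02
  obtain ⟨d120, d121, d122⟩ := dsigma3Real_12
  have he : ∀ p : Pol, ∑ k : Fin 3, X k * pderiv k (C 2 * nullCoord p)
      = C 2 * nullCoord (∑ k, X k * pderiv k p) := by
    intro p
    rw [← nullCoord_euler, Finset.mul_sum]
    refine Finset.sum_congr rfl fun k _ => ?_
    rw [MvPolynomial.pderiv_C_mul]
    ring
  rw [actHom_dpiHat_nPlus, hψ, hd, he, nullCoord_laplacian, hx, sum_Ioi_fin_three]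
  simp only [Matrix.cons_val_zero, Matrix.cons_val_one, Matrix.cons_val, C.map_zero, zero_mul,
    sub_zero]
  fin_cases r
  · have h := hr (q 0)
    simp only [Fin.zero_eta, d010, d020, d120, map_smul, map_neg, hψ, hs, MvPolynomial.pderiv_C_mul,
      h2, opRaise, opLower, Fin.sum_univ_three, nullCoord_C, map_add, map_sub, map_mul, hC2, hC4,
      map_ofNat, Nat.cast_zero, C.map_zero, map_zero, map_one,
      zero_add] at h ⊢
    linear_combination -2 * C Complex.I * h +
      (-4 * (C a * nullCoord (pderiv 0 (q 0)) - C b * nullCoord (pderiv 1 (q 0))) +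
        2 * (C a - C b) * nullCoord (pderiv 2 (q 1))) * C_I_mul_C_I
  · simp only [Fin.mk_one, d011, d021, d121, map_smul, map_zero, hψ, hs, MvPolynomial.pderiv_C_mul,
      h2, opRaise, opLower, Fin.sum_univ_three, nullCoord_C, map_add, map_sub, map_mul, hC2, hC4,
      map_ofNat, Nat.cast_one, map_one,
      show (1 : Fin 3) - 1 = 0 from rfl, show (1 : Fin 3) + 1 = 2 from rfl]
    linear_combination
      -(C a + C b) * (nullCoord (pderiv 2 (q 0)) - nullCoord (pderiv 2 (q 2))) * hh
      - C Complex.I * (C b - C a) * (nullCoord (pderiv 2 (q 0)) + nullCoord (pderiv 2 (q 2))) * hh'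
      - (C b - C a) * (nullCoord (pderiv 2 (q 0)) + nullCoord (pderiv 2 (q 2))) * C_I_mul_C_I
  · have h := hr (q 2)
    simp only [Fin.reduceFinMk, d012, d022, d122, map_smul, map_neg, neg_mul, hψ, hs,
      MvPolynomial.pderiv_C_mul, h2, opRaise, opLower, Fin.sum_univ_three, nullCoord_C, map_add,
      map_sub, map_mul, hC2, hC4, map_ofNat, map_one,
      show (2 : Fin 3) - 1 = 1 from rfl, Nat.cast_ofNat, sub_self, C.map_zero, map_zero] at h ⊢
    linear_combination 2 * C Complex.I * h +
      (4 * (C a * nullCoord (pderiv 0 (q 2)) - C b * nullCoord (pderiv 1 (q 2))) +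
        2 * (C a - C b) * nullCoord (pderiv 2 (q 1))) * C_I_mul_C_I

theorem mem_nPlusPrime_iff {Y : Matrix (Fin 5) (Fin 5) ℂ} : Y ∈ nPlusPrime ↔
    ∃ a b : ℂ, Y = nPlus ![a + b, Complex.I * (b - a), 0] := by
  constructor
  · rintro ⟨hJ, hH, hv⟩
    have hJ' (i j : Fin 5) : Y j i * J j j + J i i * Y i j = 0 := by
      have := congrFun (congrFun hJ i) j
      simpa only [J, Matrix.add_apply, Matrix.mul_diagonal, Matrix.diagonal_mul,
        Matrix.transpose_apply, Matrix.zero_apply, Matrix.diagonal_apply_eq] using this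
    have hH' (i j : Fin 5) : (H0 * Y - Y * H0) i j = Y i j := by rw [hH]
    have hv' (i : Fin 5) : Y i 3 = 0 := by simpa using congrFun hv i
    simp only [Matrix.sub_apply, Matrix.mul_apply, Fin.sum_univ_five, H0, Matrix.add_apply,
      Matrix.single_apply] at hH'
    have hz : ∀ i j : Fin 5, i ≠ 0 → i ≠ 4 → j ≠ 0 → j ≠ 4 → Y i j = 0 := by
      intro i j hi hi' hj hj'
      have := hH' i j
      simpa [hi.symm, hi'.symm, hj.symm, hj'.symm, eq_comm] using this
    have h00 : Y 0 0 = 0 := by simpa [J] using hJ' 0 0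
    have h44 : Y 4 4 = 0 := by simpa [J, ← two_mul] using hJ' 4 4
    have h04 : Y 0 4 = 0 := by simpa [h00, h44] using (hH' 0 4).symm
    have h40 : Y 4 0 = 0 := by simpa [h00, h44] using (hH' 4 0).symm
    have h30 : Y 3 0 = 0 := by simpa [J, hv'] using hJ' 0 3
    have h01 : Y 0 1 = -Y 1 0 := by
      have := hJ' 0 1
      simp only [J, Matrix.diagonal_apply_eq] at this
      simp at this
      linear_combination this
    have h02 : Y 0 2 = -Y 2 0 := by
      have := hJ' 0 2
      simp only [J, Matrix.diagonal_apply_eq] at this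
      simp at this
      linear_combination this
    have h14 : Y 1 4 = -Y 1 0 := by simpa [neg_eq_iff_eq_neg] using hH' 1 0
    have h24 : Y 2 4 = -Y 2 0 := by simpa [neg_eq_iff_eq_neg] using hH' 2 0
    have h34 : Y 3 4 = 0 := by simpa [h30] using (hH' 3 4).symm
    have h41 : Y 4 1 = -Y 1 0 := by simpa [h01] using hH' 0 1
    have h42 : Y 4 2 = -Y 2 0 := by simpa [h02] using hH' 0 2
    refine ⟨(Y 1 0 + Complex.I * Y 2 0) / 2, (Y 1 0 - Complex.I * Y 2 0) / 2, ?_⟩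
    have e1 : (Y 1 0 + Complex.I * Y 2 0) / 2 + (Y 1 0 - Complex.I * Y 2 0) / 2 = Y 1 0 := by ring
    have e2 : Complex.I * ((Y 1 0 - Complex.I * Y 2 0) / 2 - (Y 1 0 + Complex.I * Y 2 0) / 2)
        = Y 2 0 := by linear_combination -Y 2 0 * Complex.I_mul_I
    rw [e1, e2, nPlus_eq]
    ext i j
    fin_cases i <;> fin_cases j <;>
      simp [h00, h44, h04, h40, h30, h01, h02, h14, h24, h34, h41, h42, hv', hz]
  · rintro ⟨a, b, rfl⟩
    rw [nPlus_eq]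
    refine ⟨?_, ?_, ?_⟩
    · ext i j
      fin_cases i <;> fin_cases j <;>
        simp [J, Matrix.mul_apply, Matrix.diagonal_apply]
    · ext i j
      fin_cases i <;> fin_cases j <;>
        simp [H0, Matrix.mul_apply, Matrix.single_apply, Matrix.vecMul, dotProduct]
    · ext i
      fin_cases i <;> simp [Matrix.mulVec, dotProduct, Fin.sum_univ_five]

theorem forall_nPlusPrime_iff (lam : ℂ) {ψ : V3 →ₗ[ℂ] Pol} {q : Fin 3 → Pol}
    (hψ : ∀ r, ψ (u r) = nullCoord (q r)) :
    (∀ Y ∈ nPlusPrime, actHom (dpiHat lam Y) ψ = 0) ↔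
      ∀ r, opRaise lam q r = 0 ∧ opLower lam q r = 0 := by
  constructor
  · intro h r
    have key (a b : ℂ) : C a * opRaise lam q r + C b * opLower lam q r = 0 := by
      have := h _ (mem_nPlusPrime_iff.mpr ⟨a, b, rfl⟩)
      refine nullCoord.injective ?_
      rw [← actHom_dpiHat_nullCoord lam a b hψ, this, map_zero, LinearMap.zero_apply]
    exact ⟨by simpa using key 1 0, by simpa using key 0 1⟩
  · intro h Y hY
    obtain ⟨a, b, rfl⟩ := mem_nPlusPrime_iff.mp hY
    refine u.ext fun r => ?_
    rw [actHom_dpiHat_nullCoord lam a b hψ, (h r).1, (h r).2]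
    simp

/-! ### The action of `L'` and weights -/

theorem exp_conj_diagonal {U V : Matrix (Fin 5) (Fin 5) ℂ} (h : U * V = 1) (d : Fin 5 → ℂ) :
    NormedSpace.exp (U * Matrix.diagonal d * V)
      = U * Matrix.diagonal (fun i => Complex.exp (d i)) * V := by
  have e := Matrix.exp_units_conj ⟨U, V, h, mul_eq_one_comm.mp h⟩ (Matrix.diagonal d)
  rw [Matrix.exp_diagonal] at e
  rw [Complex.exp_eq_exp_ℂ]
  refine e.trans ?_
  rw [Pi.exp_def]
  rfl

/-- `H₀` is diagonalized by the coordinates `x₀ ± x₄`. -/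
theorem exp_smul_H0 (t : ℂ) : NormedSpace.exp (t • H0)
    = leviMat ((Complex.exp t + Complex.exp (-t)) / 2) ((Complex.exp t - Complex.exp (-t)) / 2)
      1 := by
  have hU : (!![1, 0, 0, 0, 1; 0, 1, 0, 0, 0; 0, 0, 1, 0, 0; 0, 0, 0, 1, 0; 1, 0, 0, 0, -1] :
      Matrix (Fin 5) (Fin 5) ℂ) * !![1 / 2, 0, 0, 0, 1 / 2; 0, 1, 0, 0, 0; 0, 0, 1, 0, 0;
        0, 0, 0, 1, 0; 1 / 2, 0, 0, 0, -1 / 2] = 1 := by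
    ext i j
    fin_cases i <;> fin_cases j <;> simp [Matrix.mul_apply, Fin.sum_univ_five] <;> norm_num
  have h := exp_conj_diagonal hU ![t, 0, 0, 0, -t]
  have h1 : t • H0 = !![1, 0, 0, 0, 1; 0, 1, 0, 0, 0; 0, 0, 1, 0, 0; 0, 0, 0, 1, 0; 1, 0, 0, 0, -1]
      * Matrix.diagonal ![t, 0, 0, 0, -t] * !![1 / 2, 0, 0, 0, 1 / 2; 0, 1, 0, 0, 0; 0, 0, 1, 0, 0;
        0, 0, 0, 1, 0; 1 / 2, 0, 0, 0, -1 / 2] := by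
    ext i j
    rw [Matrix.mul_apply]
    simp only [Matrix.mul_diagonal, Fin.sum_univ_five]
    fin_cases i <;> fin_cases j <;> simp [H0] <;> ring
  rw [h1, h]
  ext i j
  rw [Matrix.mul_apply]
  simp only [Matrix.mul_diagonal, Fin.sum_univ_five]
  fin_cases i <;> fin_cases j <;> simp [leviMat] <;> ring

theorem leviPrime_eq (s t : ℝ) : leviPrime s t
    = leviMat ((Complex.exp t + Complex.exp (-t)) / 2) ((Complex.exp t - Complex.exp (-t)) / 2)
      (fun i j => (rot s i j : ℂ)) := by
  rw [leviPrime, exp_smul_H0]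
  ext i j
  fin_cases i <;> fin_cases j <;>
    simp [embed, leviMat, Matrix.mul_apply, Fin.sum_univ_five, rot]

theorem isUnit_leviPrime (s t : ℝ) : IsUnit (leviPrime s t) := by
  refine IsUnit.mul ?_ (Matrix.isUnit_exp _)
  refine IsUnit.of_mul_eq_one (embed 1 (rot (-s))) ?_
  have hc : (Complex.cos s) * (Complex.cos s) + (Complex.sin s) * (Complex.sin s) = 1 := by
    linear_combination Complex.cos_sq_add_sin_sq (s : ℂ)
  ext i j
  fin_cases i <;> fin_cases j <;>
    simp [embed, Matrix.mul_apply, Fin.sum_univ_five, rot] <;> first | linear_combination hc | ring1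

theorem conj_leviPrime_Cplus (s t : ℝ) (j : Fin 3) :
    (leviPrime s t)⁻¹ * Cplus j * leviPrime s t
      = nPlus (fun k => Complex.exp (-t) * (rot s j k : ℂ)) := by
  have hdet : IsUnit (leviPrime s t).det := (Matrix.isUnit_iff_isUnit_det _).mp (isUnit_leviPrime s t)
  have h : Cplus j * leviPrime s t
      = leviPrime s t * nPlus (fun k => Complex.exp (-t) * (rot s j k : ℂ)) := by
    have he : Complex.exp t * Complex.exp (-t) = 1 := by rw [← Complex.exp_add]; simp
    have hc : (Complex.cos s) ^ 2 = 1 - (Complex.sin s) ^ 2 := by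
      linear_combination Complex.cos_sq_add_sin_sq (s : ℂ)
    have hC : Cplus j = nPlus (Pi.single j 1) := by
      simp [nPlus, Pi.single_apply]
    rw [hC, leviPrime_eq, nPlus_eq, nPlus_eq]
    ext i k
    generalize Complex.exp t = E at he ⊢
    generalize Complex.exp (-t) = E' at he ⊢
    fin_cases j <;> fin_cases i <;> fin_cases k <;>
      simp [leviMat, Matrix.mul_apply, Fin.sum_univ_five, rot] <;>
      first
      | ring1
      | linear_combination Complex.cos s * he
      | linear_combination -Complex.cos s * he
      | linear_combination Complex.sin s * he
      | linear_combination -Complex.sin s * he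
      | linear_combination he
      | linear_combination -E' * hc
      | linear_combination E' * hc
  rw [mul_assoc, h, Matrix.nonsing_inv_mul_cancel_left _ _ hdet]

/-- The substitution that multiplies the variable `X i` by `c i`. -/
def scaleVars (c : Fin 3 → ℂ) : Pol →ₐ[ℂ] Pol := MvPolynomial.aeval fun i => C (c i) * X i

theorem coeff_scaleVars (c : Fin 3 → ℂ) (q : Pol) (d : Fin 3 →₀ ℕ) :
    (scaleVars c q).coeff d = (∏ i, c i ^ d i) * q.coeff d := by
  induction q using MvPolynomial.induction_on' with
  | monomial e a =>
    have h : scaleVars c (MvPolynomial.monomial e a)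
        = MvPolynomial.monomial e (a * ∏ i, c i ^ e i) := by
      rw [scaleVars, MvPolynomial.aeval_monomial, Finsupp.prod_fintype _ _ (by simp)]
      simp only [mul_pow, Finset.prod_mul_distrib, ← C.map_pow, ← map_prod]
      rw [MvPolynomial.algebraMap_eq, ← mul_assoc, ← C.map_mul,
        MvPolynomial.monomial_eq (s := e), Finsupp.prod_fintype _ _ (by simp)]
    rw [h, MvPolynomial.coeff_monomial, MvPolynomial.coeff_monomial]
    split_ifs with he
    · rw [he, mul_comm]
    · rw [mul_zero]
  | add p q hp hq => rw [map_add, MvPolynomial.coeff_add, hp, hq, MvPolynomial.coeff_add, mul_add]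

/-- In null coordinates the group `L'` acts diagonally. -/
theorem AdSharp_leviPrime (s t : ℝ) (q : Pol) :
    AdSharp (leviPrime s t) (nullCoord q)
      = nullCoord (scaleVars ![Complex.exp (-t - Complex.I * s), Complex.exp (-t + Complex.I * s),
          Complex.exp (-t)] q) := by
  have h : (MvPolynomial.aeval fun k : Fin 3 => ∑ j, C (coordPlus ((leviPrime s t)⁻¹ * Cplus j
        * leviPrime s t) k) * (X j : Pol)).comp nullCoord.toAlgHom
      = nullCoord.toAlgHom.comp (scaleVars ![Complex.exp (-t - Complex.I * s),
          Complex.exp (-t + Complex.I * s), Complex.exp (-t)]) := by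
    ext i : 1
    simp only [conj_leviPrime_Cplus, coordPlus_nPlus, AlgHom.comp_apply, scaleVars,
      MvPolynomial.aeval_X, AlgEquiv.toAlgHom_apply, map_mul, nullCoord_C]
    have hm : Complex.exp (-t - Complex.I * s)
        = Complex.exp (-t) * (Complex.cos s - Complex.sin s * Complex.I) := by
      rw [sub_eq_add_neg, Complex.exp_add, show -(Complex.I * s) = (-s : ℂ) * Complex.I by ring,
        Complex.exp_mul_I, Complex.cos_neg, Complex.sin_neg, neg_mul, sub_eq_add_neg]
    have hp : Complex.exp (-t + Complex.I * s)
        = Complex.exp (-t) * (Complex.cos s + Complex.sin s * Complex.I) := by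
      rw [Complex.exp_add, mul_comm Complex.I, Complex.exp_mul_I]
    fin_cases i
    · simp [nullCoord_X_zero, Fin.sum_univ_three, rot, hm]
      linear_combination (C (Complex.exp (-t)) * C (Complex.sin s) * X 1) * C_I_mul_C_I
    · simp [nullCoord_X_one, Fin.sum_univ_three, rot, hp]
      linear_combination (C (Complex.exp (-t)) * C (Complex.sin s) * X 1) * C_I_mul_C_I
    · simp [nullCoord_X_two, Fin.sum_univ_three, rot]
  exact DFunLike.congr_fun h q

/-! ### The weight condition -/

theorem eq_of_exp_mul_eq {A B : ℂ} (h : ∀ t : ℝ, Complex.exp (A * t) = Complex.exp (B * t)) :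
    A = B := by
  have hd (A : ℂ) : HasDerivAt (fun t : ℝ => Complex.exp (A * t)) A 0 := by
    have h1 : HasDerivAt (fun t : ℝ => A * (t : ℂ)) A 0 := by
      simpa using (Complex.ofRealCLM.hasDerivAt (x := (0 : ℝ))).const_mul A
    simpa using h1.cexp
  exact (hd A).unique ((funext h : (fun t : ℝ => Complex.exp (A * t)) = _) ▸ hd B)

/-- The equivariance under `L'`, in null coordinates, prescribes which monomials occur. -/
theorem equivariant_iff (lam nu : ℂ) (m : ℤ) {ψ : V3 →ₗ[ℂ] Pol} {q : Fin 3 → Pol}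
    (hψ : ∀ r, ψ (u r) = nullCoord (q r)) :
    (∀ s t : ℝ, ψ ∘ₗ sigmaLam lam (rot s) t = tau m nu s t • (AdSharp (leviPrime s t) ∘ₗ ψ)) ↔
      ∀ r d, (q r).coeff d ≠ 0 →
        nu - lam = (d 0 + d 1 + d 2 : ℕ) ∧ (d 0 : ℤ) = d 1 + (m - 1 + (r : ℕ)) := by
  have key (s t : ℝ) : ψ ∘ₗ sigmaLam lam (rot s) t = tau m nu s t • (AdSharp (leviPrime s t) ∘ₗ ψ) ↔
      ∀ r d, (q r).coeff d ≠ 0 → Complex.exp (lam * t + Complex.I * (1 - (r : ℕ)) * s)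
        = Complex.exp ((nu - (d 0 + d 1 + d 2 : ℕ)) * t
          + Complex.I * (m - d 0 + d 1) * s) := by
    have h1 (r : Fin 3) : (ψ ∘ₗ sigmaLam lam (rot s) t) (u r)
        = nullCoord (Complex.exp (lam * t + Complex.I * (1 - (r : ℕ)) * s) • q r) := by
      rw [LinearMap.comp_apply, sigmaLam, LinearMap.smul_apply, sigma3_rot, map_smul, map_smul, hψ,
        smul_smul, ← Complex.exp_add, map_smul]
    have h2 (r : Fin 3) : (tau m nu s t • (AdSharp (leviPrime s t) ∘ₗ ψ)) (u r)
        = nullCoord (tau m nu s t • scaleVars ![Complex.exp (-t - Complex.I * s),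
          Complex.exp (-t + Complex.I * s), Complex.exp (-t)] (q r)) := by
      rw [LinearMap.smul_apply, LinearMap.comp_apply, hψ, AdSharp_leviPrime, map_smul]
    have h3 (d : Fin 3 →₀ ℕ) : tau m nu s t * ∏ i, ![Complex.exp (-t - Complex.I * s),
          Complex.exp (-t + Complex.I * s), Complex.exp (-t)] i ^ d i
        = Complex.exp ((nu - (d 0 + d 1 + d 2 : ℕ)) * t + Complex.I * (m - d 0 + d 1) * s) := by
      simp only [tau, Fin.prod_univ_three, Matrix.cons_val_zero, Matrix.cons_val_one,
        Matrix.cons_val, ← Complex.exp_nat_mul, ← Complex.exp_add]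
      congr 1
      push_cast
      ring
    constructor
    · intro h r d hd
      have h4 := congrArg (fun φ => φ (u r)) h
      simp only [h1, h2] at h4
      have h5 := congrArg (MvPolynomial.coeff d) (nullCoord.injective h4)
      rw [MvPolynomial.coeff_smul, MvPolynomial.coeff_smul, coeff_scaleVars, smul_eq_mul,
        smul_eq_mul, ← mul_assoc, h3] at h5
      exact mul_right_cancel₀ hd h5
    · intro h
      refine u.ext fun r => ?_
      rw [h1, h2]
      congr 1
      ext d
      rw [MvPolynomial.coeff_smul, MvPolynomial.coeff_smul, coeff_scaleVars, smul_eq_mul,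
        smul_eq_mul, ← mul_assoc, h3]
      by_cases hd : (q r).coeff d = 0
      · rw [hd, mul_zero, mul_zero]
      · rw [h r d hd]
  simp only [key]
  constructor
  · intro h r d hd
    have ht : lam = nu - (d 0 + d 1 + d 2 : ℕ) :=
      eq_of_exp_mul_eq fun t => by simpa using h 0 t r d hd
    have hs : Complex.I * (1 - (r : ℕ)) = Complex.I * (m - d 0 + d 1) :=
      eq_of_exp_mul_eq fun s => by simpa using h s 0 r d hd
    have hs' := mul_left_cancel₀ Complex.I_ne_zero hs
    refine ⟨by rw [ht]; ring, ?_⟩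
    have : ((d 0 : ℤ) : ℂ) = ((d 1 + (m - 1 + (r : ℕ)) : ℤ) : ℂ) := by
      push_cast
      linear_combination hs'
    exact_mod_cast this
  · intro h s t r d hd
    obtain ⟨h1, h2⟩ := h r d hd
    have h2' : (d 0 : ℂ) = d 1 + (m - 1 + (r : ℕ)) := by exact_mod_cast h2
    rw [h2', ← h1]
    congr 1
    ring

/-! ### Coefficients of the operators -/

/-- The exponent of the monomial `X 0 ^ a * X 1 ^ b * X 2 ^ c`. -/
def expo3 (a b c : ℕ) : Fin 3 →₀ ℕ := Finsupp.equivFunOnFinite.symm ![a, b, c]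

@[simp]
theorem expo3_zero (a b c : ℕ) : expo3 a b c 0 = a := rfl

@[simp]
theorem expo3_one (a b c : ℕ) : expo3 a b c 1 = b := rfl

@[simp]
theorem expo3_two (a b c : ℕ) : expo3 a b c 2 = c := rfl

theorem eq_expo3 (d : Fin 3 →₀ ℕ) : d = expo3 (d 0) (d 1) (d 2) := by
  ext i
  fin_cases i <;> rfl

theorem expo3_add_single_zero (a b c : ℕ) :
    expo3 a b c + Finsupp.single 0 1 = expo3 (a + 1) b c := by
  ext i
  fin_cases i <;> simp [expo3]

theorem expo3_add_single_one (a b c : ℕ) :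
    expo3 a b c + Finsupp.single 1 1 = expo3 a (b + 1) c := by
  ext i
  fin_cases i <;> simp [expo3]

theorem expo3_add_single_two (a b c : ℕ) :
    expo3 a b c + Finsupp.single 2 1 = expo3 a b (c + 1) := by
  ext i
  fin_cases i <;> simp [expo3]

theorem coeff_euler (p : Pol) (d : Fin 3 →₀ ℕ) :
    (∑ k : Fin 3, X k * pderiv k p).coeff d = (d 0 + d 1 + d 2) * p.coeff d := by
  have h (k : Fin 3) : (X k * pderiv k p).coeff d = d k * p.coeff d := by
    rw [MvPolynomial.coeff_X_mul']
    split_ifs with hk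
    · have h1 : 1 ≤ d k := Nat.one_le_iff_ne_zero.mpr (Finsupp.mem_support_iff.mp hk)
      rw [MvPolynomial.coeff_pderiv, tsub_add_cancel_of_le (Finsupp.single_le_iff.mpr h1),
        Finsupp.tsub_apply, Finsupp.single_eq_same, Nat.cast_sub h1]
      ring
    · rw [Finsupp.notMem_support_iff.mp hk]
      simp
  rw [Fin.sum_univ_three, MvPolynomial.coeff_add, MvPolynomial.coeff_add, h, h, h]
  ring

theorem coeff_four_mul (p : Pol) (d : Fin 3 →₀ ℕ) : (4 * p).coeff d = 4 * p.coeff d := by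
  rw [show (4 : Pol) = C 4 from (map_ofNat C 4).symm, MvPolynomial.coeff_C_mul]

theorem coeff_X_one_mul_zero (p : Pol) (a c : ℕ) : (X 1 * p).coeff (expo3 a 0 c) = 0 := by
  rw [MvPolynomial.coeff_X_mul', if_neg (by simp)]

theorem coeff_X_one_mul_succ (p : Pol) (a b c : ℕ) :
    (X 1 * p).coeff (expo3 a (b + 1) c) = p.coeff (expo3 a b c) := by
  rw [← expo3_add_single_one, add_comm, MvPolynomial.coeff_X_mul]

theorem coeff_X_zero_mul_zero (p : Pol) (b c : ℕ) : (X 0 * p).coeff (expo3 0 b c) = 0 := by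
  rw [MvPolynomial.coeff_X_mul', if_neg (by simp)]

theorem coeff_X_zero_mul_succ (p : Pol) (a b c : ℕ) :
    (X 0 * p).coeff (expo3 (a + 1) b c) = p.coeff (expo3 a b c) := by
  rw [← expo3_add_single_zero, add_comm, MvPolynomial.coeff_X_mul]

theorem coeff_opRaise_zero (lam : ℂ) (q : Fin 3 → Pol) (r : Fin 3) (a c : ℕ) :
    (opRaise lam q r).coeff (expo3 a 0 c)
      = 4 * (lam + 1 - (r : ℕ) + a + c) * (a + 1) * (q r).coeff (expo3 (a + 1) 0 c)
        - 2 * (r : ℕ) * (c + 1) * (q (r - 1)).coeff (expo3 a 0 (c + 1)) := by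
  simp only [opRaise, MvPolynomial.coeff_add, MvPolynomial.coeff_sub, MvPolynomial.coeff_C_mul,
    coeff_four_mul, coeff_euler, coeff_X_one_mul_zero, MvPolynomial.coeff_pderiv,
    expo3_add_single_zero, expo3_add_single_two, expo3_zero, expo3_one, expo3_two]
  push_cast
  ring

theorem coeff_opRaise_succ (lam : ℂ) (q : Fin 3 → Pol) (r : Fin 3) (a b c : ℕ) :
    (opRaise lam q r).coeff (expo3 a (b + 1) c)
      = 4 * (lam + 1 - (r : ℕ) + a + c) * (a + 1) * (q r).coeff (expo3 (a + 1) (b + 1) c)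
        - (c + 2) * (c + 1) * (q r).coeff (expo3 a b (c + 2))
        - 2 * (r : ℕ) * (c + 1) * (q (r - 1)).coeff (expo3 a (b + 1) (c + 1)) := by
  simp only [opRaise, MvPolynomial.coeff_add, MvPolynomial.coeff_sub, MvPolynomial.coeff_C_mul,
    coeff_four_mul, coeff_euler, coeff_X_one_mul_succ, MvPolynomial.coeff_pderiv,
    expo3_add_single_zero, expo3_add_single_one, expo3_add_single_two, expo3_zero, expo3_one,
    expo3_two]
  push_cast
  ring

theorem coeff_opLower_zero (lam : ℂ) (q : Fin 3 → Pol) (r : Fin 3) (b c : ℕ) :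
    (opLower lam q r).coeff (expo3 0 b c)
      = 4 * (lam - 1 + (r : ℕ) + b + c) * (b + 1) * (q r).coeff (expo3 0 (b + 1) c)
        + 2 * (2 - (r : ℕ)) * (c + 1) * (q (r + 1)).coeff (expo3 0 b (c + 1)) := by
  simp only [opLower, MvPolynomial.coeff_add, MvPolynomial.coeff_sub, MvPolynomial.coeff_C_mul,
    coeff_four_mul, coeff_euler, coeff_X_zero_mul_zero, MvPolynomial.coeff_pderiv,
    expo3_add_single_one, expo3_add_single_two, expo3_zero, expo3_one, expo3_two]
  push_cast
  ring

theorem coeff_opLower_succ (lam : ℂ) (q : Fin 3 → Pol) (r : Fin 3) (a b c : ℕ) :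
    (opLower lam q r).coeff (expo3 (a + 1) b c)
      = 4 * (lam - 1 + (r : ℕ) + b + c) * (b + 1) * (q r).coeff (expo3 (a + 1) (b + 1) c)
        - (c + 2) * (c + 1) * (q r).coeff (expo3 a b (c + 2))
        + 2 * (2 - (r : ℕ)) * (c + 1) * (q (r + 1)).coeff (expo3 (a + 1) b (c + 1)) := by
  simp only [opLower, MvPolynomial.coeff_add, MvPolynomial.coeff_sub, MvPolynomial.coeff_C_mul,
    coeff_four_mul, coeff_euler, coeff_X_zero_mul_succ, MvPolynomial.coeff_pderiv,
    expo3_add_single_zero, expo3_add_single_one, expo3_add_single_two, expo3_zero, expo3_one,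
    expo3_two]
  push_cast
  ring

/-! ### From the differential equations to the recurrence system -/

/-- The condition that only the monomials with the exponents `(M + r + j, j, n - r - 2 * j)` occur in
the component `r`. -/
def HasWeight (M n : ℕ) (q : Fin 3 → Pol) : Prop :=
  ∀ r d, (q r).coeff d ≠ 0 → d 0 = d 1 + (M + (r : ℕ)) ∧ d 0 + d 1 + d 2 = M + n

/-- The coefficient of the monomial with the exponents `(M + r + j, j, n - r - 2 * j)` in the
component `r`. -/
def solCoeff (M n : ℕ) (q : Fin 3 → Pol) (r : Fin 3) (j : ℕ) : ℂ :=
  (q r).coeff (expo3 (M + r + j) j (n - r - 2 * j))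

theorem coeff_eq_solCoeff (M n : ℕ) (q : Fin 3 → Pol) {r : Fin 3} {a j c : ℕ} (ha : a = M + r + j)
    (hc : r + 2 * j + c = n) : (q r).coeff (expo3 a j c) = solCoeff M n q r j := by
  rw [solCoeff, ha, show n - r - 2 * j = c by omega]

theorem val_sub_one {r : Fin 3} (hr : r ≠ 0) : ((r - 1 : Fin 3) : ℕ) + 1 = r := by
  fin_cases r
  · exact absurd rfl hr
  · rfl
  · rfl

theorem val_add_one {r : Fin 3} (hr : r ≠ 2) : ((r + 1 : Fin 3) : ℕ) = r + 1 := by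
  fin_cases r
  · rfl
  · rfl
  · exact absurd rfl hr

namespace HasWeight

variable {M n : ℕ} {q : Fin 3 → Pol}

theorem coeff_eq_zero (h : HasWeight M n q) {r : Fin 3} {a b c : ℕ}
    (h' : a = b + (M + r) → a + b + c = M + n → False) : (q r).coeff (expo3 a b c) = 0 := by
  by_contra hne
  exact h' (h r _ hne).1 (h r _ hne).2

theorem opRaise (h : HasWeight M n q) (lam : ℂ) (r : Fin 3) {a b c : ℕ}
    (h' : a + 1 = b + (M + r) → a + b + c + 1 = M + n → False) :
    (FSystem.opRaise lam q r).coeff (expo3 a b c) = 0 := by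
  have hr : ((r : ℕ) : ℂ) * (q (r - 1)).coeff (expo3 a b (c + 1)) = 0 := by
    by_cases hr : r = 0
    · simp [hr]
    · have := val_sub_one hr
      rw [h.coeff_eq_zero fun h1 h2 => h' (by omega) (by omega), mul_zero]
  cases b with
  | zero =>
    rw [coeff_opRaise_zero, h.coeff_eq_zero fun h1 h2 => h' (by omega) (by omega)]
    linear_combination -2 * (c + 1) * hr
  | succ b =>
    rw [coeff_opRaise_succ, h.coeff_eq_zero fun h1 h2 => h' (by omega) (by omega),
      h.coeff_eq_zero fun h1 h2 => h' (by omega) (by omega)]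
    linear_combination -2 * (c + 1) * hr

theorem opLower (h : HasWeight M n q) (lam : ℂ) (r : Fin 3) {a b c : ℕ}
    (h' : a = b + 1 + (M + r) → a + b + c + 1 = M + n → False) :
    (FSystem.opLower lam q r).coeff (expo3 a b c) = 0 := by
  have hr : (2 - (r : ℕ) : ℂ) * (q (r + 1)).coeff (expo3 a b (c + 1)) = 0 := by
    by_cases hr : r = 2
    · simp [hr]
    · have := val_add_one hr
      rw [h.coeff_eq_zero fun h1 h2 => h' (by omega) (by omega), mul_zero]
  cases a with
  | zero =>
    rw [coeff_opLower_zero, h.coeff_eq_zero fun h1 h2 => h' (by omega) (by omega)]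
    linear_combination 2 * (c + 1) * hr
  | succ b =>
    rw [coeff_opLower_succ, h.coeff_eq_zero fun h1 h2 => h' (by omega) (by omega),
      h.coeff_eq_zero fun h1 h2 => h' (by omega) (by omega)]
    linear_combination 2 * (c + 1) * hr

end HasWeight

theorem opRaise_coeff_succ {M n : ℕ} {q : Fin 3 → Pol} {lam nu : ℂ} (hlam : nu - lam = (M + n : ℕ))
    {r : Fin 3} {j N : ℕ} (hN : r + 2 * (j + 1) + N = n) :
    (opRaise lam q r).coeff (expo3 (M + r + j) (j + 1) N)
      = 4 * (M + r + j + 1) * (nu - r - j - 1) * solCoeff M n q r (j + 1)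
        - (N + 2) * (N + 1) * solCoeff M n q r j
        - 2 * (r : ℕ) * (N + 1) * solCoeff M n q (r - 1) (j + 1) := by
  have hr : ((r : ℕ) : ℂ) * (q (r - 1)).coeff (expo3 (M + r + j) (j + 1) (N + 1))
      = (r : ℕ) * solCoeff M n q (r - 1) (j + 1) := by
    by_cases hr : r = 0
    · simp [hr]
    · have := val_sub_one hr
      rw [coeff_eq_solCoeff M n q (by omega) (by omega)]
  have hn : ((r : ℕ) : ℂ) + 2 * (j + 1) + N = n := by exact_mod_cast hN
  push_cast at hlam
  rw [coeff_opRaise_succ, coeff_eq_solCoeff M n q (by omega) hN,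
    coeff_eq_solCoeff M n q (by omega) (show r + 2 * j + (N + 2) = n by omega)]
  push_cast
  linear_combination -2 * (N + 1) * hr
    + 4 * (M + r + j + 1) * solCoeff M n q r (j + 1) * (hn - hlam)

theorem opRaise_coeff_zero {M n : ℕ} {q : Fin 3 → Pol} {lam nu : ℂ} (hlam : nu - lam = (M + n : ℕ))
    {r : Fin 3} {a N : ℕ} (ha : a + 1 = M + r) (hN : r + N = n) :
    (opRaise lam q r).coeff (expo3 a 0 N)
      = 4 * (M + r) * (nu - r) * solCoeff M n q r 0
        - 2 * (r : ℕ) * (N + 1) * solCoeff M n q (r - 1) 0 := by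
  have hr : ((r : ℕ) : ℂ) * (q (r - 1)).coeff (expo3 a 0 (N + 1))
      = (r : ℕ) * solCoeff M n q (r - 1) 0 := by
    by_cases hr : r = 0
    · simp [hr]
    · have := val_sub_one hr
      rw [coeff_eq_solCoeff M n q (by omega) (by omega)]
  have hn : ((r : ℕ) : ℂ) + N = n := by exact_mod_cast hN
  have ha' : (a : ℂ) + 1 = M + r := by exact_mod_cast ha
  push_cast at hlam
  rw [coeff_opRaise_zero, coeff_eq_solCoeff M n q (by omega) (show (r : ℕ) + 2 * 0 + N = n by omega)]
  linear_combination -2 * (N + 1) * hr + 4 * (M + r) * solCoeff M n q r 0 * (hn - hlam)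
    + (4 * (lam + 1 - r + a + N) + 4 * (M + r)) * solCoeff M n q r 0 * ha'

theorem opLower_coeff {M n : ℕ} {q : Fin 3 → Pol} {lam nu : ℂ} (hlam : nu - lam = (M + n : ℕ))
    {r : Fin 3} {j N : ℕ} (hN : r + 2 * (j + 1) + N = n) :
    (opLower lam q r).coeff (expo3 (M + r + j + 1) j N)
      = 4 * (j + 1) * (nu - M - 3 - j) * solCoeff M n q r (j + 1)
        - (N + 2) * (N + 1) * solCoeff M n q r j
        + 2 * (2 - (r : ℕ)) * (N + 1) * solCoeff M n q (r + 1) j := by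
  have hr : (2 - (r : ℕ) : ℂ) * (q (r + 1)).coeff (expo3 (M + r + j + 1) j (N + 1))
      = (2 - (r : ℕ)) * solCoeff M n q (r + 1) j := by
    by_cases hr : r = 2
    · simp [hr]
    · have := val_add_one hr
      rw [coeff_eq_solCoeff M n q (by omega) (by omega)]
  have hn : ((r : ℕ) : ℂ) + 2 * (j + 1) + N = n := by exact_mod_cast hN
  push_cast at hlam
  rw [coeff_opLower_succ, coeff_eq_solCoeff M n q (by omega) hN,
    coeff_eq_solCoeff M n q rfl (show r + 2 * j + (N + 2) = n by omega)]
  linear_combination 2 * (N + 1) * hr + 4 * (j + 1) * solCoeff M n q r (j + 1) * (hn - hlam)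

theorem fRec_iff {M n : ℕ} {q : Fin 3 → Pol} (hw : HasWeight M n q) {lam nu : ℂ}
    (hlam : nu - lam = (M + n : ℕ)) :
    (∀ r, opRaise lam q r = 0 ∧ opLower lam q r = 0) ↔
      FRec M n nu (solCoeff M n q 0) (solCoeff M n q 1) (solCoeff M n q 2) := by
  have v1 : ((1 : Fin 3) : ℕ) = 1 := rfl
  have v2 : ((2 : Fin 3) : ℕ) = 2 := rfl
  have s1 : (1 : Fin 3) - 1 = 0 := rfl
  have s2 : (2 : Fin 3) - 1 = 1 := rfl
  have p1 : (1 : Fin 3) + 1 = 2 := rfl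
  have R (r : Fin 3) (j N : ℕ) (hN : r + 2 * (j + 1) + N = n) :=
    opRaise_coeff_succ (q := q) hlam hN
  have Z (r : Fin 3) (a N : ℕ) (ha : a + 1 = M + r) (hN : r + N = n) :=
    opRaise_coeff_zero (q := q) hlam ha hN
  have L (r : Fin 3) (j N : ℕ) (hN : r + 2 * (j + 1) + N = n) :=
    opLower_coeff (q := q) hlam hN
  have cases3 (r : Fin 3) : r = 0 ∨ r = 1 ∨ r = 2 := by fin_cases r <;> simp
  have v0 : ((0 : Fin 3) : ℕ) = 0 := rfl
  constructor
  · intro h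
    simp only [(h _).1, (h _).2, MvPolynomial.coeff_zero] at R Z L
    refine ⟨?_, ?_, ?_, ?_, ?_, ?_, ?_, ?_, ?_⟩
    · rcases Nat.eq_zero_or_pos M with hM | hM
      · simp [hM]
      · have e := Z 0 (M - 1) n (by rw [v0]; omega) (by rw [v0]; omega)
        rw [v0] at e
        push_cast at e
        linear_combination -e / 4
    · intro j N hN
      have e := R 0 j N (by rw [v0]; omega)
      rw [v0] at e
      push_cast at e
      linear_combination -e
    · intro N hN
      have e := Z 1 M N (by rw [v1]) (by rw [v1]; omega)
      rw [v1, s1] at e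
      push_cast at e
      linear_combination -e
    · intro j N hN
      have e := R 1 j N (by rw [v1]; omega)
      rw [v1, s1] at e
      push_cast at e
      linear_combination -e
    · intro N hN
      have e := Z 2 (M + 1) N (by rw [v2]) (by rw [v2]; omega)
      rw [v2, s2] at e
      push_cast at e
      linear_combination -e
    · intro j N hN
      have e := R 2 j N (by rw [v2]; omega)
      rw [v2, s2] at e
      push_cast at e
      linear_combination -e
    · intro j N hN
      have e := L 0 j N (by rw [v0]; omega)
      rw [v0, zero_add] at e
      push_cast at e
      linear_combination -e
    · intro j N hN
      have e := L 1 j N (by rw [v1]; omega)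
      rw [v1, p1] at e
      push_cast at e
      linear_combination -e
    · intro j N hN
      have e := L 2 j N (by rw [v2]; omega)
      rw [v2] at e
      push_cast at e
      linear_combination -e
  · intro h r
    refine ⟨?_, ?_⟩
    · ext d
      rw [eq_expo3 d, MvPolynomial.coeff_zero]
      by_contra hne
      refine hne (hw.opRaise lam r fun ha hc => hne ?_)
      generalize d 0 = a, d 1 = b, d 2 = N at *
      cases b with
      | zero =>
        have hN : (r : ℕ) + N = n := by omega
        rw [Z r a N (by omega) hN]
        obtain rfl | rfl | rfl := cases3 r
        · rw [v0]
          push_cast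
          linear_combination 4 * h.raise₀_zero
        · have e := h.raise₁_zero N (by rw [v1] at hN; omega)
          rw [v1, s1]
          push_cast
          linear_combination e
        · have e := h.raise₂_zero N (by rw [v2] at hN; omega)
          rw [v2, s2]
          push_cast
          linear_combination e
      | succ j =>
        obtain rfl : a = M + r + j := by omega
        have hN : r + 2 * (j + 1) + N = n := by omega
        rw [R r j N hN]
        obtain rfl | rfl | rfl := cases3 r
        · have e := h.raise₀ j N (by rw [v0] at hN; omega)
          rw [v0]
          push_cast
          linear_combination e
        · have e := h.raise₁ j N (by rw [v1] at hN; omega)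
          rw [v1, s1]
          push_cast
          linear_combination e
        · have e := h.raise₂ j N (by rw [v2] at hN; omega)
          rw [v2, s2]
          push_cast
          linear_combination e
    · ext d
      rw [eq_expo3 d, MvPolynomial.coeff_zero]
      by_contra hne
      refine hne (hw.opLower lam r fun ha hc => hne ?_)
      generalize d 0 = a, d 1 = j, d 2 = N at *
      obtain rfl : a = M + r + j + 1 := by omega
      have hN : r + 2 * (j + 1) + N = n := by omega
      rw [L r j N hN]
      obtain rfl | rfl | rfl := cases3 r
      · have e := h.lower₀ j N (by rw [v0] at hN; omega)
        rw [v0, zero_add]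
        push_cast
        linear_combination e
      · have e := h.lower₁ j N (by rw [v1] at hN; omega)
        rw [v1, p1]
        push_cast
        linear_combination e
      · have e := h.lower₂ j N (by rw [v2] at hN; omega)
        rw [v2]
        push_cast
        linear_combination e

/-! ### The space of solutions -/

/-- The components, in null coordinates, of a map `V³ → Pol(𝔫₊)`. -/
def components (ψ : V3 →ₗ[ℂ] Pol) (r : Fin 3) : Pol := nullCoord.symm (ψ (u r))

theorem nullCoord_components (ψ : V3 →ₗ[ℂ] Pol) (r : Fin 3) :
    ψ (u r) = nullCoord (components ψ r) := (nullCoord.apply_symm_apply _).symm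

theorem mem_Sol_iff {lam nu : ℂ} {m : ℤ} {ψ : V3 →ₗ[ℂ] Pol} : ψ ∈ Sol lam nu m ↔
    (∀ r d, (components ψ r).coeff d ≠ 0 →
      nu - lam = (d 0 + d 1 + d 2 : ℕ) ∧ (d 0 : ℤ) = d 1 + (m - 1 + (r : ℕ))) ∧
    ∀ r, opRaise lam (components ψ) r = 0 ∧ opLower lam (components ψ) r = 0 := by
  rw [← equivariant_iff lam nu m (nullCoord_components ψ),
    ← forall_nPlusPrime_iff lam (nullCoord_components ψ)]
  exact Iff.rfl

theorem exists_coeff_components_ne_zero {ψ : V3 →ₗ[ℂ] Pol} (h : ψ ≠ 0) :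
    ∃ r d, (components ψ r).coeff d ≠ 0 := by
  by_contra! hc
  refine h (u.ext fun r => ?_)
  rw [nullCoord_components, (MvPolynomial.ext _ _ fun d => hc r d : components ψ r = 0), map_zero,
    LinearMap.zero_apply]

/-- A nonzero solution is homogeneous of degree `ν - λ`, which is an integer `≥ m - 1`. -/
theorem exists_sub_eq {lam nu : ℂ} {M : ℕ} {ψ : V3 →ₗ[ℂ] Pol}
    (hψ : ψ ∈ Sol lam nu (M + 1 : ℕ)) (h : ψ ≠ 0) : ∃ n : ℕ, nu - lam = (M + n : ℕ) := by
  obtain ⟨r, d, hd⟩ := exists_coeff_components_ne_zero h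
  obtain ⟨h1, h2⟩ := (mem_Sol_iff.mp hψ).1 r d hd
  refine ⟨d 0 + d 1 + d 2 - M, ?_⟩
  rw [h1]
  congr 1
  omega

theorem mem_Sol_iff_fRec {lam nu : ℂ} {M n : ℕ} (hlam : nu - lam = (M + n : ℕ))
    {ψ : V3 →ₗ[ℂ] Pol} : ψ ∈ Sol lam nu (M + 1 : ℕ) ↔
      HasWeight M n (components ψ) ∧
      FRec M n nu (solCoeff M n (components ψ) 0) (solCoeff M n (components ψ) 1)
        (solCoeff M n (components ψ) 2) := by
  have hw : (∀ r d, (components ψ r).coeff d ≠ 0 → nu - lam = (d 0 + d 1 + d 2 : ℕ) ∧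
      (d 0 : ℤ) = d 1 + (((M + 1 : ℕ) : ℤ) - 1 + (r : ℕ))) ↔ HasWeight M n (components ψ) := by
    refine forall_congr' fun r => forall_congr' fun d => imp_congr_right fun _ => ?_
    rw [hlam, Nat.cast_inj]
    constructor <;> rintro ⟨h1, h2⟩ <;> constructor <;> omega
  rw [mem_Sol_iff, hw]
  exact and_congr_right fun h => fRec_iff h hlam

/-- The coefficient that determines a solution. -/
def solLead (M n : ℕ) (ψ : V3 →ₗ[ℂ] Pol) : ℂ :=
  FRec.leadCoeff n (solCoeff M n (components ψ) 0) (solCoeff M n (components ψ) 1)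
    (solCoeff M n (components ψ) 2)

theorem solLead_smul_sub (M n : ℕ) (a b : ℂ) (ψ φ : V3 →ₗ[ℂ] Pol) :
    solLead M n (a • ψ - b • φ) = a * solLead M n ψ - b * solLead M n φ := by
  have h (r : Fin 3) (j : ℕ) : solCoeff M n (components (a • ψ - b • φ)) r j
      = a * solCoeff M n (components ψ) r j - b * solCoeff M n (components φ) r j := by
    simp [solCoeff, components]
  simp only [solLead, FRec.leadCoeff, h]
  split_ifs <;> rfl

theorem eq_zero_of_solLead {lam nu : ℂ} {M n : ℕ} (hlam : nu - lam = (M + n : ℕ))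
    {ψ : V3 →ₗ[ℂ] Pol} (hψ : ψ ∈ Sol lam nu (M + 1 : ℕ)) (h : solLead M n ψ = 0) : ψ = 0 := by
  obtain ⟨hw, hF⟩ := (mem_Sol_iff_fRec hlam).mp hψ
  obtain ⟨h₀, h₁, h₂⟩ := hF.eq_zero_of_leadCoeff h
  by_contra hne
  obtain ⟨r, d, hd⟩ := exists_coeff_components_ne_zero hne
  obtain ⟨h1, h2⟩ := hw r d hd
  refine hd ?_
  have hr : (r : ℕ) + 2 * d 1 + d 2 = n := by omega
  rw [eq_expo3 d, coeff_eq_solCoeff M n _ (by omega) hr]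
  obtain rfl | rfl | rfl : r = 0 ∨ r = 1 ∨ r = 2 := by fin_cases r <;> simp
  · exact h₀ _ (by rw [Fin.val_zero] at hr; omega)
  · exact h₁ _ (by rw [Fin.val_one] at hr; omega)
  · exact h₂ _ (by rw [Fin.val_two] at hr; omega)

theorem solLead_ne_zero {lam nu : ℂ} {M n : ℕ} (hlam : nu - lam = (M + n : ℕ))
    {ψ : V3 →ₗ[ℂ] Pol} (hψ : ψ ∈ Sol lam nu (M + 1 : ℕ)) (h : ψ ≠ 0) : solLead M n ψ ≠ 0 :=
  fun h0 => h (eq_zero_of_solLead hlam hψ h0)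

theorem Sol_eq_span {lam nu : ℂ} {M n : ℕ} (hlam : nu - lam = (M + n : ℕ))
    {ψ : V3 →ₗ[ℂ] Pol} (hψ : ψ ∈ Sol lam nu (M + 1 : ℕ)) (h : solLead M n ψ ≠ 0) :
    Sol lam nu (M + 1 : ℕ) = Submodule.span ℂ {ψ} := by
  refine le_antisymm (fun φ hφ => ?_) (by simpa using hψ)
  have hz : solLead M n ψ • φ - solLead M n φ • ψ = 0 :=
    eq_zero_of_solLead hlam (Submodule.sub_mem _ (Submodule.smul_mem _ _ hφ)
      (Submodule.smul_mem _ _ hψ)) (by rw [solLead_smul_sub]; ring)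
  rw [Submodule.mem_span_singleton]
  refine ⟨(solLead M n ψ)⁻¹ * solLead M n φ, ?_⟩
  rw [mul_smul, ← sub_eq_zero.mp hz, smul_smul, inv_mul_cancel₀ h, one_smul]

/-- The polynomial in null coordinates that corresponds to `T_{a-k} g` times `(ζ₁ + iζ₂)^k` for
`k = M + r` and `a = M + n`. -/
def genComponent (M n : ℕ) (g : Fin 3 → Polynomial ℂ) (r : Fin 3) : Pol :=
  if n < r then 0 else ∑ j ∈ Finset.range ((n - r) / 2 + 1),
    MvPolynomial.monomial (expo3 (M + r + j) j (n - r - 2 * j)) (tripleCoeff n g r j)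

theorem monomial_expo3 (a b c : ℕ) (s : ℂ) :
    MvPolynomial.monomial (expo3 a b c) s = C s * (X 0 ^ a * X 1 ^ b * X 2 ^ c : Pol) := by
  rw [MvPolynomial.monomial_eq, Finsupp.prod_fintype _ _ (by simp), Fin.prod_univ_three]
  simp

theorem components_psiOf (M n : ℕ) (g : Fin 3 → Polynomial ℂ) :
    components (psiOf (M + 1) (M + n) g) = genComponent M n g := by
  funext r
  rw [components, AlgEquiv.symm_apply_eq]
  have h1 : psiOf (M + 1) (M + n) g (u r) = Tmap ((n : ℤ) - (r : ℕ)) (g r)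
      * (X 0 + C Complex.I * X 1) ^ (M + r) := by
    rw [psiOf, LinearMap.sum_apply, Finset.sum_eq_single r]
    · rw [LinearMap.comp_apply, hplus, Module.Basis.constr_basis, Pi.single_eq_same,
        LinearMap.mulLeft_apply, Nat.add_sub_cancel]
      congr 2
      push_cast
      ring
    · intro i _ hi
      rw [LinearMap.comp_apply, hplus, Module.Basis.constr_basis, Pi.single_eq_of_ne hi.symm,
        map_zero]
    · simp
  rw [h1, Tmap, genComponent]
  split_ifs with ha hb hb
  · simp
  · omega
  · omega
  · rw [Finset.sum_mul, map_sum, show ((n : ℤ) - (r : ℕ)).toNat = n - r by omega]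
    refine Finset.sum_congr rfl fun j _ => ?_
    have hq : (X 0 ^ 2 + X 1 ^ 2 : Pol) = (X 0 + C Complex.I * X 1) * (X 0 - C Complex.I * X 1) := by
      linear_combination X 1 ^ 2 * C_I_mul_C_I
    rw [monomial_expo3, map_mul, map_mul, map_mul, map_pow, map_pow, map_pow, nullCoord_C,
      nullCoord_X_zero, nullCoord_X_one, nullCoord_X_two, hq, mul_pow, tripleCoeff, pow_add _ (M + r)]
    ring

theorem hasWeight_genComponent (M n : ℕ) (g : Fin 3 → Polynomial ℂ) :
    HasWeight M n (genComponent M n g) := by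
  intro r d hd
  rw [genComponent] at hd
  split_ifs at hd with hn
  · simp at hd
  · rw [MvPolynomial.coeff_sum] at hd
    obtain ⟨j, hj, hne⟩ := Finset.exists_ne_zero_of_sum_ne_zero hd
    rw [Finset.mem_range] at hj
    rw [MvPolynomial.coeff_monomial] at hne
    obtain rfl : expo3 (M + r + j) j (n - r - 2 * j) = d := by
      by_contra h
      exact hne (if_neg h)
    simp only [expo3_zero, expo3_one, expo3_two]
    omega

theorem solCoeff_genComponent {M n : ℕ} (g : Fin 3 → Polynomial ℂ) {r : Fin 3} {j : ℕ}
    (hj : r + 2 * j ≤ n) : solCoeff M n (genComponent M n g) r j = tripleCoeff n g r j := by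
  rw [solCoeff, genComponent, if_neg (by omega), MvPolynomial.coeff_sum, Finset.sum_eq_single j]
  · rw [MvPolynomial.coeff_monomial, if_pos rfl]
  · intro i _ hi
    rw [MvPolynomial.coeff_monomial, if_neg]
    intro h
    exact hi (DFunLike.congr_fun h 1)
  · intro h
    rw [Finset.mem_range] at h
    omega

theorem Sol_eq_span_psiOf {lam nu : ℂ} {M n : ℕ} (hlam : nu - lam = (M + n : ℕ))
    {g : Fin 3 → Polynomial ℂ}
    (hF : FRec M n nu (tripleCoeff n g 0) (tripleCoeff n g 1) (tripleCoeff n g 2))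
    (hl : FRec.leadCoeff n (tripleCoeff n g 0) (tripleCoeff n g 1) (tripleCoeff n g 2) ≠ 0) :
    Sol lam nu (M + 1 : ℕ) = Submodule.span ℂ {psiOf (M + 1) (M + n) g} ∧
      psiOf (M + 1) (M + n) g ≠ 0 := by
  have h₀ (j : ℕ) (hj : 2 * j ≤ n) :
      solCoeff M n (genComponent M n g) 0 j = tripleCoeff n g 0 j :=
    solCoeff_genComponent g (by rw [Fin.val_zero]; omega)
  have h₁ (j : ℕ) (hj : 1 + 2 * j ≤ n) :
      solCoeff M n (genComponent M n g) 1 j = tripleCoeff n g 1 j :=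
    solCoeff_genComponent g (by rw [Fin.val_one]; omega)
  have h₂ (j : ℕ) (hj : 2 + 2 * j ≤ n) :
      solCoeff M n (genComponent M n g) 2 j = tripleCoeff n g 2 j :=
    solCoeff_genComponent g (by rw [Fin.val_two]; omega)
  have hmem : psiOf (M + 1) (M + n) g ∈ Sol lam nu (M + 1 : ℕ) := by
    rw [mem_Sol_iff_fRec hlam, components_psiOf]
    exact ⟨hasWeight_genComponent M n g, hF.congr h₀ h₁ h₂⟩
  have hlead : solLead M n (psiOf (M + 1) (M + n) g) ≠ 0 := by
    rw [solLead, components_psiOf, leadCoeff_congr h₀ h₁ h₂]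
    exact hl
  refine ⟨Sol_eq_span hlam hmem hlead, fun h => hlead ?_⟩
  have := solLead_smul_sub M n 0 0 0 0
  rw [h]
  simpa using this

/-- For `a = m - 1` the recurrence system consists of the equation `(m - 1) ν c = 0` only. -/
theorem fRec_bottom {M : ℕ} {nu : ℂ} (h : M * nu = 0) :
    FRec M 0 nu (tripleCoeff 0 ![1, 0, 0] 0) (tripleCoeff 0 ![1, 0, 0] 1)
      (tripleCoeff 0 ![1, 0, 0] 2) ∧
    FRec.leadCoeff 0 (tripleCoeff 0 ![1, 0, 0] 0) (tripleCoeff 0 ![1, 0, 0] 1)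
      (tripleCoeff 0 ![1, 0, 0] 2) ≠ 0 := by
  refine ⟨⟨by rw [h, zero_mul], ?_, ?_, ?_, ?_, ?_, ?_, ?_, ?_⟩, ?_⟩
  all_goals first | (intros; omega) | skip
  simp [FRec.leadCoeff, tripleCoeff]

theorem paramCondition_of_ne_bot {lam nu : ℂ} {M : ℕ} (h : Sol lam nu (M + 1 : ℕ) ≠ ⊥) :
    ParamCondition lam nu (M + 1) := by
  obtain ⟨ψ, hψ, hne⟩ := Submodule.exists_mem_ne_zero_of_ne_bot h
  obtain ⟨n, hlam⟩ := exists_sub_eq hψ hne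
  rcases Nat.eq_zero_or_pos M with rfl | hM
  · exact Or.inl ⟨rfl, n, by rw [hlam, zero_add]⟩
  · obtain ⟨k, rfl, hk2, hkn⟩ := ((mem_Sol_iff_fRec hlam).mp hψ).2.exists_nu hM
      (solLead_ne_zero hlam hψ hne)
    refine Or.inr ⟨by omega, ⟨k - M - n, ?_, by omega⟩, ?_⟩
    · push_cast at hlam ⊢
      linear_combination -hlam
    · interval_cases k <;> simp

/-- Under the parameter condition one of the explicit triples gives a generator. -/
theorem exists_generator {lam nu : ℂ} {M : ℕ} (h : ParamCondition lam nu (M + 1)) :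
    ∃ n : ℕ, nu - lam = (M + n : ℕ) ∧
      (∃ ψ, ψ ≠ 0 ∧ Sol lam nu (M + 1 : ℕ) = Submodule.span ℂ {ψ}) ∧
      (n = 0 → Sol lam nu (M + 1 : ℕ) = Submodule.span ℂ {psiOf (M + 1) (M + n) ![1, 0, 0]}) ∧
      (M = 0 → 0 < n → Sol lam nu (M + 1 : ℕ)
        = Submodule.span ℂ {psiOf (M + 1) (M + n) (tripleOne lam (M + n))}) ∧
      (0 < M → 0 < n → ∃ l k : ℤ, lam = l ∧ nu = k ∧ Sol lam nu (M + 1 : ℕ)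
        = Submodule.span ℂ {psiOf (M + 1) (M + n) (tripleGeneral l k (M + 1) (M + n))}) := by
  rcases h with ⟨hM, n, hn⟩ | ⟨hM, ⟨l, rfl, hl⟩, hnu⟩
  · obtain rfl : M = 0 := by omega
    have hlam : nu - lam = (0 + n : ℕ) := by rw [hn, zero_add]
    refine ⟨n, hlam, ?_⟩
    rcases Nat.eq_zero_or_pos n with rfl | hpos
    · have h := fRec_bottom (M := 0) (nu := nu) (by simp)
      have hs := Sol_eq_span_psiOf hlam h.1 h.2
      exact ⟨⟨_, hs.2, hs.1⟩, fun _ => hs.1, fun _ h => absurd h (lt_irrefl _),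
        fun h => absurd h (lt_irrefl _)⟩
    · have h := fRec_tripleOne lam hpos
      rw [show lam + n = nu by rw [← hn]; ring] at h
      have hs := Sol_eq_span_psiOf hlam h.1 h.2
      rw [show tripleOne lam n = tripleOne lam (0 + n) by rw [zero_add]] at hs
      exact ⟨⟨_, hs.2, hs.1⟩, fun h => by omega, fun _ _ => hs.1, fun h => absurd h (lt_irrefl _)⟩
  · obtain ⟨k, rfl, hk⟩ : ∃ k : ℕ, nu = k ∧ k ≤ 2 := by
      rcases hnu with rfl | rfl | rfl
      · exact ⟨0, by simp, by omega⟩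
      · exact ⟨1, by simp, by omega⟩
      · exact ⟨2, by simp, by omega⟩
    obtain ⟨n, hn⟩ : ∃ n : ℕ, l = (k : ℤ) - M - n := ⟨(k - M - l).toNat, by omega⟩
    have hlam : (k : ℂ) - (l : ℂ) = (M + n : ℕ) := by
      rw [hn]
      push_cast
      ring
    refine ⟨n, hlam, ?_⟩
    rcases Nat.eq_zero_or_pos n with rfl | hpos
    · obtain rfl : k = 0 := by omega
      have h := fRec_bottom (M := M) (nu := ((0 : ℕ) : ℂ)) (by simp)
      have hs := Sol_eq_span_psiOf hlam h.1 h.2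
      exact ⟨⟨_, hs.2, hs.1⟩, fun _ => hs.1, fun _ h => absurd h (lt_irrefl _),
        fun _ h => absurd h (lt_irrefl _)⟩
    · have h := fRec_tripleGeneral (M := M) (n := n) (k := k) (by omega) hpos hk (by omega)
      rw [← hn] at h
      have hs := Sol_eq_span_psiOf hlam h.1 h.2
      exact ⟨⟨_, hs.2, hs.1⟩, fun h => by omega, fun h => by omega,
        fun _ _ => ⟨l, k, rfl, by simp, hs.1⟩⟩

end FSystem

end

theorem theorem5p1 (lam nu : ℂ) (m : ℕ) (hm : 1 ≤ m) :
    (FSystem.Sol lam nu m ≠ ⊥ ↔ Module.finrank ℂ (FSystem.Sol lam nu m) = 1) ∧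
    (Module.finrank ℂ (FSystem.Sol lam nu m) = 1 ↔ FSystem.ParamCondition lam nu m) ∧
    (FSystem.ParamCondition lam nu m → ∃ a : ℕ, nu - lam = a ∧ m - 1 ≤ a ∧
      (a = m - 1 →
        FSystem.Sol lam nu m = Submodule.span ℂ {FSystem.psiOf m a ![1, 0, 0]}) ∧
      (m = 1 → 0 < a →
        FSystem.Sol lam nu m = Submodule.span ℂ {FSystem.psiOf m a (FSystem.tripleOne lam a)}) ∧
      (1 < m → m - 1 < a → ∃ l n : ℤ, lam = l ∧ nu = n ∧
        FSystem.Sol lam nu m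
          = Submodule.span ℂ {FSystem.psiOf m a (FSystem.tripleGeneral l n m a)})) := by
  obtain ⟨M, rfl⟩ : ∃ M, m = M + 1 := ⟨m - 1, by omega⟩
  have hbot : Module.finrank ℂ (FSystem.Sol lam nu (M + 1 : ℕ)) = 1 →
      FSystem.Sol lam nu (M + 1 : ℕ) ≠ ⊥ := by
    intro h h'
    rw [h', finrank_bot] at h
    exact zero_ne_one h
  have hfin : FSystem.ParamCondition lam nu (M + 1) →
      Module.finrank ℂ (FSystem.Sol lam nu (M + 1 : ℕ)) = 1 := by
    intro h
    obtain ⟨n, -, ⟨ψ, hψ, hs⟩, -⟩ := FSystem.exists_generator h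
    rw [hs, finrank_span_singleton hψ]
  refine ⟨⟨fun h => hfin (FSystem.paramCondition_of_ne_bot h), hbot⟩,
    ⟨fun h => FSystem.paramCondition_of_ne_bot (hbot h), hfin⟩, fun h => ?_⟩
  obtain ⟨n, hlam, -, h1, h2, h3⟩ := FSystem.exists_generator h
  exact ⟨M + n, hlam, by omega, fun ha => h1 (by omega), fun hm ha => h2 (by omega) (by omega),
    fun hm ha => h3 (by omega) (by omega)⟩
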